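/- Let $d\ge 1$, let $V:\mathbb{R}^d\to[0,\infty)$ be measurable with $V(x)\to\infty$ as $|x|\to\infty$, let $\beta>0$, and let $1<p<\infty$, with in addition $p<\frac{d+2}{d-2}$ if $d\ge 3$. Let $X=\{\phi\in H^1(\mathbb{R}^d;\mathbb{C}):\int V|\phi|^2<\infty\}$. Let $L_z=i(x_2\partial_{x_1}-x_1\partial_{x_2})$ if $d\ge 2$ and $L_z=0$ if $d=1$. Let $\Omega\in\mathbb{R}$ satisfy $\Omega=0$ or $0<|\Omega|<\Omega_{\max}$, where $\Omega_{\max}=\sup\{\gamma>0:\ V(x)-\tfrac{\gamma^2}{2}(x_1^2+x_2^2)\to\infty \text{ as } |x|\to\infty\}\le\infty$ (for $d=1$, where there is no rotation, the term $x_1^2+x_2^2$ is replaced by $0$, so that $\Omega$ is unrestricted). For $\phi\in X$ put $$E(\phi)=\tfrac12\|\nabla\phi\|_{L^2}^2+\int V|\phi|^2+\tfrac{2\beta}{p+1}\|\phi\|_{L^{p+1}}^{p+1}-\Omega\int\overline{\phi}\,L_z\phi,\qquad S_{\Omega,\omega}(\phi)=E(\phi)+\omega\|\phi\|_{L^2}^2,$$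 $$\lambda_0(\Omega)=\inf_{0\ne\phi\in X}\frac{\tfrac12\|\nabla\phi\|_{L^2}^2+\int V|\phi|^2-\Omega\int\overline{\phi}L_z\phi}{\|\phi\|_{L^2}^2}.$$ For $\omega<-\lambda_0(\Omega)$ let $\mathcal{A}_{\Omega,\omega}$ be the set of action ground states, that is, of the minimizers of $S_{\Omega,\omega}$ among all nonzero weak solutions $\phi\in X$ of $$-\tfrac12\Delta\phi+V\phi+\beta|\phi|^{p-1}\phi-\Omega L_z\phi+\omega\phi=0.$$ Let $S^g_\Omega(\omega)$ be the value of $S_{\Omega,\omega}$ at the action ground states, $\mathcal{N}_{\Omega,\omega}=\{\|\phi\|_{L^2}^2:\phi\in\mathcal{A}_{\Omega,\omega}\}$ and $\mathcal{I}(\omega)=[\inf\mathcal{N}_{\Omega,\omega},\sup\mathcal{N}_{\Omega,\omega}]$. For $m>0$ let $$\mathcal{E}(m)=\inf\{E(\phi):\phi\in X,\ \|\phi\|_{L^2}^2=m\},\qquad \mathcal{E}^*(m)=\sup_{\omega<-\lambda_0(\Omega)}\ \inf_{\phi\in X}\left[E(\phi)+\omega\left(\|\phi\|_{L^2}^2-m\right)\right].$$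 Then: 1. For every $m>0$, $\mathcal{E}^*(m)=\sup_{\omega<-\lambda_0(\Omega)}\left[S^g_\Omega(\omega)-\omega m\right]$. 2. (Weak duality.) For every $m>0$, $\mathcal{E}^*(m)\le\mathcal{E}(m)$. 3. (Strong duality.) If $\omega<-\lambda_0(\Omega)$, $m\in\mathcal{I}(\omega)$ and $m\in\mathcal{N}_{\Omega,\omega}$, then $\mathcal{E}^*(m)=\mathcal{E}(m)$. -/

import Mathlib

open MeasureTheory Filter Set
open scoped ENNReal

namespace RNLS

/-- Physical space `ℝ^d` with the Euclidean norm. -/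
abbrev Space (d : ℕ) := EuclideanSpace ℝ (Fin d)

noncomputable section

/-! ### Weak derivatives and the energy space -/

/-- `g` is the weak `i`-th partial derivative of `u`: both are locally integrable and
`∫ (∂ᵢ η) u = - ∫ η g` for all real test functions `η ∈ C_c^∞(ℝ^d)`. -/
def IsWeakPartial {d : ℕ} (i : Fin d) (u g : Space d → ℂ) : Prop :=
  LocallyIntegrable u ∧ LocallyIntegrable g ∧
    ∀ η : Space d → ℝ, ContDiff ℝ ((⊤ : ℕ∞) : WithTop ℕ∞) η → HasCompactSupport η →
      ∫ x, (fderiv ℝ η x (EuclideanSpace.single i 1)) • u x = - ∫ x, η x • g x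

open Classical in
/-- The weak `i`-th partial derivative of `u` (unique up to null sets where it exists). -/
def weakPartial {d : ℕ} (i : Fin d) (u : Space d → ℂ) : Space d → ℂ :=
  if h : ∃ g, IsWeakPartial i u g then h.choose else 0

/-- The energy space `X = H¹(ℝ^d) ∩ L²_V(ℝ^d)`, as a set of functions. -/
def energySpace {d : ℕ} (V : Space d → ℝ) : Set (Space d → ℂ) :=
  {u | MemLp u 2 ∧ (∀ i : Fin d, ∃ g, IsWeakPartial i u g ∧ MemLp g 2) ∧
    Integrable (fun x => V x * ‖u x‖ ^ 2)}

/-! ### The rotation -/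

/-- `x₁² + x₂²` for `d ≥ 2`. In dimension one there is no rotation and the value is `0`. -/
def axisDistSq {d : ℕ} (x : Space d) : ℝ :=
  if h : 2 ≤ d then x ⟨0, by omega⟩ ^ 2 + x ⟨1, by omega⟩ ^ 2 else 0

/-- The angular momentum operator: `L_z u = i (x₂ ∂₁ u - x₁ ∂₂ u)` for `d ≥ 2`, and `L_z u = 0`
for `d = 1`. -/
def Lz {d : ℕ} (u : Space d → ℂ) (x : Space d) : ℂ :=
  if h : 2 ≤ d then
    Complex.I * ((x ⟨1, by omega⟩ : ℂ) * weakPartial ⟨0, by omega⟩ u x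
      - (x ⟨0, by omega⟩ : ℂ) * weakPartial ⟨1, by omega⟩ u x)
  else 0

/-- `L_Ω(u) = -Ω ∫ ū L_z u`. The integral is a real number for `u ∈ X`, so taking the real part
only changes the type. -/
def rotationTerm {d : ℕ} (Ω : ℝ) (u : Space d → ℂ) : ℝ :=
  -Ω * (∫ x, (starRingEnd ℂ) (u x) * Lz u x).re

/-- The critical rotation speed
`Ω_max = sup {γ > 0 : V(x) - γ² (x₁² + x₂²) / 2 → ∞ as |x| → ∞} ≤ ∞`. -/
def OmegaMax {d : ℕ} (V : Space d → ℝ) : EReal :=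
  sSup ((fun γ : ℝ => (γ : EReal)) '' {γ : ℝ | 0 < γ ∧
    Tendsto (fun x : Space d => V x - γ ^ 2 / 2 * axisDistSq x) (cocompact (Space d)) atTop})

/-! ### Mass, energy, action -/

/-- The mass `‖u‖²_{L²}`. -/
def mass {d : ℕ} (u : Space d → ℂ) : ℝ := ∫ x, ‖u x‖ ^ 2

/-- The quadratic part of the energy, `½ ‖∇u‖² + ∫ V |u|² + L_Ω(u)`. -/
def quadraticEnergy {d : ℕ} (V : Space d → ℝ) (Ω : ℝ) (u : Space d → ℂ) : ℝ :=
  1 / 2 * (∑ i : Fin d, ∫ x, ‖weakPartial i u x‖ ^ 2) + (∫ x, V x * ‖u x‖ ^ 2) + rotationTerm Ω u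

/-- The energy `E(u) = ½ ‖∇u‖² + ∫ V |u|² + (2β/(p+1)) ‖u‖_{L^{p+1}}^{p+1} + L_Ω(u)`, as an
extended real, so that no convention on divergent integrals enters. -/
def energy {d : ℕ} (V : Space d → ℝ) (p β Ω : ℝ) (u : Space d → ℂ) : EReal :=
  (quadraticEnergy V Ω u : EReal) +
    ((ENNReal.ofReal (2 * β / (p + 1)) * (∫⁻ x, ‖u x‖ₑ ^ (p + 1)) : ℝ≥0∞) : EReal)

/-- The action `S_{Ω,ω}(u) = E(u) + ω ‖u‖²_{L²}`. -/
def action {d : ℕ} (V : Space d → ℝ) (p β Ω ω : ℝ) (u : Space d → ℂ) : EReal :=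
  energy V p β Ω u + ((ω * mass u : ℝ) : EReal)

/-- `λ₀(Ω)`, the infimum over `0 ≠ u ∈ X` of the Rayleigh quotient of `-½Δ + V - Ω L_z`. -/
def lambda0 {d : ℕ} (V : Space d → ℝ) (Ω : ℝ) : EReal :=
  ⨅ u ∈ {u | u ∈ energySpace V ∧ ¬ u =ᵐ[volume] 0},
    ((quadraticEnergy V Ω u / mass u : ℝ) : EReal)

/-! ### Action ground states -/

/-- `u` is a weak solution in `X` of
`-½ Δu + V u + β |u|^{p-1} u - Ω L_z u + ω u = 0`, tested against all `v ∈ X ∩ L^{p+1}`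
(which is all of `X` when `p` is energy-subcritical). -/
def IsStationary {d : ℕ} (V : Space d → ℝ) (p β Ω ω : ℝ) (u : Space d → ℂ) : Prop :=
  u ∈ energySpace V ∧
    ∀ v ∈ energySpace V, MemLp v (ENNReal.ofReal (p + 1)) →
      ∫ x, (1 / 2 * (∑ i : Fin d, weakPartial i u x * (starRingEnd ℂ) (weakPartial i v x))
        + ((V x : ℂ) * u x + (β : ℂ) * ((‖u x‖ ^ (p - 1) : ℝ) : ℂ) * u x
          - (Ω : ℂ) * Lz u x + (ω : ℂ) * u x) * (starRingEnd ℂ) (v x)) = 0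

/-- The set `𝒜_{Ω,ω}` of action ground states: the minimizers of the action among the nonzero
solutions of the stationary equation. -/
def actionGroundStates {d : ℕ} (V : Space d → ℝ) (p β Ω ω : ℝ) : Set (Space d → ℂ) :=
  {u | (IsStationary V p β Ω ω u ∧ ¬ u =ᵐ[volume] 0) ∧
    ∀ v, IsStationary V p β Ω ω v → ¬ v =ᵐ[volume] 0 →
      action V p β Ω ω u ≤ action V p β Ω ω v}

/-- The set `𝒩_{Ω,ω}` of the masses of the action ground states. -/
def groundMasses {d : ℕ} (V : Space d → ℝ) (p β Ω ω : ℝ) : Set ℝ :=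
  mass '' actionGroundStates V p β Ω ω

/-- `ℐ(ω) = [inf 𝒩_{Ω,ω}, sup 𝒩_{Ω,ω}]`, the bounds being taken in the extended reals. -/
def massInterval {d : ℕ} (V : Space d → ℝ) (p β Ω ω : ℝ) : Set ℝ :=
  {m | (⨅ n ∈ groundMasses V p β Ω ω, (n : EReal)) ≤ (m : EReal) ∧
    (m : EReal) ≤ ⨆ n ∈ groundMasses V p β Ω ω, (n : EReal)}

/-- `S^g_Ω(ω)`, the common value of the action at the action ground states (`+∞` if there is
none). -/
def groundAction {d : ℕ} (V : Space d → ℝ) (p β Ω ω : ℝ) : EReal :=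
  ⨅ u ∈ actionGroundStates V p β Ω ω, action V p β Ω ω u

/-! ### The energy problem and its dual -/

/-- The minimal energy at mass `m`, `ℰ(m) = inf {E(u) : u ∈ X, ‖u‖²_{L²} = m}`. -/
def minEnergy {d : ℕ} (V : Space d → ℝ) (p β Ω m : ℝ) : EReal :=
  ⨅ u ∈ {u | u ∈ energySpace V ∧ mass u = m}, energy V p β Ω u

/-- The Lagrangian `L(u, ω) = E(u) + ω (‖u‖²_{L²} - m)`. -/
def lagrangian {d : ℕ} (V : Space d → ℝ) (p β Ω m : ℝ) (u : Space d → ℂ) (ω : ℝ) : EReal :=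
  energy V p β Ω u + ((ω * (mass u - m) : ℝ) : EReal)

/-- The dual value `ℰ*(m) = sup_{ω < -λ₀(Ω)} inf_{u ∈ X} L(u, ω)`. -/
def dualEnergy {d : ℕ} (V : Space d → ℝ) (p β Ω m : ℝ) : EReal :=
  ⨆ ω ∈ {ω : ℝ | (ω : EReal) < -lambda0 V Ω}, ⨅ u ∈ energySpace V, lagrangian V p β Ω m u ω

end

end RNLS

/-!
Below the threshold `-λ₀(Ω)`, the action ground states minimize the action over the whole energy
space `X`, not only among the stationary solutions. Given this, everything is bookkeeping: the
Lagrangian at mass `m` is the action minus the constant `ω m`, so its infimum over `X` is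
`S^g_Ω(ω) - ω m`; weak duality is immediate; and a ground state of mass `m` is at the same time a
minimizer of the Lagrangian and a competitor for `ℰ(m)`, which closes the gap.

To prove the claim it suffices to find *one* minimizer of the action over `X` that is nonzero and
stationary (`RotationBound.exists_actionGroundState`).

* *Coercivity.* A rotation below the critical speed satisfies `½ Ω² (x₁² + x₂²) ≤ θ² V + C` for some
  `θ < 1` (`exists_rotationBound`). Young's inequality then bounds the rotation term by
  `θ (½ ‖∇u‖² + ∫ V |u|²) + (C/θ) ‖u‖²`, so after a shift by a multiple of the mass the quadratic
  energy is an inner product equivalent to that of `X` (`RotationBound.le_shiftedForm`).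
* *Existence.* The action is this inner product, minus a multiple of the mass, plus the convex
  defocusing power, which controls the mass where `V` is small. Sets bounded in `X` are
  precompact in `L²` because `V → ∞` (`RotationBound.exists_subseq_massForm`). Hence a minimizing
  sequence has an `L²`-Cauchy subsequence, which is Cauchy in `X` by the parallelogram identity and
  convexity (`exists_minimizer_of_compact`). No Sobolev embedding enters: the power is lower
  semicontinuous by Fatou's lemma.
* *Stationarity.* The first variation in all directions of `X ∩ L^{p+1}` vanishes
  (`RotationBound.isStationary_of_minimizer`).
* *Nontriviality.* As `ω < -λ₀(Ω)`, the quadratic part of the action is negative at some `u ∈ X`.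
  The truncations `u / (1 + δ² |u|²)` are bounded and converge to `u` in `X` as `δ → 0`, so it is
  negative at a function in `L^{p+1}`. At a small multiple of that function the action is negative,
  whereas it vanishes at `0` (`RotationBound.exists_action_neg`).

What is needed about Sobolev functions comes from their behaviour under translation: if `u` and its
weak derivative `∂ₑ u` are in `L²`, then `u(· + s e) - u` is the integral over `[0, s]` of the
translates of `∂ₑ u` (`translate_sub_eq_integral`), so `s ↦ u(· + s e)` is differentiable in `L²`.
This gives the equicontinuity in the compactness theorem, the integration by parts behind the
symmetry of `L_z`, and the chain rule for truncations, with no approximation by smooth functions.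
-/

namespace RNLS

open scoped Topology InnerProductSpace Convolution

/-! ### Translations and weak derivatives -/

section Translation

variable {d : ℕ}

/-- The weak derivative in the direction of an arbitrary vector `e`. For a basis vector this is
`IsWeakPartial`. -/
def IsWeakDeriv (e : Space d) (u g : Space d → ℂ) : Prop :=
  LocallyIntegrable u ∧ LocallyIntegrable g ∧
    ∀ η : Space d → ℝ, ContDiff ℝ (⊤ : ℕ∞) η → HasCompactSupport η →
      ∫ x, (fderiv ℝ η x e) • u x = - ∫ x, η x • g x

lemma isWeakPartial_iff {i : Fin d} {u g : Space d → ℂ} :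
    IsWeakPartial i u g ↔ IsWeakDeriv (EuclideanSpace.single i 1) u g := Iff.rfl

/-- The pairing of a locally integrable function with a moving test function is differentiable,
being a convolution with the reflected test function. -/
lemma hasDerivAt_integral_translate {η : Space d → ℝ} (hη : ContDiff ℝ (⊤ : ℕ∞) η)
    (hc : HasCompactSupport η) {w : Space d → ℂ} (hw : LocallyIntegrable w) (e : Space d) (s : ℝ) :
    HasDerivAt (fun s : ℝ => ∫ x, η (x - s • e) • w x)
      (- ∫ x, (fderiv ℝ η (x - s • e) e) • w x) s := by
  let η' : Space d → ℝ := fun z => η (-z)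
  have hη' : ContDiff ℝ (⊤ : ℕ∞) η' := hη.comp contDiff_neg
  have hc' : HasCompactSupport η' := hc.comp_homeomorph (Homeomorph.neg _)
  have h1 := hc'.hasFDerivAt_convolution_left (ContinuousLinearMap.lsmul ℝ ℝ : ℝ →L[ℝ] ℂ →L[ℝ] ℂ)
    (hη'.of_le (by simp)) hw (μ := volume) (s • e)
  have h2 : HasDerivAt (fun s : ℝ => s • e) e s := by
    simpa using (hasDerivAt_id s).smul_const e
  have h3 := h1.comp_hasDerivAt s h2
  have hd : ∀ z, fderiv ℝ η' z = - fderiv ℝ η (-z) := by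
    intro z
    have := ((hη.differentiable (by simp)) (-z)).hasFDerivAt.comp z (hasFDerivAt_id z).neg
    rw [HasFDerivAt.fderiv (f := η') this]
    ext v
    simp
  have hfun : (fun s : ℝ => ∫ x, η (x - s • e) • w x) =
      (η' ⋆[ContinuousLinearMap.lsmul ℝ ℝ, volume] w) ∘ fun s : ℝ => s • e := by
    funext s
    simp only [Function.comp_apply]
    rw [convolution_lsmul_swap]
    simp [η']
  have hval : - ∫ x, (fderiv ℝ η (x - s • e) e) • w x =
      ((fderiv ℝ η' ⋆[(ContinuousLinearMap.lsmul ℝ ℝ : ℝ →L[ℝ] ℂ →L[ℝ] ℂ).precompL (Space d),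
        volume] w) (s • e)) e := by
    rw [convolution_eq_swap, ContinuousLinearMap.integral_apply]
    · rw [← integral_neg]
      congr 1
      funext x
      rw [hd]
      simp [ContinuousLinearMap.precompL_apply]
    · have := (hc'.fderiv ℝ).convolutionExists_left
        ((ContinuousLinearMap.lsmul ℝ ℝ : ℝ →L[ℝ] ℂ →L[ℝ] ℂ).precompL (Space d))
        (hη'.continuous_fderiv (by simp)) hw (s • e)
      exact this.integrable_swap
  rw [hfun, hval]
  exact h3

lemma measurePreserving_translate (h : Space d) :
    MeasurePreserving (fun x : Space d => x + h) volume volume :=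
  measurePreserving_add_right volume h

/-- Translation `f ↦ f (· + h)` on `L²`. -/
noncomputable def translate (h : Space d) :
    Lp ℂ 2 (volume : Measure (Space d)) →ₗᵢ[ℂ] Lp ℂ 2 (volume : Measure (Space d)) :=
  Lp.compMeasurePreservingₗᵢ ℂ (fun x : Space d => x + h) (measurePreserving_translate h)

lemma coeFn_translate (h : Space d) (f : Lp ℂ 2 (volume : Measure (Space d))) :
    translate h f =ᵐ[volume] fun x => f (x + h) :=
  Lp.coeFn_compMeasurePreserving f (measurePreserving_translate h)

lemma translate_toLp (h : Space d) {f : Space d → ℂ} (hf : MemLp f 2) :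
    translate h (hf.toLp f) =
      (hf.comp_measurePreserving (measurePreserving_translate h)).toLp _ := rfl

@[simp]
lemma translate_zero (f : Lp ℂ 2 (volume : Measure (Space d))) : translate 0 f = f := by
  ext1
  filter_upwards [coeFn_translate 0 f] with x hx
  simp [hx]

lemma continuous_translate (e : Space d) (f : Lp ℂ 2 (volume : Measure (Space d))) :
    Continuous fun s : ℝ => translate (s • e) f := by
  let g : ℝ → C(Space d, Space d) := fun s => ⟨fun x => x + s • e, by fun_prop⟩
  have hg : Continuous g := by
    apply ContinuousMap.continuous_of_continuous_uncurry
    change Continuous fun q : ℝ × Space d => q.2 + q.1 • e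
    fun_prop
  exact (continuous_const (y := f)).compMeasurePreservingLp hg
    (fun s => measurePreserving_translate (s • e)) (by simp)

/-- The pairing of `L²` with a test function. -/
lemma inner_toLp_ofReal {η : Space d → ℝ} (hη : MemLp (fun x => (η x : ℂ)) 2)
    (f : Lp ℂ 2 (volume : Measure (Space d))) :
    ⟪hη.toLp _, f⟫_ℂ = ∫ x, η x • f x := by
  rw [L2.inner_def]
  apply integral_congr_ae
  filter_upwards [hη.coeFn_toLp] with x hx
  simp [hx, mul_comm]

lemma memLp_ofReal_test {η : Space d → ℝ} (hη : ContDiff ℝ (⊤ : ℕ∞) η) (hc : HasCompactSupport η) :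
    MemLp (fun x => (η x : ℂ)) 2 (volume : Measure (Space d)) := by
  apply Continuous.memLp_of_hasCompactSupport
  · exact Complex.continuous_ofReal.comp hη.continuous
  · exact hc.comp_left (g := fun r : ℝ => (r : ℂ)) (by simp)

/-- Elements of `L²` are determined by their pairings with test functions. -/
lemma Lp_ext_test {f g : Lp ℂ 2 (volume : Measure (Space d))}
    (h : ∀ η : Space d → ℝ, ContDiff ℝ (⊤ : ℕ∞) η → HasCompactSupport η →
      ∫ x, η x • f x = ∫ x, η x • g x) : f = g := by
  ext1
  exact ae_eq_of_integral_contDiff_smul_eq ((Lp.memLp f).locallyIntegrable (by norm_num))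
    ((Lp.memLp g).locallyIntegrable (by norm_num)) h

/-- Along its weak derivative, an `L²` function moves by the fundamental theorem of calculus. -/
lemma translate_sub_eq_integral {e : Space d} {u g : Space d → ℂ} (hw : IsWeakDeriv e u g)
    (hu : MemLp u 2 volume) (hg : MemLp g 2 volume) (s : ℝ) :
    translate (s • e) (hu.toLp u) - hu.toLp u =
      ∫ r in (0 : ℝ)..s, translate (r • e) (hg.toLp g) := by
  apply Lp_ext_test
  intro η hη hc
  have hm := memLp_ofReal_test hη hc
  have key : ∀ (w : Space d → ℂ) (hw2 : MemLp w 2) (r : ℝ),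
      ⟪hm.toLp _, translate (r • e) (hw2.toLp w)⟫_ℂ = ∫ x, η (x - r • e) • w x := by
    intro w hw2 r
    rw [inner_toLp_ofReal, ← integral_add_right_eq_self (fun x => η (x - r • e) • w x) (r • e)]
    apply integral_congr_ae
    rw [translate_toLp]
    filter_upwards [(hw2.comp_measurePreserving (measurePreserving_translate (r • e))).coeFn_toLp]
      with x hx
    simp [hx]
  have hder : ∀ r : ℝ, HasDerivAt (fun r : ℝ => ⟪hm.toLp _, translate (r • e) (hu.toLp u)⟫_ℂ)
      ⟪hm.toLp _, translate (r • e) (hg.toLp g)⟫_ℂ r := by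
    intro r
    simp_rw [key]
    convert hasDerivAt_integral_translate hη hc hw.1 e r using 1
    have := hw.2.2 (fun x => η (x - r • e)) (hη.comp (contDiff_id.sub contDiff_const))
      (hc.comp_homeomorph (Homeomorph.subRight (r • e)))
    rw [eq_comm, neg_eq_iff_eq_neg, ← this]
    congr 1
    funext x
    have h1 := ((hη.differentiable (by simp)) (x - r • e)).hasFDerivAt.comp x
      ((hasFDerivAt_id x).sub_const (r • e))
    rw [HasFDerivAt.fderiv (f := fun x => η (x - r • e)) h1]
    simp
  rw [← inner_toLp_ofReal hm, ← inner_toLp_ofReal hm, inner_sub_right]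
  have hcont := continuous_translate e (hg.toLp g)
  have h2 := ((innerSL ℂ (hm.toLp _)).restrictScalars ℝ).intervalIntegral_comp_comm
    (hcont.intervalIntegrable (μ := volume) 0 s)
  have h3 := intervalIntegral.integral_eq_sub_of_hasDerivAt (fun r _ => hder r)
    ((continuous_const.inner hcont).intervalIntegrable 0 s)
  simp only [ContinuousLinearMap.coe_restrictScalars', innerSL_apply_apply] at h2
  rw [← h2, h3]
  simp

lemma norm_translate_sub_le {e : Space d} {u g : Space d → ℂ} (hw : IsWeakDeriv e u g)
    (hu : MemLp u 2 volume) (hg : MemLp g 2 volume) (s : ℝ) :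
    ‖translate (s • e) (hu.toLp u) - hu.toLp u‖ ≤ |s| * ‖hg.toLp g‖ := by
  rw [translate_sub_eq_integral hw hu hg s]
  have := intervalIntegral.norm_integral_le_of_norm_le_const (a := (0 : ℝ)) (b := s)
    (f := fun r => translate (r • e) (hg.toLp g)) (C := ‖hg.toLp g‖) (by intro x _; simp)
  simpa [mul_comm] using this

lemma hasDerivAt_translate {e : Space d} {u g : Space d → ℂ} (hw : IsWeakDeriv e u g)
    (hu : MemLp u 2 volume) (hg : MemLp g 2 volume) :
    HasDerivAt (fun s : ℝ => translate (s • e) (hu.toLp u)) (hg.toLp g) 0 := by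
  have h : (fun s : ℝ => translate (s • e) (hu.toLp u)) =
      fun s => hu.toLp u + ∫ r in (0 : ℝ)..s, translate (r • e) (hg.toLp g) := by
    funext s
    rw [← translate_sub_eq_integral hw hu hg s]
    abel
  rw [h]
  have hcont := continuous_translate e (hg.toLp g)
  have := intervalIntegral.integral_hasDerivAt_right (hcont.intervalIntegrable (μ := volume) 0 0)
    hcont.stronglyMeasurable.stronglyMeasurableAtFilter hcont.continuousAt
  simpa using this.const_add (hu.toLp u)

end Translation

/-! ### Calculus of weak derivatives -/

section WeakDerivative

variable {d : ℕ} {e : Space d} {u v g k : Space d → ℂ}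

lemma contDiff_fderiv_test {η : Space d → ℝ} (hη : ContDiff ℝ (⊤ : ℕ∞) η) (e : Space d) :
    ContDiff ℝ (⊤ : ℕ∞) fun x => fderiv ℝ η x e :=
  (hη.fderiv_right (by simp)).clm_apply contDiff_const

lemma hasCompactSupport_fderiv_test {η : Space d → ℝ} (hc : HasCompactSupport η) (e : Space d) :
    HasCompactSupport fun x => fderiv ℝ η x e :=
  (hc.fderiv ℝ).comp_left (g := fun L : Space d →L[ℝ] ℝ => L e) (by simp)

lemma integrable_test_smul {η : Space d → ℝ} (hη : ContDiff ℝ (⊤ : ℕ∞) η) (hc : HasCompactSupport η)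
    (hu : LocallyIntegrable u) : Integrable fun x => η x • u x :=
  hu.integrable_smul_left_of_hasCompactSupport hη.continuous hc

lemma IsWeakDeriv.add (h : IsWeakDeriv e u g) (h' : IsWeakDeriv e v k) :
    IsWeakDeriv e (u + v) (g + k) := by
  refine ⟨h.1.add h'.1, h.2.1.add h'.2.1, fun η hη hc => ?_⟩
  have hη' := contDiff_fderiv_test hη e
  have hc' := hasCompactSupport_fderiv_test hc e
  simp only [Pi.add_apply, smul_add]
  rw [integral_add (integrable_test_smul hη' hc' h.1) (integrable_test_smul hη' hc' h'.1),
    integral_add (integrable_test_smul hη hc h.2.1) (integrable_test_smul hη hc h'.2.1),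
    h.2.2 η hη hc, h'.2.2 η hη hc]
  ring

lemma IsWeakDeriv.const_smul (h : IsWeakDeriv e u g) (c : ℂ) :
    IsWeakDeriv e (c • u) (c • g) := by
  refine ⟨h.1.smul c, h.2.1.smul c, fun η hη hc => ?_⟩
  simp only [Pi.smul_apply]
  simp_rw [smul_comm _ c]
  rw [integral_smul, integral_smul, h.2.2 η hη hc, smul_neg]

lemma isWeakDeriv_zero : IsWeakDeriv e 0 0 := by
  refine ⟨locallyIntegrable_zero, locallyIntegrable_zero, fun η hη hc => ?_⟩
  simp

lemma IsWeakDeriv.ae_eq (h : IsWeakDeriv e u g) (h' : IsWeakDeriv e u k) : g =ᵐ[volume] k := by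
  refine ae_eq_of_integral_contDiff_smul_eq h.2.1 h'.2.1 fun η hη hc => ?_
  have h1 := h.2.2 η hη hc
  rw [h'.2.2 η hη hc] at h1
  exact (neg_injective h1).symm

lemma IsWeakDeriv.congr (h : IsWeakDeriv e u g) (hu : u =ᵐ[volume] v) (hg : g =ᵐ[volume] k) :
    IsWeakDeriv e v k := by
  refine ⟨h.1.congr hu, h.2.1.congr hg, fun η hη hc => ?_⟩
  have h1 : ∫ x, (fderiv ℝ η x e) • v x = ∫ x, (fderiv ℝ η x e) • u x :=
    integral_congr_ae (by filter_upwards [hu] with x hx; rw [hx])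
  have h2 : ∫ x, η x • k x = ∫ x, η x • g x :=
    integral_congr_ae (by filter_upwards [hg] with x hx; rw [hx])
  rw [h1, h2, h.2.2 η hη hc]

lemma IsWeakPartial.exists_isWeakPartial {i : Fin d} (h : ∃ g, IsWeakPartial i u g) :
    IsWeakPartial i u (weakPartial i u) := by
  rw [weakPartial, dif_pos h]
  exact h.choose_spec

lemma IsWeakPartial.weakPartial_ae_eq {i : Fin d} (h : IsWeakPartial i u g) :
    weakPartial i u =ᵐ[volume] g :=
  IsWeakDeriv.ae_eq (IsWeakPartial.exists_isWeakPartial ⟨g, h⟩) h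

/-- The weak derivative in the direction `e` is `∑ᵢ eᵢ ∂ᵢ u`. -/
lemma isWeakDeriv_of_isWeakPartial {G : Fin d → Space d → ℂ} (hu : LocallyIntegrable u)
    (h : ∀ i, IsWeakPartial i u (G i)) (e : Space d) :
    IsWeakDeriv e u (fun x => ∑ i, e i • G i x) := by
  refine ⟨hu, locallyIntegrable_finsetSum _ fun i _ => (h i).2.1.smul (e i), fun η hη hc => ?_⟩
  have he : e = ∑ i, e i • EuclideanSpace.single i (1 : ℝ) := by
    ext j
    simp [Pi.single_apply]
  have h1 : ∀ x, (fderiv ℝ η x e) • u x =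
      ∑ i, e i • ((fderiv ℝ η x (EuclideanSpace.single i 1)) • u x) := by
    intro x
    conv_lhs => rw [he]
    rw [map_sum, Finset.sum_smul]
    refine Finset.sum_congr rfl fun i _ => ?_
    rw [map_smul, smul_eq_mul, mul_smul]
  have h2 : ∀ x, η x • (∑ i, e i • G i x) = ∑ i, e i • (η x • G i x) := by
    intro x
    rw [Finset.smul_sum]
    exact Finset.sum_congr rfl fun i _ => smul_comm _ _ _
  simp_rw [h1, h2]
  rw [integral_finsetSum, integral_finsetSum, ← Finset.sum_neg_distrib]
  · refine Finset.sum_congr rfl fun i _ => ?_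
    rw [integral_smul, integral_smul, (h i).2.2 η hη hc, smul_neg]
  · intro i _
    exact (integrable_test_smul hη hc (h i).2.1).smul (e i)
  · intro i _
    exact (integrable_test_smul (contDiff_fderiv_test hη _)
      (hasCompactSupport_fderiv_test hc _) hu).smul (e i)

/-- Weak differentiation is a closed operator in `L²`. -/
lemma isWeakDeriv_of_tendsto {U G : ℕ → Lp ℂ 2 (volume : Measure (Space d))}
    {U' G' : Lp ℂ 2 (volume : Measure (Space d))} (hU : Tendsto U atTop (𝓝 U'))
    (hG : Tendsto G atTop (𝓝 G')) (h : ∀ n, IsWeakDeriv e (U n) (G n)) :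
    IsWeakDeriv e U' G' := by
  refine ⟨(Lp.memLp U').locallyIntegrable (by norm_num),
    (Lp.memLp G').locallyIntegrable (by norm_num), fun η hη hc => ?_⟩
  have hm := memLp_ofReal_test hη hc
  have hm' := memLp_ofReal_test (contDiff_fderiv_test hη e) (hasCompactSupport_fderiv_test hc e)
  rw [← inner_toLp_ofReal hm, ← inner_toLp_ofReal hm']
  refine tendsto_nhds_unique (tendsto_const_nhds.inner hU) ?_
  have : ∀ n, ⟪hm'.toLp _, U n⟫_ℂ = - ⟪hm.toLp _, G n⟫_ℂ := by
    intro n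
    rw [inner_toLp_ofReal hm, inner_toLp_ofReal hm']
    exact (h n).2.2 η hη hc
  simp_rw [this]
  exact (tendsto_const_nhds.inner hG).neg

/-- Weak differentiability follows from convergence of the difference quotients in the sense of
distributions. -/
lemma isWeakDeriv_of_tendsto_slope (hu : LocallyIntegrable u) (hg : LocallyIntegrable g)
    (h : ∀ η : Space d → ℝ, ContDiff ℝ (⊤ : ℕ∞) η → HasCompactSupport η →
      HasDerivAt (fun s : ℝ => ∫ x, η x • u (x + s • e)) (∫ x, η x • g x) 0) :
    IsWeakDeriv e u g := by
  refine ⟨hu, hg, fun η hη hc => ?_⟩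
  have h1 := hasDerivAt_integral_translate hη hc hu e 0
  have h2 : (fun s : ℝ => ∫ x, η (x - s • e) • u x) = fun s => ∫ x, η x • u (x + s • e) := by
    funext s
    rw [← integral_add_right_eq_self (fun x => η (x - s • e) • u x) (s • e)]
    simp
  rw [h2] at h1
  have := h1.unique (h η hη hc)
  simp only [zero_smul, sub_zero] at this
  rw [← this, neg_neg]

/-- Integration by parts in `H¹` against a weight `c` that is invariant in the direction of
differentiation. -/
lemma integral_weakDeriv_mul_conj {c : Space d → ℝ} (hc : ∀ (s : ℝ) x, c (x + s • e) = c x)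
    (hug : IsWeakDeriv e u g) (hvk : IsWeakDeriv e v k)
    (hu : MemLp u 2 volume) (hg : MemLp g 2 volume) (hv : MemLp v 2 volume) (hk : MemLp k 2 volume)
    (hcu : MemLp (fun x => (c x : ℂ) * u x) 2 volume)
    (hcv : MemLp (fun x => (c x : ℂ) * v x) 2 volume) :
    ∫ x, (c x : ℂ) * g x * (starRingEnd ℂ) (v x) =
      - ∫ x, (c x : ℂ) * u x * (starRingEnd ℂ) (k x) := by
  have h1 := hasDerivAt_translate hug hu hg
  have h2 := hasDerivAt_translate hvk hv hk
  have h3 : HasDerivAt (fun s : ℝ => ⟪hcv.toLp _, translate (s • e) (hu.toLp u)⟫_ℂ)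
      ⟪hcv.toLp _, hg.toLp g⟫_ℂ 0 := by
    simpa using (hasDerivAt_const (0 : ℝ) (hcv.toLp _)).inner ℂ h1
  have h2' : HasDerivAt (fun s : ℝ => translate ((-s) • e) (hv.toLp v)) (-hk.toLp k) 0 := by
    have h0 : HasDerivAt (fun s : ℝ => translate (s • e) (hv.toLp v)) (hk.toLp k) (-0) := by
      simpa using h2
    have h00 := h0.scomp (0 : ℝ) (hasDerivAt_neg (0 : ℝ))
    rw [neg_one_smul] at h00
    exact h00
  have h4 : HasDerivAt (fun s : ℝ => ⟪translate ((-s) • e) (hv.toLp v), hcu.toLp _⟫_ℂ)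
      ⟪-hk.toLp k, hcu.toLp _⟫_ℂ 0 := by
    simpa using h2'.inner ℂ (hasDerivAt_const (0 : ℝ) (hcu.toLp _))
  have h5 : (fun s : ℝ => ⟪hcv.toLp _, translate (s • e) (hu.toLp u)⟫_ℂ) =
      fun s : ℝ => ⟪translate ((-s) • e) (hv.toLp v), hcu.toLp _⟫_ℂ := by
    funext s
    rw [L2.inner_def, L2.inner_def, translate_toLp, translate_toLp]
    refine Eq.trans ?_ (integral_add_right_eq_self _ (s • e))
    have hq := (measurePreserving_translate (s • e)).quasiMeasurePreserving
    have a1 := hq.ae (hv.comp_measurePreserving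
      (measurePreserving_translate ((-s) • e))).coeFn_toLp
    have a2 := hq.ae hcu.coeFn_toLp
    apply integral_congr_ae
    filter_upwards [hcv.coeFn_toLp, (hu.comp_measurePreserving
      (measurePreserving_translate (s • e))).coeFn_toLp, a1, a2] with x b1 b2 b3 b4
    rw [b1, b2, b3, b4]
    simp [hc]
    ring
  rw [h5] at h3
  have h6 := h3.unique h4
  rw [inner_neg_left, L2.inner_def, L2.inner_def] at h6
  calc ∫ x, (c x : ℂ) * g x * (starRingEnd ℂ) (v x) = _ := ?_
    _ = _ := h6
    _ = _ := ?_
  · apply integral_congr_ae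
    filter_upwards [hcv.coeFn_toLp, hg.coeFn_toLp] with x b1 b2
    rw [b1, b2]
    simp
    ring
  · congr 1
    apply integral_congr_ae
    filter_upwards [hcu.coeFn_toLp, hk.coeFn_toLp] with x b1 b2
    rw [b1, b2]
    simp

end WeakDerivative

/-! ### Compactness in `L²` -/

section Compactness

lemma eLpNorm_two_sq {α F : Type*} [MeasurableSpace α] [NormedAddCommGroup F] (f : α → F)
    (μ : Measure α) : eLpNorm f 2 μ ^ 2 = ∫⁻ x, ‖f x‖ₑ ^ 2 ∂μ := by
  have := eLpNorm_nnreal_pow_eq_lintegral (f := f) (μ := μ) (p := 2) (by norm_num)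
  simpa using this

lemma sq_lintegral_le {α : Type*} [MeasurableSpace α] (μ : Measure α) [IsProbabilityMeasure μ]
    {f : α → ℝ≥0∞} (hf : AEMeasurable f μ) : (∫⁻ x, f x ∂μ) ^ 2 ≤ ∫⁻ x, f x ^ 2 ∂μ := by
  have h := ENNReal.lintegral_mul_le_Lp_mul_Lq μ Real.HolderConjugate.two_two hf
    (aemeasurable_const (b := (1 : ℝ≥0∞)))
  simp only [Pi.mul_apply, mul_one, ENNReal.rpow_ofNat, one_pow, lintegral_one, measure_univ,
    ENNReal.one_rpow] at h
  calc (∫⁻ x, f x ∂μ) ^ 2 ≤ ((∫⁻ x, f x ^ 2 ∂μ) ^ (1 / 2 : ℝ)) ^ 2 := by gcongr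
    _ = _ := by
      rw [← ENNReal.rpow_natCast, ← ENNReal.rpow_mul]
      norm_num

/-- Bounded sequences in a separable Hilbert space have weakly convergent subsequences. -/
lemma exists_subseq_tendsto_inner {H : Type*} [NormedAddCommGroup H] [InnerProductSpace ℂ H]
    [CompleteSpace H] [TopologicalSpace.SeparableSpace H] {x : ℕ → H} {M : ℝ}
    (hx : ∀ n, ‖x n‖ ≤ M) :
    ∃ φ : ℕ → ℕ, StrictMono φ ∧ ∃ a : H, ∀ w, Tendsto (fun n => ⟪w, x (φ n)⟫_ℂ) atTop
      (𝓝 ⟪w, a⟫_ℂ) := by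
  have hs := WeakDual.isSeqCompact_closedBall ℂ H (0 : StrongDual ℂ H) M
  obtain ⟨a, -, φ, hφ, ha⟩ := hs (x := fun n => StrongDual.toWeakDual
    (InnerProductSpace.toDual ℂ H (x n))) (by
      intro n
      simpa using hx n)
  refine ⟨φ, hφ, (InnerProductSpace.toDual ℂ H).symm (WeakDual.toStrongDual a), fun w => ?_⟩
  have h1 := (WeakDual.eval_continuous w).continuousAt.tendsto.comp ha
  have h2 := (Complex.continuous_conj.tendsto _).comp h1
  have e1 : ∀ y : H, ⟪w, y⟫_ℂ = (starRingEnd ℂ) ⟪y, w⟫_ℂ := fun y => (inner_conj_symm w y).symm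
  simp_rw [e1]
  rw [InnerProductSpace.toDual_symm_apply]
  exact h2

variable {d : ℕ}

/-- The uniform probability measure on the ball of radius `r` around the origin. -/
noncomputable def ballMeasure (d : ℕ) (r : ℝ) : Measure (Space d) :=
  (volume (Metric.ball (0 : Space d) r))⁻¹ • volume.restrict (Metric.ball 0 r)

/-- The average of `u` over the ball of radius `r` around `x`. -/
noncomputable def ballAverage (r : ℝ) (u : Space d → ℂ) (x : Space d) : ℂ :=
  ∫ h, u (x + h) ∂ballMeasure d r

lemma isProbabilityMeasure_ballMeasure {r : ℝ} (hr : 0 < r) :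
    IsProbabilityMeasure (ballMeasure d r) := by
  constructor
  rw [ballMeasure, Measure.smul_apply, Measure.restrict_apply_univ, smul_eq_mul]
  exact ENNReal.inv_mul_cancel (Metric.measure_ball_pos _ _ hr).ne' measure_ball_lt_top.ne

lemma integrable_ballMeasure {u : Space d → ℂ} (hu : LocallyIntegrable u) {r : ℝ} (hr : 0 < r)
    (x : Space d) : Integrable (fun h => u (x + h)) (ballMeasure d r) := by
  refine Integrable.smul_measure ?_ (ENNReal.inv_ne_top.2 (Metric.measure_ball_pos _ _ hr).ne')
  have h1 : IntegrableOn u (Metric.closedBall x r) :=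
    hu.integrableOn_isCompact (isCompact_closedBall _ _)
  have h2 := (measurePreserving_add_left volume x).integrableOn_comp_preimage
    (measurableEmbedding_addLeft x) (f := u) (s := Metric.closedBall x r)
  refine (h2.2 h1).mono_set ?_
  intro y hy
  simp at hy ⊢
  exact hy.le

lemma ballAverage_eq_inner {r : ℝ} (x : Space d) (f : Lp ℂ 2 (volume : Measure (Space d))) :
    ballAverage r f x = ((volume (Metric.ball (0 : Space d) r)).toReal⁻¹ : ℂ) *
      ⟪indicatorConstLp 2 (measurableSet_ball (x := x) (ε := r)) measure_ball_lt_top.ne (1 : ℂ),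
        f⟫_ℂ := by
  rw [L2.inner_indicatorConstLp_one, ballAverage, ballMeasure, integral_smul_measure]
  have h2 := (measurePreserving_add_left volume x).setIntegral_preimage_emb
    (measurableEmbedding_addLeft x) f (Metric.ball x r)
  have h3 : (fun h => x + h) ⁻¹' Metric.ball x r = Metric.ball 0 r := by
    ext y; simp
  rw [h3] at h2
  rw [h2, Complex.real_smul]
  simp

lemma stronglyMeasurable_ballAverage (r : ℝ) (f : Lp ℂ 2 (volume : Measure (Space d))) :
    StronglyMeasurable (ballAverage r f) := by
  have : StronglyMeasurable fun q : Space d × Space d => f (q.1 + q.2) :=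
    (Lp.stronglyMeasurable f).comp_measurable (measurable_fst.add measurable_snd)
  have : SFinite (ballMeasure d r) := by unfold ballMeasure; infer_instance
  exact StronglyMeasurable.integral_prod_right (f := fun x h => f (x + h)) (by assumption)

/-- The distance to the ball average is controlled by small translations. -/
lemma eLpNorm_sub_ballAverage_le {r ε : ℝ} (hr : 0 < r)
    (f : Lp ℂ 2 (volume : Measure (Space d)))
    (hf : ∀ h : Space d, ‖h‖ < r → ‖translate h f - f‖ ≤ ε) :
    eLpNorm (fun x => f x - ballAverage r f x) 2 volume ≤ ENNReal.ofReal ε := by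
  have := isProbabilityMeasure_ballMeasure (d := d) hr
  have hm := Lp.stronglyMeasurable f
  have hm2 : StronglyMeasurable fun q : Space d × Space d => f q.1 - f (q.1 + q.2) :=
    (hm.comp_measurable measurable_fst).sub
      (hm.comp_measurable (measurable_fst.add measurable_snd))
  rw [← ENNReal.pow_le_pow_left_iff (two_ne_zero), eLpNorm_two_sq]
  calc ∫⁻ x, ‖f x - ballAverage r f x‖ₑ ^ 2
      ≤ ∫⁻ x, ∫⁻ h, ‖f x - f (x + h)‖ₑ ^ 2 ∂ballMeasure d r := by
        refine lintegral_mono fun x => ?_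
        have h1 : f x - ballAverage r f x = ∫ h, (f x - f (x + h)) ∂ballMeasure d r := by
          rw [integral_sub (integrable_const _) (integrable_ballMeasure
            ((Lp.memLp f).locallyIntegrable (by norm_num)) hr x)]
          simp [ballAverage]
        rw [h1]
        refine le_trans (pow_le_pow_left' (enorm_integral_le_lintegral_enorm _) 2)
          (sq_lintegral_le _ ?_)
        exact ((hm2.comp_measurable measurable_prodMk_left).enorm).aemeasurable
    _ = ∫⁻ h, (∫⁻ x, ‖f x - f (x + h)‖ₑ ^ 2) ∂ballMeasure d r := by
        rw [lintegral_lintegral_swap]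
        exact (hm2.enorm.pow_const 2).aemeasurable
    _ ≤ ∫⁻ _, ENNReal.ofReal ε ^ 2 ∂ballMeasure d r := by
        refine lintegral_mono_ae ?_
        have hB : ∀ᵐ h ∂ballMeasure d r, h ∈ Metric.ball (0 : Space d) r :=
          Measure.ae_smul_measure (ae_restrict_mem measurableSet_ball) _
        filter_upwards [hB] with h hh
        have h1 := hf h (by simpa using hh)
        rw [← eLpNorm_two_sq (fun x => f x - f (x + h))]
        gcongr
        have h2 : eLpNorm (fun x => f x - f (x + h)) 2 volume = ‖translate h f - f‖ₑ := by
          rw [Lp.enorm_def, eLpNorm_congr_ae (Lp.coeFn_sub _ _)]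
          rw [← eLpNorm_neg]
          apply eLpNorm_congr_ae
          filter_upwards [coeFn_translate h f] with x hx
          simp [hx]
        rw [h2, ← ofReal_norm]
        exact ENNReal.ofReal_le_ofReal h1
    _ = ENNReal.ofReal ε ^ 2 := by simp

lemma ballAverage_sub {r : ℝ} (f g : Lp ℂ 2 (volume : Measure (Space d))) (x : Space d) :
    ballAverage r (f - g : Lp ℂ 2 volume) x = ballAverage r f x - ballAverage r g x := by
  simp only [ballAverage_eq_inner, inner_sub_right, mul_sub]

/-- Ball averages turn weak convergence into strong convergence on bounded sets. -/
lemma tendsto_eLpNorm_ballAverage {r R M : ℝ} {f : ℕ → Lp ℂ 2 (volume : Measure (Space d))}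
    {g : Lp ℂ 2 (volume : Measure (Space d))} (hM : ∀ n, ‖f n‖ ≤ M)
    (h : ∀ w, Tendsto (fun n => ⟪w, f n⟫_ℂ) atTop (𝓝 ⟪w, g⟫_ℂ)) :
    Tendsto (fun n => eLpNorm (ballAverage r (f n - g : Lp ℂ 2 volume)) 2
      (volume.restrict (Metric.ball 0 R))) atTop (𝓝 0) := by
  let C : ℝ := (volume (Metric.ball (0 : Space d) r)).toReal⁻¹ *
    ((volume (Metric.ball (0 : Space d) r)).toReal ^ (1 / 2 : ℝ) * (M + ‖g‖))
  have hb : ∀ n x, ‖ballAverage r (f n - g : Lp ℂ 2 volume) x‖ ≤ C := by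
    intro n x
    rw [ballAverage_eq_inner, norm_mul]
    have e1 : ‖((volume (Metric.ball (0 : Space d) r)).toReal⁻¹ : ℂ)‖ =
        (volume (Metric.ball (0 : Space d) r)).toReal⁻¹ := by
      rw [norm_inv, Complex.norm_real, Real.norm_of_nonneg ENNReal.toReal_nonneg]
    rw [e1]
    refine mul_le_mul_of_nonneg_left ?_ (by positivity)
    refine (norm_inner_le_norm _ _).trans ?_
    rw [norm_indicatorConstLp (by norm_num) (by norm_num)]
    have e2 : (volume : Measure (Space d)).real (Metric.ball x r) =
        (volume (Metric.ball (0 : Space d) r)).toReal := by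
      rw [Measure.real, Measure.addHaar_ball_center]
    rw [e2]
    simp only [norm_one, one_mul, ENNReal.toReal_ofNat]
    gcongr
    exact (norm_sub_le _ _).trans (by gcongr; exact hM n)
  have hp : ∀ x, Tendsto (fun n => ballAverage r (f n - g : Lp ℂ 2 volume) x) atTop (𝓝 0) := by
    intro x
    simp_rw [ballAverage_eq_inner, inner_sub_right]
    have h1 := h (indicatorConstLp 2 (measurableSet_ball (x := x) (ε := r))
      measure_ball_lt_top.ne (1 : ℂ))
    have := (h1.sub (tendsto_const_nhds (x := ⟪indicatorConstLp 2
      (measurableSet_ball (x := x) (ε := r)) measure_ball_lt_top.ne (1 : ℂ), g⟫_ℂ))).const_mul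
        ((volume (Metric.ball (0 : Space d) r)).toReal⁻¹ : ℂ)
    simpa using this
  have hC : IsFiniteMeasure ((volume : Measure (Space d)).restrict (Metric.ball 0 R)) :=
    ⟨by simpa using measure_ball_lt_top⟩
  have key : Tendsto (fun n => ∫⁻ x in Metric.ball 0 R,
      ‖ballAverage r (f n - g : Lp ℂ 2 volume) x‖ₑ ^ 2) atTop
      (𝓝 (∫⁻ _ in Metric.ball (0 : Space d) R, 0)) := by
    refine tendsto_lintegral_of_dominated_convergence (fun _ => ENNReal.ofReal C ^ 2)
      (fun n => ((stronglyMeasurable_ballAverage r _).enorm.pow_const 2)) ?_ ?_ ?_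
    · intro n
      refine Eventually.of_forall fun x => ?_
      have := hb n x
      simp only [← ofReal_norm]
      gcongr
    · rw [lintegral_const]
      exact ENNReal.mul_ne_top (by simp) (measure_ne_top _ _)
    · refine Eventually.of_forall fun x => ?_
      have h1 := (hp x).enorm
      have h2 := ((ENNReal.continuous_pow 2).tendsto _).comp h1
      rw [enorm_zero, zero_pow two_ne_zero] at h2
      exact h2
  simp only [lintegral_zero, ← eLpNorm_two_sq] at key
  have h3 := ((ENNReal.continuous_rpow_const (y := 1 / 2)).tendsto _).comp key
  simp only [Function.comp_def] at h3
  rw [ENNReal.zero_rpow_of_pos (by norm_num)] at h3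
  refine h3.congr fun n => ?_
  rw [← ENNReal.rpow_natCast, ← ENNReal.rpow_mul]
  norm_num

/-- The sequential form of the Riesz–Kolmogorov compactness theorem in `L²`. Along a weakly
convergent subsequence, tightness reduces the claim to a ball, equicontinuity reduces it to ball
averages, and these converge strongly. -/
theorem exists_subseq_cauchySeq_of_equicontinuous_of_tight
    {f : ℕ → Lp ℂ 2 (volume : Measure (Space d))} {M : ℝ} (hM : ∀ n, ‖f n‖ ≤ M)
    (heq : ∀ ε > 0, ∃ r > 0, ∀ n, ∀ h : Space d, ‖h‖ < r → ‖translate h (f n) - f n‖ ≤ ε)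
    (htight : ∀ ε > 0, ∃ R, ∀ n, eLpNorm (f n) 2
      (volume.restrict (Metric.ball 0 R)ᶜ) ≤ ENNReal.ofReal ε) :
    ∃ φ : ℕ → ℕ, StrictMono φ ∧ CauchySeq (f ∘ φ) := by
  have : Fact ((2 : ℝ≥0∞) ≠ ⊤) := ⟨by norm_num⟩
  obtain ⟨φ, hφ, a, ha⟩ := exists_subseq_tendsto_inner hM
  refine ⟨φ, hφ, ?_⟩
  rw [Metric.cauchySeq_iff]
  intro ε hε
  obtain ⟨r, hr, hr'⟩ := heq (ε / 8) (by positivity)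
  obtain ⟨R, hR⟩ := htight (ε / 8) (by positivity)
  have hlim := tendsto_eLpNorm_ballAverage (r := r) (R := R) (fun n => hM (φ n)) ha
  have hev := hlim.eventually_lt_const (u := ENNReal.ofReal (ε / 8)) (by simpa using by positivity)
  obtain ⟨N, hN⟩ := eventually_atTop.1 hev
  refine ⟨N, fun n hn m hm => ?_⟩
  set D : Lp ℂ 2 (volume : Measure (Space d)) := f (φ n) - f (φ m) with hD
  have hBm : MeasurableSet (Metric.ball (0 : Space d) R) := measurableSet_ball
  have hDm : AEStronglyMeasurable D volume := Lp.aestronglyMeasurable D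
  have hae : (D : Space d → ℂ) =ᵐ[volume] f (φ n) - f (φ m) := Lp.coeFn_sub _ _
  -- the part outside the ball
  have h1 : eLpNorm D 2 (volume.restrict (Metric.ball 0 R)ᶜ) ≤ ENNReal.ofReal (ε / 4) := by
    rw [eLpNorm_congr_ae (ae_restrict_of_ae hae)]
    refine (eLpNorm_sub_le (Lp.aestronglyMeasurable _).restrict
      (Lp.aestronglyMeasurable _).restrict (by norm_num)).trans ?_
    refine (add_le_add (hR _) (hR _)).trans ?_
    rw [← ENNReal.ofReal_add (by positivity) (by positivity)]
    exact ENNReal.ofReal_le_ofReal (by linarith)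
  -- the distance to the ball average
  have h2 : eLpNorm (fun x => D x - ballAverage r D x) 2 (volume.restrict (Metric.ball 0 R)) ≤
      ENNReal.ofReal (ε / 4) := by
    refine (eLpNorm_mono_measure _ Measure.restrict_le_self).trans ?_
    refine eLpNorm_sub_ballAverage_le hr D fun h hh => ?_
    have e1 : translate h D - D = (translate h (f (φ n)) - f (φ n)) -
        (translate h (f (φ m)) - f (φ m)) := by
      rw [hD, map_sub]; abel
    rw [e1]
    refine (norm_sub_le _ _).trans ?_
    linarith [hr' (φ n) h hh, hr' (φ m) h hh]
  -- the ball average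
  have h3 : eLpNorm (ballAverage r D) 2 (volume.restrict (Metric.ball 0 R)) ≤
      ENNReal.ofReal (ε / 4) := by
    have e1 : ballAverage r D = ballAverage r (f (φ n) - a : Lp ℂ 2 volume) -
        ballAverage r (f (φ m) - a : Lp ℂ 2 volume) := by
      funext x
      rw [Pi.sub_apply, ← ballAverage_sub, hD]
      congr 2
      exact (sub_sub_sub_cancel_right _ _ _).symm
    rw [e1]
    refine (eLpNorm_sub_le (stronglyMeasurable_ballAverage r _).aestronglyMeasurable
      (stronglyMeasurable_ballAverage r _).aestronglyMeasurable (by norm_num)).trans ?_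
    refine (add_le_add (hN n hn).le (hN m hm).le).trans ?_
    rw [← ENNReal.ofReal_add (by positivity) (by positivity)]
    exact ENNReal.ofReal_le_ofReal (by linarith)
  have h4 : eLpNorm D 2 (volume.restrict (Metric.ball 0 R)) ≤ ENNReal.ofReal (ε / 2) := by
    have e1 : (D : Space d → ℂ) = (fun x => D x - ballAverage r D x) + ballAverage r D := by
      funext x; simp
    rw [e1]
    refine (eLpNorm_add_le (hDm.sub
      (stronglyMeasurable_ballAverage r _).aestronglyMeasurable).restrict
      (stronglyMeasurable_ballAverage r _).aestronglyMeasurable (by norm_num)).trans ?_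
    refine (add_le_add h2 h3).trans ?_
    rw [← ENNReal.ofReal_add (by positivity) (by positivity)]
    exact ENNReal.ofReal_le_ofReal (by linarith)
  have h5 : eLpNorm D 2 volume ≤ ENNReal.ofReal (ε / 2) + ENNReal.ofReal (ε / 4) := by
    have e1 : (D : Space d → ℂ) = (Metric.ball 0 R).indicator D + (Metric.ball 0 R)ᶜ.indicator D :=
      (Set.indicator_self_add_compl _ _).symm
    conv_lhs => rw [e1]
    refine (eLpNorm_add_le (hDm.indicator hBm) (hDm.indicator hBm.compl) (by norm_num)).trans ?_
    rw [eLpNorm_indicator_eq_eLpNorm_restrict hBm, eLpNorm_indicator_eq_eLpNorm_restrict hBm.compl]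
    exact add_le_add h4 h1
  rw [← ENNReal.ofReal_add (by positivity) (by positivity)] at h5
  rw [Function.comp_apply, Function.comp_apply, dist_eq_norm, ← hD, Lp.norm_def]
  have := ENNReal.toReal_le_of_le_ofReal (by positivity) h5
  linarith

end Compactness

/-! ### The energy space and the rotating quadratic form -/

section EnergySpace

variable {d : ℕ} {V : Space d → ℝ} {u v w : Space d → ℂ}

lemma integrable_mul_conj {f g : Space d → ℂ} (hf : MemLp f 2 volume) (hg : MemLp g 2 volume) :
    Integrable fun x => f x * (starRingEnd ℂ) (g x) :=
  hf.integrable_mul (hg.star)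

lemma isWeakPartial_weakPartial (hu : u ∈ energySpace V) (i : Fin d) :
    IsWeakPartial i u (weakPartial i u) := by
  obtain ⟨g, hg, -⟩ := hu.2.1 i
  exact IsWeakPartial.exists_isWeakPartial ⟨g, hg⟩

lemma memLp_weakPartial (hu : u ∈ energySpace V) (i : Fin d) : MemLp (weakPartial i u) 2 := by
  obtain ⟨g, hg, hg2⟩ := hu.2.1 i
  exact hg2.ae_eq hg.weakPartial_ae_eq.symm

lemma memLp_of_integrable_mul_norm_sq {W : Space d → ℝ} (hW : Measurable W) (hW0 : ∀ x, 0 ≤ W x)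
    (hu : AEStronglyMeasurable u volume) (h : Integrable fun x => W x * ‖u x‖ ^ 2) :
    MemLp (fun x => (√(W x) : ℂ) * u x) 2 volume := by
  rw [memLp_two_iff_integrable_sq_norm]
  · refine h.congr (Eventually.of_forall fun x => ?_)
    simp only [norm_mul, Complex.norm_real, mul_pow, Real.norm_eq_abs, sq_abs]
    rw [Real.sq_sqrt (hW0 x)]
  · exact (Complex.measurable_ofReal.comp hW.sqrt).aestronglyMeasurable.mul hu

lemma memLp_sqrt_mul (hVm : Measurable V) (hV0 : ∀ x, 0 ≤ V x) (hu : u ∈ energySpace V) :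
    MemLp (fun x => (√(V x) : ℂ) * u x) 2 volume :=
  memLp_of_integrable_mul_norm_sq hVm hV0 hu.1.1 hu.2.2

lemma add_mem_energySpace (hVm : Measurable V) (hV0 : ∀ x, 0 ≤ V x) (hu : u ∈ energySpace V)
    (hv : v ∈ energySpace V) : u + v ∈ energySpace V := by
  refine ⟨hu.1.add hv.1, fun i => ⟨weakPartial i u + weakPartial i v, ?_, ?_⟩, ?_⟩
  · exact IsWeakDeriv.add (isWeakPartial_weakPartial hu i) (isWeakPartial_weakPartial hv i)
  · exact (memLp_weakPartial hu i).add (memLp_weakPartial hv i)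
  · have h := (memLp_sqrt_mul hVm hV0 hu).add (memLp_sqrt_mul hVm hV0 hv)
    rw [memLp_two_iff_integrable_sq_norm h.1] at h
    refine h.congr (Eventually.of_forall fun x => ?_)
    simp only [Pi.add_apply, ← mul_add, norm_mul, Complex.norm_real, mul_pow, Real.norm_eq_abs,
      sq_abs]
    rw [Real.sq_sqrt (hV0 x)]

lemma smul_mem_energySpace (c : ℂ) (hu : u ∈ energySpace V) : c • u ∈ energySpace V := by
  refine ⟨hu.1.const_smul c, fun i => ⟨c • weakPartial i u, ?_, ?_⟩, ?_⟩
  · exact IsWeakDeriv.const_smul (isWeakPartial_weakPartial hu i) c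
  · exact (memLp_weakPartial hu i).const_smul c
  · refine (hu.2.2.const_mul (‖c‖ ^ 2)).congr (Eventually.of_forall fun x => ?_)
    simp only [Pi.smul_apply, smul_eq_mul, norm_mul, mul_pow]
    ring

lemma zero_mem_energySpace : (0 : Space d → ℂ) ∈ energySpace V :=
  ⟨MemLp.zero', fun _ => ⟨0, isWeakDeriv_zero, MemLp.zero'⟩, by simp⟩

/-- The energy space as a real vector space. -/
def energySubmodule (V : Space d → ℝ) (hVm : Measurable V) (hV0 : ∀ x, 0 ≤ V x) :
    Submodule ℝ (Space d → ℂ) where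
  carrier := energySpace V
  add_mem' := add_mem_energySpace hVm hV0
  zero_mem' := zero_mem_energySpace
  smul_mem' c u hu := by
    have := smul_mem_energySpace (c : ℂ) hu
    rwa [Complex.coe_smul] at this

lemma weakPartial_add_ae (hu : u ∈ energySpace V) (hv : v ∈ energySpace V) (i : Fin d) :
    weakPartial i (u + v) =ᵐ[volume] fun x => weakPartial i u x + weakPartial i v x :=
  IsWeakPartial.weakPartial_ae_eq
    (IsWeakDeriv.add (isWeakPartial_weakPartial hu i) (isWeakPartial_weakPartial hv i))

lemma weakPartial_smul_ae (c : ℂ) (hu : u ∈ energySpace V) (i : Fin d) :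
    weakPartial i (c • u) =ᵐ[volume] fun x => c * weakPartial i u x :=
  IsWeakPartial.weakPartial_ae_eq
    (IsWeakDeriv.const_smul (isWeakPartial_weakPartial hu i) c)

lemma Lz_ae_of_weakPartial_ae {G : Fin d → Space d → ℂ}
    (h : ∀ i, weakPartial i u =ᵐ[volume] G i) :
    Lz u =ᵐ[volume] fun x => if h : 2 ≤ d then
      Complex.I * ((x ⟨1, by omega⟩ : ℂ) * G ⟨0, by omega⟩ x
        - (x ⟨0, by omega⟩ : ℂ) * G ⟨1, by omega⟩ x) else 0 := by
  filter_upwards [ae_all_iff.2 h] with x hx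
  simp only [Lz, hx]

lemma Lz_add_ae (hu : u ∈ energySpace V) (hv : v ∈ energySpace V) :
    Lz (u + v) =ᵐ[volume] fun x => Lz u x + Lz v x := by
  filter_upwards [Lz_ae_of_weakPartial_ae (weakPartial_add_ae hu hv)] with x hx
  rw [hx]
  simp only [Lz]
  split_ifs
  · ring
  · simp

lemma Lz_smul_ae (c : ℂ) (hu : u ∈ energySpace V) :
    Lz (c • u) =ᵐ[volume] fun x => c * Lz u x := by
  filter_upwards [Lz_ae_of_weakPartial_ae (weakPartial_smul_ae c hu)] with x hx
  rw [hx]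
  simp only [Lz]
  split_ifs
  · ring
  · simp

lemma axisDistSq_nonneg (x : Space d) : 0 ≤ axisDistSq x := by
  unfold axisDistSq
  split_ifs <;> positivity

/-- The rotation is subordinate to the trap: `½ Ω² (x₁² + x₂²) ≤ θ² V + C` with `θ < 1`. The
measurability and nonnegativity of `V` are included. -/
structure RotationBound (V : Space d → ℝ) (Ω θ C : ℝ) : Prop where
  measurable : Measurable V
  nonneg : ∀ x, 0 ≤ V x
  pos : 0 < θ
  lt_one : θ < 1
  const_nonneg : 0 ≤ C
  le : ∀ x, Ω ^ 2 * axisDistSq x / 2 ≤ θ ^ 2 * V x + C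

variable {Ω θ C : ℝ}

/-- The density of the weak form of `-½ Δ + V - Ω L_z`. -/
noncomputable def formDensity (V : Space d → ℝ) (Ω : ℝ) (u v : Space d → ℂ) (x : Space d) : ℂ :=
  1 / 2 * (∑ i : Fin d, weakPartial i u x * (starRingEnd ℂ) (weakPartial i v x))
    + ((V x : ℂ) * u x - (Ω : ℂ) * Lz u x) * (starRingEnd ℂ) (v x)

/-- `½ ‖∇u‖² + ∫ V |u|²`. -/
noncomputable def gradPot (V : Space d → ℝ) (u : Space d → ℂ) : ℝ :=
  1 / 2 * (∑ i : Fin d, ∫ x, ‖weakPartial i u x‖ ^ 2) + ∫ x, V x * ‖u x‖ ^ 2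

lemma gradPot_nonneg (hV0 : ∀ x, 0 ≤ V x) (u : Space d → ℂ) : 0 ≤ gradPot V u := by
  have h1 : 0 ≤ ∑ i : Fin d, ∫ x, ‖weakPartial i u x‖ ^ 2 :=
    Finset.sum_nonneg fun i _ => integral_nonneg fun x => by positivity
  have h2 : 0 ≤ ∫ x, V x * ‖u x‖ ^ 2 := integral_nonneg fun x => mul_nonneg (hV0 x) (by positivity)
  unfold gradPot
  linarith

lemma mass_nonneg (u : Space d → ℂ) : 0 ≤ mass u := integral_nonneg fun x => by positivity

namespace RotationBound

lemma memLp_coord_mul (h : RotationBound V Ω θ C) (hu : u ∈ energySpace V) (j : Fin d)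
    (hj : ∀ x : Space d, x j ^ 2 ≤ axisDistSq x) :
    MemLp (fun x => ((Ω * x j : ℝ) : ℂ) * u x) 2 volume := by
  have hm : AEStronglyMeasurable (fun x : Space d => ((Ω * x j : ℝ) : ℂ) * u x) volume :=
    (by fun_prop : Continuous fun x : Space d => ((Ω * x j : ℝ) : ℂ)).aestronglyMeasurable.mul
      hu.1.1
  rw [memLp_two_iff_integrable_sq_norm hm]
  have hu1 := hu.1
  rw [memLp_two_iff_integrable_sq_norm hu1.1] at hu1
  refine ((hu.2.2.const_mul (2 * θ ^ 2)).add (hu1.const_mul (2 * C))).mono' (hm.norm.pow 2)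
    (Eventually.of_forall fun x => ?_)
  simp only [norm_mul, Complex.norm_real, mul_pow, Real.norm_eq_abs, sq_abs, abs_pow,
    abs_norm, Pi.add_apply]
  have h1 := h.le x
  have h2 := mul_le_mul_of_nonneg_left (hj x) (sq_nonneg Ω)
  have h3 : Ω ^ 2 * x j ^ 2 ≤ 2 * θ ^ 2 * V x + 2 * C := by linarith
  nlinarith [mul_le_mul_of_nonneg_right h3 (sq_nonneg ‖u x‖)]

lemma integrable_rot (h : RotationBound V Ω θ C) (hu : u ∈ energySpace V)
    (hv : v ∈ energySpace V) :
    Integrable fun x => (Ω : ℂ) * Lz u x * (starRingEnd ℂ) (v x) := by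
  by_cases hd : 2 ≤ d
  · have h0 := h.memLp_coord_mul hv ⟨0, by omega⟩ (fun x => by
      simp only [axisDistSq, hd, dif_pos]; nlinarith [sq_nonneg (x ⟨1, by omega⟩)])
    have h1 := h.memLp_coord_mul hv ⟨1, by omega⟩ (fun x => by
      simp only [axisDistSq, hd, dif_pos]; nlinarith [sq_nonneg (x ⟨0, by omega⟩)])
    have i1 := integrable_mul_conj (memLp_weakPartial hu ⟨0, by omega⟩) h1
    have i0 := integrable_mul_conj (memLp_weakPartial hu ⟨1, by omega⟩) h0
    refine ((i1.sub i0).const_mul Complex.I).congr (Eventually.of_forall fun x => ?_)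
    simp only [Lz, hd, dif_pos, Pi.sub_apply, map_mul, Complex.conj_ofReal]
    push_cast
    ring
  · simp [Lz, hd]

/-- `L_z` is symmetric: in `x₂ ∂₁` and in `x₁ ∂₂` the coordinate is constant in the direction of
differentiation, so that each term can be integrated by parts. -/
lemma integral_rot_symm (h : RotationBound V Ω θ C) (hu : u ∈ energySpace V)
    (hv : v ∈ energySpace V) :
    ∫ x, (Ω : ℂ) * Lz u x * (starRingEnd ℂ) (v x) =
      (starRingEnd ℂ) (∫ x, (Ω : ℂ) * Lz v x * (starRingEnd ℂ) (u x)) := by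
  by_cases hd : 2 ≤ d
  · have hj0 : ∀ x : Space d, x ⟨0, by omega⟩ ^ 2 ≤ axisDistSq x := fun x => by
      simp only [axisDistSq, hd, dif_pos]; nlinarith [sq_nonneg (x ⟨1, by omega⟩)]
    have hj1 : ∀ x : Space d, x ⟨1, by omega⟩ ^ 2 ≤ axisDistSq x := fun x => by
      simp only [axisDistSq, hd, dif_pos]; nlinarith [sq_nonneg (x ⟨0, by omega⟩)]
    have key : ∀ (i j : Fin d), i ≠ j → (∀ x : Space d, x j ^ 2 ≤ axisDistSq x) →
        Integrable (fun x => ((Ω * x j : ℝ) : ℂ) * weakPartial i u x * (starRingEnd ℂ) (v x)) ∧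
        Integrable (fun x => ((Ω * x j : ℝ) : ℂ) * u x * (starRingEnd ℂ) (weakPartial i v x)) ∧
        ∫ x, ((Ω * x j : ℝ) : ℂ) * weakPartial i u x * (starRingEnd ℂ) (v x) =
          - ∫ x, ((Ω * x j : ℝ) : ℂ) * u x * (starRingEnd ℂ) (weakPartial i v x) := by
      intro i j hij hj
      refine ⟨?_, integrable_mul_conj (h.memLp_coord_mul hu j hj) (memLp_weakPartial hv i),
        integral_weakDeriv_mul_conj ?_ (isWeakPartial_weakPartial hu i)
        (isWeakPartial_weakPartial hv i) hu.1 (memLp_weakPartial hu i) hv.1 (memLp_weakPartial hv i)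
        (h.memLp_coord_mul hu j hj) (h.memLp_coord_mul hv j hj)⟩
      · refine (integrable_mul_conj (memLp_weakPartial hu i) (h.memLp_coord_mul hv j hj)).congr
          (Eventually.of_forall fun x => ?_)
        simp only [map_mul, Complex.conj_ofReal]
        ring
      · intro s x
        simp [Ne.symm hij]
    obtain ⟨a1, b1, c1⟩ := key ⟨0, by omega⟩ ⟨1, by omega⟩ (by simp) hj1
    obtain ⟨a2, b2, c2⟩ := key ⟨1, by omega⟩ ⟨0, by omega⟩ (by simp) hj0
    rw [← integral_conj]
    calc ∫ x, (Ω : ℂ) * Lz u x * (starRingEnd ℂ) (v x)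
        = Complex.I * ((∫ x, ((Ω * x ⟨1, by omega⟩ : ℝ) : ℂ) * weakPartial ⟨0, by omega⟩ u x *
            (starRingEnd ℂ) (v x)) - ∫ x, ((Ω * x ⟨0, by omega⟩ : ℝ) : ℂ) *
            weakPartial ⟨1, by omega⟩ u x * (starRingEnd ℂ) (v x)) := by
          rw [← integral_sub a1 a2, ← integral_const_mul]
          congr 1
          funext x
          simp only [Lz, hd, dif_pos]
          push_cast
          ring
      _ = -Complex.I * ((∫ x, ((Ω * x ⟨1, by omega⟩ : ℝ) : ℂ) * u x *
            (starRingEnd ℂ) (weakPartial ⟨0, by omega⟩ v x)) - ∫ x,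
            ((Ω * x ⟨0, by omega⟩ : ℝ) : ℂ) * u x *
            (starRingEnd ℂ) (weakPartial ⟨1, by omega⟩ v x)) := by
          rw [c1, c2]; ring
      _ = _ := by
          rw [← integral_sub b1 b2, ← integral_const_mul]
          congr 1
          funext x
          simp only [Lz, hd, dif_pos, map_mul, map_sub, Complex.conj_ofReal, Complex.conj_conj,
            Complex.conj_I]
          push_cast
          ring
  · simp [Lz, hd]

lemma integrable_grad (hu : u ∈ energySpace V) (hv : v ∈ energySpace V) :
    Integrable fun x => 1 / 2 * (∑ i : Fin d,
      weakPartial i u x * (starRingEnd ℂ) (weakPartial i v x)) :=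
  (integrable_finsetSum _ fun i _ =>
    integrable_mul_conj (memLp_weakPartial hu i) (memLp_weakPartial hv i)).const_mul _

lemma integrable_pot (hVm : Measurable V) (hV0 : ∀ x, 0 ≤ V x) (hu : u ∈ energySpace V)
    (hv : v ∈ energySpace V) :
    Integrable fun x => (V x : ℂ) * u x * (starRingEnd ℂ) (v x) := by
  refine (integrable_mul_conj (memLp_sqrt_mul hVm hV0 hu) (memLp_sqrt_mul hVm hV0 hv)).congr
    (Eventually.of_forall fun x => ?_)
  have : (V x : ℂ) = (√(V x) : ℂ) * (√(V x) : ℂ) := by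
    rw [← Complex.ofReal_mul, Real.mul_self_sqrt (hV0 x)]
  simp only [map_mul, Complex.conj_ofReal]
  rw [this]
  ring

lemma integrable_formDensity (h : RotationBound V Ω θ C) (hu : u ∈ energySpace V)
    (hv : v ∈ energySpace V) :
    Integrable (formDensity V Ω u v) := by
  refine ((integrable_grad hu hv).add ((integrable_pot h.measurable h.nonneg hu hv).sub
    (h.integrable_rot hu hv))).congr (Eventually.of_forall fun x => ?_)
  simp only [formDensity, Pi.add_apply, Pi.sub_apply]
  ring

lemma integral_formDensity (h : RotationBound V Ω θ C) (hu : u ∈ energySpace V)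
    (hv : v ∈ energySpace V) :
    ∫ x, formDensity V Ω u v x = (∫ x, 1 / 2 * (∑ i : Fin d,
      weakPartial i u x * (starRingEnd ℂ) (weakPartial i v x))) +
      (∫ x, (V x : ℂ) * u x * (starRingEnd ℂ) (v x)) -
      ∫ x, (Ω : ℂ) * Lz u x * (starRingEnd ℂ) (v x) := by
  have h1 := (integrable_grad hu hv).add (integrable_pot h.measurable h.nonneg hu hv)
  rw [← integral_add (integrable_grad hu hv) (integrable_pot h.measurable h.nonneg hu hv)]
  refine Eq.trans ?_ (integral_sub h1 (h.integrable_rot hu hv))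
  congr 1
  funext x
  simp only [formDensity]
  ring

/-- The weak form is Hermitian. -/
lemma integral_formDensity_symm (h : RotationBound V Ω θ C) (hu : u ∈ energySpace V)
    (hv : v ∈ energySpace V) :
    ∫ x, formDensity V Ω u v x = (starRingEnd ℂ) (∫ x, formDensity V Ω v u x) := by
  have e1 : ∫ x, 1 / 2 * (∑ i : Fin d, weakPartial i u x * (starRingEnd ℂ) (weakPartial i v x)) =
      (starRingEnd ℂ) (∫ x, 1 / 2 * (∑ i : Fin d,
        weakPartial i v x * (starRingEnd ℂ) (weakPartial i u x))) := by
    rw [← integral_conj]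
    congr 1
    funext x
    have : (starRingEnd ℂ) 2 = 2 := Complex.conj_ofNat 2
    simp [map_sum, mul_comm, this]
  have e2 : ∫ x, (V x : ℂ) * u x * (starRingEnd ℂ) (v x) =
      (starRingEnd ℂ) (∫ x, (V x : ℂ) * v x * (starRingEnd ℂ) (u x)) := by
    rw [← integral_conj]
    congr 1
    funext x
    simp only [map_mul, Complex.conj_ofReal, Complex.conj_conj]
    ring
  rw [h.integral_formDensity hu hv, h.integral_formDensity hv hu, h.integral_rot_symm hu hv,
    map_sub, map_add, e1, e2]

lemma integral_formDensity_add (h : RotationBound V Ω θ C) (hu : u ∈ energySpace V)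
    (hv : v ∈ energySpace V)
    (hw : w ∈ energySpace V) :
    ∫ x, formDensity V Ω (u + v) w x =
      (∫ x, formDensity V Ω u w x) + ∫ x, formDensity V Ω v w x := by
  rw [← integral_add (h.integrable_formDensity hu hw) (h.integrable_formDensity hv hw)]
  apply integral_congr_ae
  filter_upwards [ae_all_iff.2 fun i => weakPartial_add_ae hu hv i, Lz_add_ae hu hv] with x h1 h2
  simp only [formDensity, h1, h2, Pi.add_apply, add_mul, Finset.sum_add_distrib]
  ring

lemma integral_formDensity_smul (c : ℂ) (hu : u ∈ energySpace V) :
    ∫ x, formDensity V Ω (c • u) w x = c * ∫ x, formDensity V Ω u w x := by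
  rw [← integral_const_mul]
  apply integral_congr_ae
  filter_upwards [ae_all_iff.2 fun i => weakPartial_smul_ae c hu i, Lz_smul_ae c hu] with x h1 h2
  simp only [formDensity, h1, h2, Pi.smul_apply, smul_eq_mul, mul_assoc, ← Finset.mul_sum]
  ring

lemma quadraticEnergy_eq (V : Space d → ℝ) (Ω : ℝ) (u : Space d → ℂ) :
    quadraticEnergy V Ω u = gradPot V u - (∫ x, (Ω : ℂ) * Lz u x * (starRingEnd ℂ) (u x)).re := by
  have h1 : ∫ x, (Ω : ℂ) * Lz u x * (starRingEnd ℂ) (u x) =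
      (Ω : ℂ) * ∫ x, (starRingEnd ℂ) (u x) * Lz u x := by
    rw [← integral_const_mul]
    congr 1
    funext x
    ring
  rw [h1, Complex.re_ofReal_mul, quadraticEnergy, gradPot, rotationTerm]
  ring

lemma quadraticEnergy_eq_integral (h : RotationBound V Ω θ C) (hu : u ∈ energySpace V) :
    quadraticEnergy V Ω u = (∫ x, formDensity V Ω u u x).re := by
  have e0 : ∀ z : ℂ, z * (starRingEnd ℂ) z = ((‖z‖ ^ 2 : ℝ) : ℂ) := by
    intro z
    rw [Complex.mul_conj, Complex.normSq_eq_norm_sq]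
  rw [quadraticEnergy_eq V Ω u, h.integral_formDensity hu hu, Complex.sub_re, Complex.add_re,
    gradPot]
  congr 2
  · rw [integral_const_mul, integral_finsetSum _ fun i _ =>
      integrable_mul_conj (memLp_weakPartial hu i) (memLp_weakPartial hu i)]
    simp_rw [e0, integral_complex_ofReal]
    rw [← Complex.ofReal_sum]
    simp
  · simp_rw [mul_assoc, e0, ← Complex.ofReal_mul, integral_complex_ofReal]
    simp

/-- The rotation term is a small perturbation of the non-rotating form, up to mass. -/
lemma abs_rot_le (h : RotationBound V Ω θ C) (hu : u ∈ energySpace V) :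
    |(∫ x, (Ω : ℂ) * Lz u x * (starRingEnd ℂ) (u x)).re| ≤ θ * gradPot V u + C / θ * mass u := by
  have hθ := h.pos
  have hg : ∀ i, Integrable fun x => ‖weakPartial i u x‖ ^ 2 := fun i =>
    (memLp_two_iff_integrable_sq_norm (memLp_weakPartial hu i).1).1 (memLp_weakPartial hu i)
  have hm : Integrable fun x => ‖u x‖ ^ 2 := (memLp_two_iff_integrable_sq_norm hu.1.1).1 hu.1
  have hgs : Integrable fun x => ∑ i, ‖weakPartial i u x‖ ^ 2 :=
    integrable_finsetSum _ fun i _ => hg i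
  have e1 : θ * gradPot V u + C / θ * mass u = ∫ x, (θ / 2 * (∑ i, ‖weakPartial i u x‖ ^ 2) +
      θ * (V x * ‖u x‖ ^ 2) + C / θ * ‖u x‖ ^ 2) := by
    have i1 := hgs.const_mul (θ / 2)
    have i2 := hu.2.2.const_mul θ
    have i3 := hm.const_mul (C / θ)
    have s1 : ∫ x, (θ / 2 * (∑ i, ‖weakPartial i u x‖ ^ 2) + θ * (V x * ‖u x‖ ^ 2) +
        C / θ * ‖u x‖ ^ 2) = _ := integral_add (i1.add i2) i3
    have s2 := integral_add i1 i2
    rw [s1, s2, integral_const_mul, integral_const_mul,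
      integral_const_mul, integral_finsetSum _ fun i _ => hg i, gradPot, mass]
    ring
  rw [e1]
  refine (Complex.abs_re_le_norm _).trans ((norm_integral_le_integral_norm _).trans ?_)
  refine integral_mono (h.integrable_rot hu hu).norm
    (((hgs.const_mul _).add (hu.2.2.const_mul _)).add (hm.const_mul _)) fun x => ?_
  simp only [norm_mul, Complex.norm_real, RCLike.norm_conj, Real.norm_eq_abs]
  have hsum : 0 ≤ ∑ i, ‖weakPartial i u x‖ ^ 2 := Finset.sum_nonneg fun i _ => by positivity
  have hrhs : 0 ≤ θ / 2 * (∑ i, ‖weakPartial i u x‖ ^ 2) +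
      θ * (V x * ‖u x‖ ^ 2) + C / θ * ‖u x‖ ^ 2 := by
    have := h.nonneg x
    have := h.const_nonneg
    positivity
  by_cases hd : 2 ≤ d
  · set g0 := weakPartial ⟨0, by omega⟩ u x with hg0
    set g1 := weakPartial ⟨1, by omega⟩ u x with hg1
    have hG : ‖g0‖ ^ 2 + ‖g1‖ ^ 2 ≤ ∑ i, ‖weakPartial i u x‖ ^ 2 := by
      rw [← Finset.sum_pair (f := fun i => ‖weakPartial i u x‖ ^ 2)
        (a := ⟨0, by omega⟩) (b := ⟨1, by omega⟩) (by simp)]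
      exact Finset.sum_le_sum_of_subset_of_nonneg (Finset.subset_univ _)
        fun i _ _ => by positivity
    have hL : ‖Lz u x‖ ^ 2 ≤ axisDistSq x * (‖g0‖ ^ 2 + ‖g1‖ ^ 2) := by
      simp only [Lz, axisDistSq, hd, dif_pos, norm_mul, Complex.norm_I, one_mul, ← hg0, ← hg1]
      set a := x ⟨0, by omega⟩
      set b := x ⟨1, by omega⟩
      have h1 : ‖(b : ℂ) * g0 - (a : ℂ) * g1‖ ≤ |b| * ‖g0‖ + |a| * ‖g1‖ := by
        refine (norm_sub_le _ _).trans ?_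
        simp
      have h2 := pow_le_pow_left₀ (norm_nonneg _) h1 2
      refine h2.trans ?_
      rw [← sq_abs a, ← sq_abs b]
      nlinarith [sq_nonneg (|b| * ‖g1‖ - |a| * ‖g0‖)]
    -- Young's inequality with weight `θ`
    have hY : |Ω| * ‖Lz u x‖ * ‖u x‖ * θ ≤ (θ ^ 2 * (‖g0‖ ^ 2 + ‖g1‖ ^ 2) +
        Ω ^ 2 * axisDistSq x * ‖u x‖ ^ 2) / 2 := by
      set G := ‖g0‖ ^ 2 + ‖g1‖ ^ 2 with hGdef
      have hG0 : 0 ≤ G := by positivity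
      have hr := axisDistSq_nonneg x
      have h1 : (|Ω| * ‖Lz u x‖ * ‖u x‖ * θ) ^ 2 ≤
          (θ ^ 2 * G) * (Ω ^ 2 * axisDistSq x * ‖u x‖ ^ 2) := by
        have := mul_le_mul_of_nonneg_left hL (sq_nonneg (|Ω| * ‖u x‖ * θ))
        rw [← sq_abs Ω]
        nlinarith
      have h2 : 0 ≤ θ ^ 2 * G := by positivity
      have h3 : 0 ≤ Ω ^ 2 * axisDistSq x * ‖u x‖ ^ 2 := by positivity
      refine abs_le_of_sq_le_sq' (h1.trans ?_) (by positivity) |>.2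
      nlinarith [sq_nonneg (θ ^ 2 * G - Ω ^ 2 * axisDistSq x * ‖u x‖ ^ 2)]
    have h4 := mul_le_mul_of_nonneg_right (h.le x) (sq_nonneg ‖u x‖)
    have h5 : |Ω| * ‖Lz u x‖ * ‖u x‖ * θ ≤ (θ / 2 * (∑ i, ‖weakPartial i u x‖ ^ 2) +
        θ * (V x * ‖u x‖ ^ 2) + C / θ * ‖u x‖ ^ 2) * θ := by
      have h6 : (θ / 2 * (∑ i, ‖weakPartial i u x‖ ^ 2) +
        θ * (V x * ‖u x‖ ^ 2) + C / θ * ‖u x‖ ^ 2) * θ = θ ^ 2 / 2 *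
          (∑ i, ‖weakPartial i u x‖ ^ 2) + θ ^ 2 * (V x * ‖u x‖ ^ 2) + C * ‖u x‖ ^ 2 := by
        field_simp
      rw [h6]
      have h7 := mul_le_mul_of_nonneg_left hG (sq_nonneg θ)
      nlinarith
    exact le_of_mul_le_mul_right h5 hθ
  · simpa [Lz, hd] using hrhs

lemma le_quadraticEnergy (h : RotationBound V Ω θ C) (hu : u ∈ energySpace V) :
    (1 - θ) * gradPot V u - C / θ * mass u ≤ quadraticEnergy V Ω u := by
  have := abs_le.1 (h.abs_rot_le hu)
  rw [quadraticEnergy_eq V Ω u]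
  linarith

lemma quadraticEnergy_le (h : RotationBound V Ω θ C) (hu : u ∈ energySpace V) :
    quadraticEnergy V Ω u ≤ 2 * gradPot V u + C / θ * mass u := by
  have := abs_le.1 (h.abs_rot_le hu)
  have := gradPot_nonneg h.nonneg u
  rw [quadraticEnergy_eq V Ω u]
  nlinarith [h.lt_one]

end RotationBound

end EnergySpace

/-! ### The direct method for a relatively compact perturbation -/

section Minimization

variable {E : Type*} [AddCommGroup E] [Module ℝ E]

lemma apply_self_add {B : E →ₗ[ℝ] E →ₗ[ℝ] ℝ} (hs : ∀ u v, B u v = B v u) (u v : E) :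
    B (u + v) (u + v) = B u u + 2 * B u v + B v v := by
  simp only [map_add, LinearMap.add_apply, hs v u]
  ring

lemma apply_self_midpoint {B : E →ₗ[ℝ] E →ₗ[ℝ] ℝ} (hs : ∀ u v, B u v = B v u) (u v : E) :
    B ((1 / 2 : ℝ) • (u + v)) ((1 / 2 : ℝ) • (u + v)) =
      1 / 2 * B u u + 1 / 2 * B v v - 1 / 4 * B (u - v) (u - v) := by
  simp only [map_add, map_sub, map_smul, LinearMap.add_apply, LinearMap.sub_apply,
    LinearMap.smul_apply, hs v u, smul_eq_mul]
  ring

lemma tendsto_apply_self {B : E →ₗ[ℝ] E →ₗ[ℝ] ℝ} (hs : ∀ u v, B u v = B v u)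
    (h0 : ∀ u, 0 ≤ B u u) {w : ℕ → E} {u : E}
    (h : Tendsto (fun n => B (w n - u) (w n - u)) atTop (𝓝 0)) :
    Tendsto (fun n => B (w n) (w n)) atTop (𝓝 (B u u)) := by
  have h1 : Tendsto (fun n => B u (w n - u)) atTop (𝓝 0) := by
    have h2 : Tendsto (fun n => √(B u u * B (w n - u) (w n - u))) atTop (𝓝 0) := by
      have := (Real.continuous_sqrt.tendsto _).comp (h.const_mul (B u u))
      rwa [mul_zero, Real.sqrt_zero] at this
    refine squeeze_zero_norm (fun n => ?_) h2
    rw [Real.norm_eq_abs]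
    refine Real.abs_le_sqrt ?_
    have := LinearMap.BilinForm.apply_mul_apply_le_of_forall_zero_le B h0 u (w n - u)
    rw [hs (w n - u) u] at this
    linarith [sq (B u (w n - u))]
  have h3 := ((tendsto_const_nhds (x := B u u)).add (h1.const_mul 2)).add h
  simp only [mul_zero, add_zero] at h3
  refine h3.congr fun n => ?_
  rw [← apply_self_add hs]
  simp

/-- The direct method for the difference of a coercive convex functional `q + N` and a multiple of
a quadratic form `m` that is compact relative to `q`. Along a minimizing sequence that is Cauchy
for `m`, the parallelogram identity for `q` and the convexity of `N` make it Cauchy for `q`. -/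
theorem exists_minimizer_of_compact {q m : E →ₗ[ℝ] E →ₗ[ℝ] ℝ} (hqs : ∀ u v, q u v = q v u)
    (hms : ∀ u v, m u v = m v u) (hm0 : ∀ u, 0 ≤ m u u) (hmq : ∀ u, m u u ≤ q u u)
    {N : E → ℝ≥0∞} (hN0 : N 0 = 0)
    (hNmid : ∀ u v, 2 * N ((1 / 2 : ℝ) • (u + v)) ≤ N u + N v) {a K : ℝ}
    (hcoer : ∀ u, N u ≠ ⊤ → q u u / 2 - K ≤ q u u - a * m u u + (N u).toReal)
    (hcompact : ∀ (w : ℕ → E) (M : ℝ), (∀ n, q (w n) (w n) ≤ M) → ∃ φ : ℕ → ℕ, StrictMono φ ∧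
      ∀ ε > 0, ∃ n, ∀ j ≥ n, ∀ k ≥ n, m (w (φ j) - w (φ k)) (w (φ j) - w (φ k)) < ε)
    (hcomplete : ∀ w : ℕ → E, (∀ ε > 0, ∃ n, ∀ j ≥ n, ∀ k ≥ n, q (w j - w k) (w j - w k) < ε) →
      ∃ u, Tendsto (fun n => q (w n - u) (w n - u)) atTop (𝓝 0))
    (hlsc : ∀ (w : ℕ → E) (u : E) (b : ℝ≥0∞),
      Tendsto (fun n => m (w n - u) (w n - u)) atTop (𝓝 0) → (∀ n, N (w n) ≤ b) → N u ≤ b) :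
    ∃ u, N u ≠ ⊤ ∧ ∀ v, N v ≠ ⊤ →
      q u u - a * m u u + (N u).toReal ≤ q v v - a * m v v + (N v).toReal := by
  have hq0 : ∀ u, 0 ≤ q u u := fun u => (hm0 u).trans (hmq u)
  set J : E → ℝ := fun u => q u u - a * m u u + (N u).toReal with hJ
  let S : Set ℝ := J '' {u | N u ≠ ⊤}
  have hSne : S.Nonempty := ⟨J 0, 0, by simp [hN0], rfl⟩
  have hSb : BddBelow S := by
    refine ⟨-K, ?_⟩
    rintro _ ⟨u, hu, rfl⟩
    linarith [hcoer u hu, hq0 u]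
  set I := sInf S with hI
  have hIle : ∀ u, N u ≠ ⊤ → I ≤ J u := fun u hu => csInf_le hSb ⟨u, hu, rfl⟩
  have hex : ∀ n : ℕ, ∃ u, N u ≠ ⊤ ∧ J u < I + 1 / ((n : ℝ) + 1) := by
    intro n
    obtain ⟨_, ⟨u, hu, rfl⟩, hlt⟩ := exists_lt_of_csInf_lt hSne
      (lt_add_of_pos_right I (by positivity : (0 : ℝ) < 1 / ((n : ℝ) + 1)))
    exact ⟨u, hu, hlt⟩
  choose w' hw'N hw'J using hex
  obtain ⟨φ, hφ, hφm⟩ := hcompact w' (2 * (I + 1 + K)) (by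
    intro n
    have h1 := hcoer _ (hw'N n)
    have h2 := hw'J n
    have h3 : 1 / ((n : ℝ) + 1) ≤ 1 := by
      rw [div_le_one (by positivity)]; linarith [Nat.cast_nonneg (α := ℝ) n]
    simp only [hJ] at h2
    linarith)
  set w : ℕ → E := fun n => w' (φ n) with hw
  have hwN : ∀ n, N (w n) ≠ ⊤ := fun n => hw'N _
  have hwJ : Tendsto (fun n => J (w n)) atTop (𝓝 I) := by
    have h1 : Tendsto (fun n : ℕ => I + 1 / ((φ n : ℝ) + 1)) atTop (𝓝 (I + 0)) :=
      tendsto_const_nhds.add ((tendsto_one_div_add_atTop_nhds_zero_nat).comp hφ.tendsto_atTop)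
    rw [add_zero] at h1
    exact tendsto_of_tendsto_of_tendsto_of_le_of_le tendsto_const_nhds h1
      (fun n => hIle _ (hwN n)) (fun n => (hw'J _).le)
  -- midpoints of the minimizing sequence are admissible competitors
  have hpar : ∀ j k, q (w j - w k) (w j - w k) ≤
      2 * (J (w j) - I) + 2 * (J (w k) - I) + |a| * m (w j - w k) (w j - w k) := by
    intro j k
    have h1 := hNmid (w j) (w k)
    have hfin : N (w j) + N (w k) ≠ ⊤ := ENNReal.add_ne_top.2 ⟨hwN j, hwN k⟩
    have hmid : N ((1 / 2 : ℝ) • (w j + w k)) ≠ ⊤ := by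
      intro hc
      rw [hc, ENNReal.mul_top two_ne_zero] at h1
      exact hfin (top_le_iff.1 h1)
    have h2 := ENNReal.toReal_mono hfin h1
    rw [ENNReal.toReal_mul, ENNReal.toReal_add (hwN j) (hwN k)] at h2
    have h3 := hIle _ hmid
    simp only [hJ, apply_self_midpoint hqs, apply_self_midpoint hms] at h3 ⊢
    simp only [ENNReal.toReal_ofNat] at h2
    have h4 := mul_le_mul_of_nonneg_right (le_abs_self a) (hm0 (w j - w k))
    nlinarith
  have hcau : ∀ ε > 0, ∃ n, ∀ j ≥ n, ∀ k ≥ n, q (w j - w k) (w j - w k) < ε := by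
    intro ε hε
    obtain ⟨n1, hn1⟩ := hφm (ε / (2 * (|a| + 1))) (by positivity)
    obtain ⟨n2, hn2⟩ := eventually_atTop.1
      (hwJ.eventually_lt_const (show I < I + ε / 8 by linarith))
    refine ⟨max n1 n2, fun j hj k hk => ?_⟩
    have h1 := hn1 j (le_trans (le_max_left _ _) hj) k (le_trans (le_max_left _ _) hk)
    have h2 := hn2 j (le_trans (le_max_right _ _) hj)
    have h3 := hn2 k (le_trans (le_max_right _ _) hk)
    have h4 : |a| * m (w j - w k) (w j - w k) ≤ ε / 2 := by
      rw [lt_div_iff₀ (by positivity)] at h1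
      nlinarith [hm0 (w j - w k), abs_nonneg a]
    linarith [hpar j k]
  obtain ⟨u, hu⟩ := hcomplete w hcau
  have hum : Tendsto (fun n => m (w n - u) (w n - u)) atTop (𝓝 0) :=
    squeeze_zero (fun n => hm0 _) (fun n => hmq _) hu
  have hq := tendsto_apply_self hqs hq0 hu
  have hm := tendsto_apply_self hms hm0 hum
  have hNlim : Tendsto (fun n => (N (w n)).toReal) atTop (𝓝 (I - q u u + a * m u u)) := by
    refine ((hwJ.sub hq).add (hm.const_mul a)).congr fun n => ?_
    simp only [hJ]
    ring
  have hc0 : 0 ≤ I - q u u + a * m u u :=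
    ge_of_tendsto hNlim (Eventually.of_forall fun n => ENNReal.toReal_nonneg)
  have hNle : ∀ ε > 0, N u ≤ ENNReal.ofReal (I - q u u + a * m u u + ε) := by
    intro ε hε
    obtain ⟨n, hn⟩ := eventually_atTop.1 (hNlim.eventually_lt_const
      (show I - q u u + a * m u u < I - q u u + a * m u u + ε by linarith))
    refine hlsc (fun k => w (k + n)) u _ (hum.comp (tendsto_add_atTop_nat n)) fun k => ?_
    exact (ENNReal.le_ofReal_iff_toReal_le (hwN _) (by linarith)).2 (hn _ (by omega)).le
  refine ⟨u, ne_top_of_le_ne_top ENNReal.ofReal_ne_top (hNle 1 one_pos), fun v hv => ?_⟩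
  refine le_trans ?_ (hIle v hv)
  refine le_of_forall_pos_le_add fun ε hε => ?_
  have := ENNReal.toReal_le_of_le_ofReal (by linarith) (hNle ε hε)
  linarith

end Minimization

/-! ### Quadratic forms on the energy space -/

section Forms

variable {d : ℕ} {V : Space d → ℝ} {u v w : Space d → ℂ} {Ω θ C : ℝ}

lemma norm_toLp_sq {f : Space d → ℂ} (hf : MemLp f 2 volume) :
    ‖hf.toLp f‖ ^ 2 = ∫ x, ‖f x‖ ^ 2 := by
  rw [← @inner_self_eq_norm_sq ℂ, L2.inner_def]
  have : ∫ x, ⟪hf.toLp f x, hf.toLp f x⟫_ℂ = ∫ x, ((‖f x‖ ^ 2 : ℝ) : ℂ) := by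
    apply integral_congr_ae
    filter_upwards [hf.coeFn_toLp] with x hx
    rw [hx, inner_self_eq_norm_sq_to_K]
    simp
  rw [this, integral_complex_ofReal]
  simp

/-- The class in `L²` of an element of the energy space. -/
noncomputable def toL2 (hVm : Measurable V) (hV0 : ∀ x, 0 ≤ V x) :
    energySubmodule V hVm hV0 →ₗ[ℝ] Lp ℂ 2 (volume : Measure (Space d)) where
  toFun u := MemLp.toLp (u : Space d → ℂ) u.2.1
  map_add' _ _ := rfl
  map_smul' _ _ := rfl

/-- The class in `L²` of the `i`-th weak partial derivative. -/
noncomputable def gradL2 (hVm : Measurable V) (hV0 : ∀ x, 0 ≤ V x) (i : Fin d) :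
    energySubmodule V hVm hV0 →ₗ[ℝ] Lp ℂ 2 (volume : Measure (Space d)) where
  toFun u := (memLp_weakPartial u.2 i).toLp _
  map_add' u v := by
    rw [← MemLp.toLp_add, MemLp.toLp_eq_toLp_iff]
    exact weakPartial_add_ae u.2 v.2 i
  map_smul' c u := by
    rw [RingHom.id_apply, ← MemLp.toLp_const_smul, MemLp.toLp_eq_toLp_iff]
    have := weakPartial_smul_ae (c : ℂ) u.2 i
    rw [Complex.coe_smul] at this
    filter_upwards [this] with x hx
    simp [← hx]

/-- The class in `L²` of `√V u`. -/
noncomputable def potL2 (hVm : Measurable V) (hV0 : ∀ x, 0 ≤ V x) :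
    energySubmodule V hVm hV0 →ₗ[ℝ] Lp ℂ 2 (volume : Measure (Space d)) where
  toFun u := (memLp_sqrt_mul hVm hV0 u.2).toLp _
  map_add' u v := by
    rw [← MemLp.toLp_add]
    congr 1
    funext x
    simp [mul_add]
  map_smul' c u := by
    rw [RingHom.id_apply, ← MemLp.toLp_const_smul]
    congr 1
    funext x
    simp
    ring

section

variable {hVm : Measurable V} {hV0 : ∀ x, 0 ≤ V x}

lemma coeFn_toL2 (u : energySubmodule V hVm hV0) : toL2 hVm hV0 u =ᵐ[volume] u.1 :=
  MemLp.coeFn_toLp u.2.1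

lemma coeFn_gradL2 (i : Fin d) (u : energySubmodule V hVm hV0) :
    gradL2 hVm hV0 i u =ᵐ[volume] weakPartial i u.1 :=
  (memLp_weakPartial u.2 i).coeFn_toLp

lemma coeFn_potL2 (u : energySubmodule V hVm hV0) :
    potL2 hVm hV0 u =ᵐ[volume] fun x => (√(V x) : ℂ) * u.1 x :=
  (memLp_sqrt_mul hVm hV0 u.2).coeFn_toLp

lemma norm_toL2_sq (u : energySubmodule V hVm hV0) : ‖toL2 hVm hV0 u‖ ^ 2 = mass u.1 :=
  norm_toLp_sq u.2.1

lemma norm_gradL2_sq (i : Fin d) (u : energySubmodule V hVm hV0) :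
    ‖gradL2 hVm hV0 i u‖ ^ 2 = ∫ x, ‖weakPartial i u.1 x‖ ^ 2 :=
  norm_toLp_sq (memLp_weakPartial u.2 i)

lemma norm_potL2_sq (u : energySubmodule V hVm hV0) :
    ‖potL2 hVm hV0 u‖ ^ 2 = ∫ x, V x * ‖u.1 x‖ ^ 2 := by
  refine (norm_toLp_sq (memLp_sqrt_mul hVm hV0 u.2)).trans ?_
  congr 1
  funext x
  simp only [norm_mul, Complex.norm_real, mul_pow, Real.norm_eq_abs, sq_abs]
  rw [Real.sq_sqrt (hV0 x)]

lemma gradPot_eq (u : energySubmodule V hVm hV0) :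
    gradPot V u.1 = 1 / 2 * (∑ i, ‖gradL2 hVm hV0 i u‖ ^ 2) + ‖potL2 hVm hV0 u‖ ^ 2 := by
  simp only [gradPot, norm_gradL2_sq, norm_potL2_sq]

lemma norm_gradL2_sq_le (i : Fin d) (u : energySubmodule V hVm hV0) :
    ‖gradL2 hVm hV0 i u‖ ^ 2 ≤ 2 * gradPot V u.1 := by
  have := Finset.single_le_sum (f := fun i => ‖gradL2 hVm hV0 i u‖ ^ 2)
    (fun i _ => sq_nonneg _) (Finset.mem_univ i)
  rw [gradPot_eq]
  nlinarith [sq_nonneg ‖potL2 hVm hV0 u‖]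

lemma norm_potL2_sq_le (u : energySubmodule V hVm hV0) :
    ‖potL2 hVm hV0 u‖ ^ 2 ≤ gradPot V u.1 := by
  have := Finset.sum_nonneg (s := Finset.univ) (f := fun i => ‖gradL2 hVm hV0 i u‖ ^ 2)
    (fun i _ => sq_nonneg _)
  rw [gradPot_eq]
  linarith

end

/-- The real `L²` inner product, whose quadratic form is the mass. -/
noncomputable def massForm (hVm : Measurable V) (hV0 : ∀ x, 0 ≤ V x) :
    energySubmodule V hVm hV0 →ₗ[ℝ] energySubmodule V hVm hV0 →ₗ[ℝ] ℝ :=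
  LinearMap.mk₂ ℝ (fun u v => (⟪toL2 hVm hV0 u, toL2 hVm hV0 v⟫_ℂ).re)
    (by intro u v w; simp [inner_add_left])
    (by intro c u v; simp [inner_smul_left_eq_smul])
    (by intro u v w; simp [inner_add_right])
    (by intro c u v; simp [inner_smul_right_eq_smul])

lemma massForm_symm {hVm : Measurable V} {hV0 : ∀ x, 0 ≤ V x} (u v : energySubmodule V hVm hV0) :
    massForm hVm hV0 u v = massForm hVm hV0 v u := by
  simp only [massForm, LinearMap.mk₂_apply]
  rw [← inner_conj_symm, Complex.conj_re]

lemma massForm_self {hVm : Measurable V} {hV0 : ∀ x, 0 ≤ V x} (u : energySubmodule V hVm hV0) :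
    massForm hVm hV0 u u = mass u.1 := by
  rw [← norm_toL2_sq, ← @inner_self_eq_norm_sq ℂ]
  rfl

lemma massForm_eq_integral {hVm : Measurable V} {hV0 : ∀ x, 0 ≤ V x}
    (u v : energySubmodule V hVm hV0) :
    massForm hVm hV0 u v = (∫ x, u.1 x * (starRingEnd ℂ) (v.1 x)).re := by
  rw [massForm_symm]
  simp only [massForm, LinearMap.mk₂_apply, L2.inner_def]
  congr 1
  apply integral_congr_ae
  filter_upwards [coeFn_toL2 u, coeFn_toL2 v] with x h1 h2
  rw [h1, h2]
  simp

namespace RotationBound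

/-- The real bilinear form of `-½ Δ + V - Ω L_z`, whose quadratic form is `quadraticEnergy`. -/
noncomputable def energyForm (h : RotationBound V Ω θ C) :
    energySubmodule V h.measurable h.nonneg →ₗ[ℝ] energySubmodule V h.measurable h.nonneg →ₗ[ℝ] ℝ :=
  have hadd : ∀ u v w : energySubmodule V h.measurable h.nonneg,
      (∫ x, formDensity V Ω (u + v).1 w.1 x).re =
        (∫ x, formDensity V Ω u.1 w.1 x).re + (∫ x, formDensity V Ω v.1 w.1 x).re := by
    intro u v w
    rw [← Complex.add_re, ← h.integral_formDensity_add u.2 v.2 w.2]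
    rfl
  have hsmul : ∀ (c : ℝ) (u v : energySubmodule V h.measurable h.nonneg),
      (∫ x, formDensity V Ω (c • u).1 v.1 x).re = c • (∫ x, formDensity V Ω u.1 v.1 x).re := by
    intro c u v
    have h1 := integral_formDensity_smul (Ω := Ω) (w := v.1) (c : ℂ) u.2
    rw [Complex.coe_smul] at h1
    rw [smul_eq_mul, ← Complex.re_ofReal_mul, ← h1]
    rfl
  have hsymm : ∀ u v : energySubmodule V h.measurable h.nonneg,
      (∫ x, formDensity V Ω u.1 v.1 x).re = (∫ x, formDensity V Ω v.1 u.1 x).re := by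
    intro u v
    rw [h.integral_formDensity_symm u.2 v.2, Complex.conj_re]
  LinearMap.mk₂ ℝ (fun u v => (∫ x, formDensity V Ω u.1 v.1 x).re) hadd hsmul
    (fun u v w => by rw [hsymm, hadd, hsymm v, hsymm w])
    (fun c u v => by rw [hsymm, hsmul, hsymm v])

lemma energyForm_apply (h : RotationBound V Ω θ C)
    (u v : energySubmodule V h.measurable h.nonneg) :
    h.energyForm u v = (∫ x, formDensity V Ω u.1 v.1 x).re := rfl

lemma energyForm_symm (h : RotationBound V Ω θ C)
    (u v : energySubmodule V h.measurable h.nonneg) : h.energyForm u v = h.energyForm v u := by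
  rw [energyForm_apply, energyForm_apply, h.integral_formDensity_symm u.2 v.2, Complex.conj_re]

lemma energyForm_self (h : RotationBound V Ω θ C)
    (u : energySubmodule V h.measurable h.nonneg) :
    h.energyForm u u = quadraticEnergy V Ω u.1 :=
  (h.quadraticEnergy_eq_integral u.2).symm

/-- The energy form, shifted by a multiple of the mass that makes it positive definite. -/
noncomputable def shiftedForm (h : RotationBound V Ω θ C) :
    energySubmodule V h.measurable h.nonneg →ₗ[ℝ] energySubmodule V h.measurable h.nonneg →ₗ[ℝ] ℝ :=
  h.energyForm + (C / θ + 1) • massForm h.measurable h.nonneg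

lemma shiftedForm_apply (h : RotationBound V Ω θ C)
    (u v : energySubmodule V h.measurable h.nonneg) :
    h.shiftedForm u v = h.energyForm u v + (C / θ + 1) * massForm h.measurable h.nonneg u v := rfl

lemma shiftedForm_symm (h : RotationBound V Ω θ C)
    (u v : energySubmodule V h.measurable h.nonneg) : h.shiftedForm u v = h.shiftedForm v u := by
  rw [shiftedForm_apply, shiftedForm_apply, h.energyForm_symm, massForm_symm]

lemma le_shiftedForm (h : RotationBound V Ω θ C) (u : energySubmodule V h.measurable h.nonneg) :
    (1 - θ) * gradPot V u.1 + mass u.1 ≤ h.shiftedForm u u := by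
  rw [shiftedForm_apply, h.energyForm_self, massForm_self]
  linarith [h.le_quadraticEnergy u.2]

lemma shiftedForm_le (h : RotationBound V Ω θ C) (u : energySubmodule V h.measurable h.nonneg) :
    h.shiftedForm u u ≤ 2 * gradPot V u.1 + (2 * (C / θ) + 1) * mass u.1 := by
  rw [shiftedForm_apply, h.energyForm_self, massForm_self]
  linarith [h.quadraticEnergy_le u.2]

lemma mass_le_shiftedForm (h : RotationBound V Ω θ C)
    (u : energySubmodule V h.measurable h.nonneg) : mass u.1 ≤ h.shiftedForm u u := by
  have := h.le_shiftedForm u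
  have := mul_nonneg (sub_nonneg.2 h.lt_one.le) (gradPot_nonneg h.nonneg u.1)
  linarith

lemma gradPot_le_shiftedForm (h : RotationBound V Ω θ C)
    (u : energySubmodule V h.measurable h.nonneg) :
    gradPot V u.1 ≤ (1 - θ)⁻¹ * h.shiftedForm u u := by
  have h1 := h.le_shiftedForm u
  have h2 := mass_nonneg u.1
  have h3 : 0 < 1 - θ := sub_pos.2 h.lt_one
  rw [inv_mul_eq_div, le_div_iff₀ h3]
  linarith

/-- The energy space is complete. -/
lemma exists_tendsto_shiftedForm (h : RotationBound V Ω θ C)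
    (w : ℕ → energySubmodule V h.measurable h.nonneg)
    (hw : ∀ ε > 0, ∃ n, ∀ j ≥ n, ∀ k ≥ n, h.shiftedForm (w j - w k) (w j - w k) < ε) :
    ∃ u, Tendsto (fun n => h.shiftedForm (w n - u) (w n - u)) atTop (𝓝 0) := by
  have h3 : 0 < 1 - θ := sub_pos.2 h.lt_one
  have cau : ∀ (L : energySubmodule V h.measurable h.nonneg →ₗ[ℝ]
      Lp ℂ 2 (volume : Measure (Space d))) (c : ℝ), 0 < c →
      (∀ u, ‖L u‖ ^ 2 ≤ c * h.shiftedForm u u) → CauchySeq fun n => L (w n) := by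
    intro L c hc hL
    rw [Metric.cauchySeq_iff]
    intro ε hε
    obtain ⟨n, hn⟩ := hw (ε ^ 2 / c) (by positivity)
    refine ⟨n, fun j hj k hk => ?_⟩
    rw [dist_eq_norm, ← map_sub]
    refine lt_of_pow_lt_pow_left₀ 2 hε.le ((hL _).trans_lt ?_)
    have := hn j hj k hk
    rw [lt_div_iff₀ hc] at this
    linarith
  obtain ⟨U, hU⟩ := cauchySeq_tendsto_of_complete (cau (toL2 h.measurable h.nonneg) 1 one_pos
    (fun u => by rw [norm_toL2_sq, one_mul]; exact h.mass_le_shiftedForm u))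
  have hG : ∀ i, ∃ G, Tendsto (fun n => gradL2 h.measurable h.nonneg i (w n)) atTop (𝓝 G) :=
    fun i => cauchySeq_tendsto_of_complete (cau _ (2 * (1 - θ)⁻¹) (by positivity)
      (fun u => (norm_gradL2_sq_le i u).trans (by
        linarith [h.gradPot_le_shiftedForm u])))
  choose G hG using hG
  obtain ⟨W, hW⟩ := cauchySeq_tendsto_of_complete (cau (potL2 h.measurable h.nonneg) (1 - θ)⁻¹
    (by positivity) (fun u => (norm_potL2_sq_le u).trans (h.gradPot_le_shiftedForm u)))
  have hpart : ∀ i, IsWeakPartial i U (G i) := by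
    intro i
    refine isWeakDeriv_of_tendsto hU (hG i) fun n => ?_
    exact IsWeakDeriv.congr (isWeakPartial_weakPartial (w n).2 i)
      (MemLp.coeFn_toLp (w n).2.1).symm (memLp_weakPartial (w n).2 i).coeFn_toLp.symm
  -- the limit of `√V wₙ` is identified along an almost everywhere convergent subsequence
  have hWU : (fun x => (√(V x) : ℂ) * U x) =ᵐ[volume] W := by
    obtain ⟨φ, hφ, hφU⟩ := (tendstoInMeasure_of_tendsto_Lp hU).exists_seq_tendsto_ae
    obtain ⟨ψ, hψ, hψW⟩ := (tendstoInMeasure_of_tendsto_Lp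
      (hW.comp hφ.tendsto_atTop)).exists_seq_tendsto_ae
    filter_upwards [hφU, hψW, ae_all_iff.2 fun n => coeFn_toL2 (w n),
      ae_all_iff.2 fun n => coeFn_potL2 (w n)] with x h1 h2 h3 h4
    have h5 := (h1.comp hψ.tendsto_atTop).const_mul (√(V x) : ℂ)
    refine tendsto_nhds_unique h5 (h2.congr fun n => ?_)
    simp only [Function.comp_apply, h3, h4]
  have hmem : (U : Space d → ℂ) ∈ energySpace V := by
    refine ⟨Lp.memLp U, fun i => ⟨G i, hpart i, Lp.memLp _⟩, ?_⟩
    have h4 := (Lp.memLp W).ae_eq hWU.symm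
    rw [memLp_two_iff_integrable_sq_norm h4.1] at h4
    refine h4.congr (Eventually.of_forall fun x => ?_)
    simp only [norm_mul, Complex.norm_real, mul_pow, Real.norm_eq_abs, sq_abs]
    rw [Real.sq_sqrt (h.nonneg x)]
  obtain ⟨u, hu⟩ : ∃ u : energySubmodule V h.measurable h.nonneg, u.1 = U := ⟨⟨U, hmem⟩, rfl⟩
  have eU : toL2 h.measurable h.nonneg u = U := by
    ext1
    rw [← hu]
    exact coeFn_toL2 u
  have eG : ∀ i, gradL2 h.measurable h.nonneg i u = G i := by
    intro i
    ext1
    refine (coeFn_gradL2 i u).trans ?_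
    rw [hu]
    exact (hpart i).weakPartial_ae_eq
  have eW : potL2 h.measurable h.nonneg u = W := by
    ext1
    refine (coeFn_potL2 u).trans ?_
    rw [hu]
    exact hWU
  have lim : ∀ (L : energySubmodule V h.measurable h.nonneg →ₗ[ℝ]
      Lp ℂ 2 (volume : Measure (Space d))), Tendsto (fun n => L (w n)) atTop (𝓝 (L u)) →
      Tendsto (fun n => ‖L (w n - u)‖ ^ 2) atTop (𝓝 0) := by
    intro L hL
    simp_rw [map_sub]
    have := ((hL.sub_const (L u)).norm).pow 2
    simpa using this
  have l1 := lim (toL2 h.measurable h.nonneg) (by rw [eU]; exact hU)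
  have l2 := fun i => lim (gradL2 h.measurable h.nonneg i) (by rw [eG]; exact hG i)
  have l3 := lim (potL2 h.measurable h.nonneg) (by rw [eW]; exact hW)
  have l4 : Tendsto (fun n => 2 * gradPot V (w n - u).1 + (2 * (C / θ) + 1) * mass (w n - u).1)
      atTop (𝓝 0) := by
    have := ((((tendsto_finsetSum Finset.univ fun i _ => l2 i).const_mul (1 / 2)).add l3).const_mul
      2).add (l1.const_mul (2 * (C / θ) + 1))
    simp only [Finset.sum_const_zero, mul_zero, add_zero] at this
    refine this.congr fun n => ?_
    rw [gradPot_eq, norm_toL2_sq]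
  refine ⟨u, squeeze_zero (fun n => (mass_nonneg _).trans (h.mass_le_shiftedForm _))
    (fun n => h.shiftedForm_le _) l4⟩

/-- The embedding of the energy space into `L²` is compact. -/
lemma exists_subseq_massForm (h : RotationBound V Ω θ C)
    (hV : Tendsto V (cocompact (Space d)) atTop)
    (w : ℕ → energySubmodule V h.measurable h.nonneg) (M : ℝ)
    (hw : ∀ n, h.shiftedForm (w n) (w n) ≤ M) :
    ∃ φ : ℕ → ℕ, StrictMono φ ∧ ∀ ε > 0, ∃ n, ∀ j ≥ n, ∀ k ≥ n,
      massForm h.measurable h.nonneg (w (φ j) - w (φ k)) (w (φ j) - w (φ k)) < ε := by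
  have h3 : 0 < 1 - θ := sub_pos.2 h.lt_one
  have hM0 : 0 ≤ M := (mass_nonneg _).trans ((h.mass_le_shiftedForm (w 0)).trans (hw 0))
  have hP : ∀ n, gradPot V (w n).1 ≤ (1 - θ)⁻¹ * M := fun n =>
    (h.gradPot_le_shiftedForm (w n)).trans (by gcongr; exact hw n)
  set P := (1 - θ)⁻¹ * M with hPdef
  have hP0 : 0 ≤ P := by positivity
  have hbdd : ∀ n, ‖toL2 h.measurable h.nonneg (w n)‖ ≤ √M := by
    intro n
    refine Real.le_sqrt_of_sq_le ?_
    rw [norm_toL2_sq]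
    exact (h.mass_le_shiftedForm (w n)).trans (hw n)
  have hequi : ∀ ε > 0, ∃ r > 0, ∀ n, ∀ y : Space d, ‖y‖ < r →
      ‖translate y (toL2 h.measurable h.nonneg (w n)) - toL2 h.measurable h.nonneg (w n)‖ ≤ ε := by
    intro ε hε
    refine ⟨ε / ((d + 1) * √(2 * P + 1)), by positivity, fun n y hy => ?_⟩
    have hu := isWeakDeriv_of_isWeakPartial ((w n).2.1.locallyIntegrable (by norm_num))
      (fun i => isWeakPartial_weakPartial (w n).2 i) y
    have hg : MemLp (fun x => ∑ i, y i • weakPartial i (w n).1 x) 2 volume :=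
      memLp_finsetSum _ fun i _ => (memLp_weakPartial (w n).2 i).const_smul (y i)
    have h4 := norm_translate_sub_le hu (w n).2.1 hg 1
    rw [one_smul, abs_one, one_mul] at h4
    have e1 : hg.toLp _ = ∑ i, y i • gradL2 h.measurable h.nonneg i (w n) := by
      ext1
      refine hg.coeFn_toLp.trans ?_
      filter_upwards [Lp.coeFn_fun_finsetSum Finset.univ
        (fun i => y i • gradL2 h.measurable h.nonneg i (w n)), ae_all_iff.2 fun i =>
        (Lp.coeFn_smul (y i) (gradL2 h.measurable h.nonneg i (w n))),
        ae_all_iff.2 fun i => coeFn_gradL2 i (w n)] with x a1 a2 a3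
      rw [a1]
      simp only [a2, a3, Pi.smul_apply]
    rw [e1] at h4
    have h5 : ∀ i, ‖y i • gradL2 h.measurable h.nonneg i (w n)‖ ≤ ‖y‖ * √(2 * P + 1) := by
      intro i
      rw [norm_smul]
      gcongr
      · exact PiLp.norm_apply_le y i
      · refine Real.le_sqrt_of_sq_le ((norm_gradL2_sq_le i _).trans ?_)
        linarith [hP n]
    refine h4.trans ((norm_sum_le _ _).trans ((Finset.sum_le_sum fun i _ => h5 i).trans ?_))
    rw [Finset.sum_const, Finset.card_univ, Fintype.card_fin, nsmul_eq_mul]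
    rw [lt_div_iff₀ (by positivity)] at hy
    have : 0 ≤ ‖y‖ * √(2 * P + 1) := by positivity
    nlinarith
  have htight : ∀ ε > 0, ∃ R, ∀ n, eLpNorm (toL2 h.measurable h.nonneg (w n)) 2
      (volume.restrict (Metric.ball 0 R)ᶜ) ≤ ENNReal.ofReal ε := by
    intro ε hε
    obtain ⟨R, hR⟩ : ∃ R, ∀ x : Space d, x ∈ (Metric.ball (0 : Space d) R)ᶜ →
        P / ε ^ 2 + 1 ≤ V x := by
      have hev := hV.eventually_ge_atTop (P / ε ^ 2 + 1)
      rw [← Metric.cobounded_eq_cocompact] at hev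
      obtain ⟨R, -, hR⟩ := (Metric.hasBasis_cobounded_compl_ball (0 : Space d)).eventually_iff.1 hev
      exact ⟨R, fun x hx => hR hx⟩
    refine ⟨R, fun n => ?_⟩
    set A := P / ε ^ 2 + 1 with hA
    have hA0 : 0 < A := by positivity
    rw [← ENNReal.pow_le_pow_left_iff two_ne_zero, eLpNorm_two_sq]
    calc ∫⁻ x in (Metric.ball 0 R)ᶜ, ‖toL2 h.measurable h.nonneg (w n) x‖ₑ ^ 2
        = ∫⁻ x in (Metric.ball 0 R)ᶜ, ‖(w n).1 x‖ₑ ^ 2 := by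
          refine lintegral_congr_ae (ae_restrict_of_ae ?_)
          filter_upwards [coeFn_toL2 (w n)] with x hx
          rw [hx]
      _ ≤ ∫⁻ x in (Metric.ball 0 R)ᶜ, ENNReal.ofReal (A⁻¹ * (V x * ‖(w n).1 x‖ ^ 2)) := by
          refine setLIntegral_mono' measurableSet_ball.compl fun x hx => ?_
          rw [← ofReal_norm, ← ENNReal.ofReal_pow (norm_nonneg _)]
          refine ENNReal.ofReal_le_ofReal ?_
          rw [inv_mul_eq_div, le_div_iff₀ hA0, mul_comm]
          exact mul_le_mul_of_nonneg_right (hR x hx) (sq_nonneg _)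
      _ ≤ ∫⁻ x, ENNReal.ofReal (A⁻¹ * (V x * ‖(w n).1 x‖ ^ 2)) := setLIntegral_le_lintegral _ _
      _ = ENNReal.ofReal (A⁻¹ * ∫ x, V x * ‖(w n).1 x‖ ^ 2) := by
          rw [← integral_const_mul, ofReal_integral_eq_lintegral_ofReal ((w n).2.2.2.const_mul _)]
          exact Eventually.of_forall fun x => mul_nonneg (inv_nonneg.2 hA0.le)
            (mul_nonneg (h.nonneg x) (sq_nonneg _))
      _ ≤ ENNReal.ofReal (ε ^ 2) := by
          refine ENNReal.ofReal_le_ofReal ?_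
          rw [← norm_potL2_sq (hVm := h.measurable) (hV0 := h.nonneg), inv_mul_eq_div,
            div_le_iff₀ hA0]
          refine ((norm_potL2_sq_le (w n)).trans (hP n)).trans ?_
          rw [hA, mul_add, mul_div_cancel₀ _ (by positivity)]
          nlinarith [sq_nonneg ε]
      _ = ENNReal.ofReal ε ^ 2 := ENNReal.ofReal_pow hε.le 2
  obtain ⟨φ, hφ, hc⟩ := exists_subseq_cauchySeq_of_equicontinuous_of_tight hbdd hequi htight
  refine ⟨φ, hφ, fun ε hε => ?_⟩
  rw [Metric.cauchySeq_iff] at hc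
  obtain ⟨n, hn⟩ := hc √ε (by positivity)
  refine ⟨n, fun j hj k hk => ?_⟩
  have h4 := hn j hj k hk
  rw [Function.comp_apply, Function.comp_apply, dist_eq_norm, ← map_sub] at h4
  rw [massForm_self, ← norm_toL2_sq]
  have := pow_lt_pow_left₀ h4 (norm_nonneg _) two_ne_zero
  rwa [Real.sq_sqrt hε.le] at this

end RotationBound

end Forms

/-! ### Existence of minimizers of the action -/

section Nonlinear

variable {d : ℕ} {V : Space d → ℝ} {u v w : Space d → ℂ} {Ω θ C p β : ℝ}

/-- The nonlinear part `(2β/(p+1)) ‖u‖_{L^{p+1}}^{p+1}` of the energy. -/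
noncomputable def powerEnergy (p β : ℝ) (u : Space d → ℂ) : ℝ≥0∞ :=
  ENNReal.ofReal (2 * β / (p + 1)) * ∫⁻ x, ‖u x‖ₑ ^ (p + 1)

lemma action_eq (V : Space d → ℝ) (p β Ω ω : ℝ) (u : Space d → ℂ) :
    action V p β Ω ω u =
      ((quadraticEnergy V Ω u + ω * mass u : ℝ) : EReal) + (powerEnergy p β u : EReal) := by
  rw [action, energy, powerEnergy, EReal.coe_add, add_assoc, add_assoc,
    add_comm ((ω * mass u : ℝ) : EReal)]

lemma powerEnergy_zero (hp : 1 < p) : powerEnergy p β (0 : Space d → ℂ) = 0 := by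
  have : 0 < p + 1 := by linarith
  simp [powerEnergy, ENNReal.zero_rpow_of_pos this]

lemma two_mul_enorm_rpow_midpoint_le (hp : 1 < p) (a b : ℂ) :
    2 * ‖(1 / 2 : ℝ) • (a + b)‖ₑ ^ (p + 1) ≤ ‖a‖ₑ ^ (p + 1) + ‖b‖ₑ ^ (p + 1) := by
  have h1 := ENNReal.rpow_arith_mean_le_arith_mean2_rpow (1 / 2) (1 / 2) ‖a‖ₑ ‖b‖ₑ
    (by simpa using ENNReal.inv_two_add_inv_two) (p := p + 1) (by linarith)
  have h2 : ‖(1 / 2 : ℝ) • (a + b)‖ₑ ≤ 1 / 2 * ‖a‖ₑ + 1 / 2 * ‖b‖ₑ := by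
    rw [enorm_smul, ← mul_add]
    have : ‖(1 / 2 : ℝ)‖ₑ = 1 / 2 := by
      rw [← ofReal_norm, Real.norm_of_nonneg (by norm_num), ENNReal.ofReal_div_of_pos two_pos]
      simp
    rw [this]
    gcongr
    exact enorm_add_le a b
  calc 2 * ‖(1 / 2 : ℝ) • (a + b)‖ₑ ^ (p + 1)
      ≤ 2 * (1 / 2 * ‖a‖ₑ ^ (p + 1) + 1 / 2 * ‖b‖ₑ ^ (p + 1)) := by
        gcongr
        exact (ENNReal.rpow_le_rpow h2 (by linarith)).trans h1
    _ = _ := by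
        rw [← mul_add, ← mul_assoc, one_div, ENNReal.mul_inv_cancel two_ne_zero (by simp), one_mul]

lemma two_mul_powerEnergy_midpoint_le (hp : 1 < p) (hu : AEStronglyMeasurable u volume) :
    2 * powerEnergy p β ((1 / 2 : ℝ) • (u + v)) ≤ powerEnergy p β u + powerEnergy p β v := by
  rw [powerEnergy, powerEnergy, powerEnergy, ← mul_add, mul_left_comm]
  gcongr
  rw [← lintegral_add_left' (hu.enorm.pow_const _), ← lintegral_const_mul' _ _ (by simp)]
  exact lintegral_mono fun x => two_mul_enorm_rpow_midpoint_le hp _ _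

lemma powerEnergy_coef_pos (hp : 1 < p) (hβ : 0 < β) : 0 < 2 * β / (p + 1) := by
  have : 0 < p + 1 := by linarith
  positivity

lemma integrable_rpow_of_memLp (hp : 1 < p) (hu : MemLp u (ENNReal.ofReal (p + 1)) volume) :
    Integrable fun x => ‖u x‖ ^ (p + 1) := by
  have := hu.integrable_norm_rpow (by simp; linarith) (by simp)
  rwa [ENNReal.toReal_ofReal (by linarith)] at this

lemma lintegral_enorm_rpow (hp : 1 < p) (u : Space d → ℂ) :
    ∫⁻ x, ‖u x‖ₑ ^ (p + 1) = ∫⁻ x, ENNReal.ofReal (‖u x‖ ^ (p + 1)) := by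
  congr 1
  funext x
  rw [← ofReal_norm, ENNReal.ofReal_rpow_of_nonneg (norm_nonneg _) (by linarith)]

lemma powerEnergy_toReal (hp : 1 < p) (hβ : 0 < β)
    (hu : MemLp u (ENNReal.ofReal (p + 1)) volume) :
    powerEnergy p β u ≠ ⊤ ∧
      (powerEnergy p β u).toReal = 2 * β / (p + 1) * ∫ x, ‖u x‖ ^ (p + 1) := by
  have hc := powerEnergy_coef_pos hp hβ
  have : powerEnergy p β u = ENNReal.ofReal (2 * β / (p + 1) * ∫ x, ‖u x‖ ^ (p + 1)) := by
    rw [powerEnergy, lintegral_enorm_rpow hp, ENNReal.ofReal_mul hc.le,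
      ofReal_integral_eq_lintegral_ofReal (integrable_rpow_of_memLp hp hu)
        (Eventually.of_forall fun x => Real.rpow_nonneg (norm_nonneg _) _)]
  rw [this]
  refine ⟨ENNReal.ofReal_ne_top, ENNReal.toReal_ofReal (mul_nonneg hc.le ?_)⟩
  exact integral_nonneg fun x => Real.rpow_nonneg (norm_nonneg _) _

lemma memLp_of_powerEnergy_ne_top (hp : 1 < p) (hβ : 0 < β) (hu : AEStronglyMeasurable u volume)
    (h : powerEnergy p β u ≠ ⊤) : MemLp u (ENNReal.ofReal (p + 1)) volume := by
  have hc := powerEnergy_coef_pos hp hβ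
  refine ⟨hu, ?_⟩
  rw [eLpNorm_lt_top_iff_lintegral_rpow_enorm_lt_top (by simp; linarith) (by simp),
    ENNReal.toReal_ofReal (by linarith)]
  refine lt_top_iff_ne_top.2 fun hc' => h ?_
  rw [powerEnergy, hc', ENNReal.mul_top (by simpa using hc)]

/-- `A t²` is dominated by `c t^{p+1}` up to a constant. -/
lemma exists_sq_le_rpow_add (hp : 1 < p) {A c : ℝ} (hA : 0 ≤ A) (hc : 0 < c) :
    ∃ K, 0 ≤ K ∧ ∀ t : ℝ, 0 ≤ t → A * t ^ 2 ≤ c * t ^ (p + 1) + K := by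
  set T := (A / c) ^ (1 / (p - 1)) with hT
  have hp1 : 0 < p - 1 := by linarith
  have hT0 : 0 ≤ T := by positivity
  refine ⟨A * T ^ 2, by positivity, fun t ht => ?_⟩
  rcases le_total t T with h | h
  · have h1 : A * t ^ 2 ≤ A * T ^ 2 := by gcongr
    have : 0 ≤ c * t ^ (p + 1) := by positivity
    linarith
  · have h1 : A / c ≤ t ^ (p - 1) := by
      have := Real.rpow_le_rpow hT0 h hp1.le
      rwa [hT, ← Real.rpow_mul (by positivity), one_div, inv_mul_cancel₀ hp1.ne',
        Real.rpow_one] at this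
    have h2 : t ^ (p + 1) = t ^ (p - 1) * t ^ 2 := by
      rw [← Real.rpow_natCast t 2, ← Real.rpow_add_of_nonneg ht hp1.le (by norm_num)]
      congr 1
      push_cast
      ring
    rw [div_le_iff₀ hc] at h1
    have : 0 ≤ A * T ^ 2 := by positivity
    rw [h2]
    nlinarith [mul_le_mul_of_nonneg_right h1 (sq_nonneg t)]

/-- Lower semicontinuity of the power with respect to `L²` convergence, by Fatou's lemma. -/
lemma powerEnergy_le_of_tendsto {hVm : Measurable V} {hV0 : ∀ x, 0 ≤ V x}
    (w : ℕ → energySubmodule V hVm hV0) (u : energySubmodule V hVm hV0) (b : ℝ≥0∞)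
    (hw : Tendsto (fun n => massForm hVm hV0 (w n - u) (w n - u)) atTop (𝓝 0))
    (hb : ∀ n, powerEnergy p β (w n).1 ≤ b) : powerEnergy p β u.1 ≤ b := by
  have h1 : Tendsto (fun n => toL2 hVm hV0 (w n)) atTop (𝓝 (toL2 hVm hV0 u)) := by
    rw [tendsto_iff_norm_sub_tendsto_zero]
    have := (Real.continuous_sqrt.tendsto _).comp hw
    rw [Real.sqrt_zero] at this
    refine this.congr fun n => ?_
    rw [Function.comp_apply, massForm_self, ← norm_toL2_sq, Real.sqrt_sq (norm_nonneg _), map_sub]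
  obtain ⟨φ, hφ, hae⟩ := (tendstoInMeasure_of_tendsto_Lp h1).exists_seq_tendsto_ae
  have h2 : ∫⁻ x, ‖u.1 x‖ₑ ^ (p + 1) ≤
      liminf (fun n => ∫⁻ x, ‖(w (φ n)).1 x‖ₑ ^ (p + 1)) atTop := by
    refine le_trans ?_ (lintegral_liminf_le' fun n => (w (φ n)).2.1.1.enorm.pow_const _)
    refine lintegral_mono_ae ?_
    filter_upwards [hae, coeFn_toL2 u, ae_all_iff.2 fun n => coeFn_toL2 (w n)] with x h3 h4 h5
    simp only [h4, h5] at h3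
    exact (((ENNReal.continuous_rpow_const (y := p + 1)).tendsto _).comp h3.enorm).liminf_eq.ge
  calc powerEnergy p β u.1 ≤ ENNReal.ofReal (2 * β / (p + 1)) *
        liminf (fun n => ∫⁻ x, ‖(w (φ n)).1 x‖ₑ ^ (p + 1)) atTop := by
        rw [powerEnergy]
        gcongr
    _ = liminf (fun n => powerEnergy p β (w (φ n)).1) atTop := by
        simp only [powerEnergy]
        exact (ENNReal.liminf_const_mul_of_ne_top ENNReal.ofReal_ne_top).symm
    _ ≤ liminf (fun _ : ℕ => b) atTop := liminf_le_liminf (Eventually.of_forall fun n => hb (φ n))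
    _ = b := liminf_const b

namespace RotationBound

/-- Coercivity: any multiple of the mass is controlled by the potential energy far out and by the
nonlinearity elsewhere. -/
lemma exists_mass_le (h : RotationBound V Ω θ C) (hV : Tendsto V (cocompact (Space d)) atTop)
    (hp : 1 < p) (hβ : 0 < β) (a : ℝ) :
    ∃ K, ∀ u : energySubmodule V h.measurable h.nonneg, powerEnergy p β u.1 ≠ ⊤ →
      a * mass u.1 ≤ h.shiftedForm u u / 2 + (powerEnergy p β u.1).toReal + K := by
  have h3 : 0 < 1 - θ := sub_pos.2 h.lt_one
  have hc := powerEnergy_coef_pos hp hβ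
  obtain ⟨K, hK0, hK⟩ := exists_sq_le_rpow_add hp (abs_nonneg a) hc
  obtain ⟨R, hR⟩ : ∃ R, ∀ x : Space d, x ∈ (Metric.ball (0 : Space d) R)ᶜ →
      2 * |a| / (1 - θ) ≤ V x := by
    have hev := hV.eventually_ge_atTop (2 * |a| / (1 - θ))
    rw [← Metric.cobounded_eq_cocompact] at hev
    obtain ⟨R, -, hR⟩ := (Metric.hasBasis_cobounded_compl_ball (0 : Space d)).eventually_iff.1 hev
    exact ⟨R, fun x hx => hR hx⟩
  refine ⟨∫ x, (Metric.ball (0 : Space d) R).indicator (fun _ => K) x, fun u hu => ?_⟩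
  have hup := memLp_of_powerEnergy_ne_top hp hβ u.2.1.1 hu
  rw [(powerEnergy_toReal hp hβ hup).2]
  have i1 := (memLp_two_iff_integrable_sq_norm u.2.1.1).1 u.2.1
  have i2 := u.2.2.2.const_mul ((1 - θ) / 2)
  have i3 := (integrable_rpow_of_memLp hp hup).const_mul (2 * β / (p + 1))
  have i4 : Integrable ((Metric.ball (0 : Space d) R).indicator fun _ => K) :=
    (integrable_indicator_iff measurableSet_ball).2 (integrableOn_const measure_ball_lt_top.ne)
  have key : |a| * mass u.1 ≤ (1 - θ) / 2 * (∫ x, V x * ‖u.1 x‖ ^ 2) +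
      2 * β / (p + 1) * (∫ x, ‖u.1 x‖ ^ (p + 1)) +
      ∫ x, (Metric.ball (0 : Space d) R).indicator (fun _ => K) x := by
    rw [mass, ← integral_const_mul, ← integral_const_mul, ← integral_const_mul]
    have s1 := integral_add i2 i3
    have s2 := integral_add (i2.add i3) i4
    rw [← s1]
    refine le_trans ?_ s2.le
    refine integral_mono (i1.const_mul _) ((i2.add i3).add i4) fun x => ?_
    have hpow : 0 ≤ 2 * β / (p + 1) * ‖u.1 x‖ ^ (p + 1) := by positivity
    by_cases hx : x ∈ Metric.ball (0 : Space d) R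
    · simp only [Pi.add_apply, indicator_of_mem hx]
      have := hK ‖u.1 x‖ (norm_nonneg _)
      have := mul_nonneg (half_pos h3).le (mul_nonneg (h.nonneg x) (sq_nonneg ‖u.1 x‖))
      linarith
    · simp only [Pi.add_apply, indicator_of_notMem hx, add_zero]
      have h4 := hR x hx
      rw [div_le_iff₀ h3] at h4
      have := mul_le_mul_of_nonneg_right h4 (sq_nonneg ‖u.1 x‖)
      nlinarith
  have h5 := mul_le_mul_of_nonneg_right (le_abs_self a) (mass_nonneg u.1)
  have h6 := h.le_shiftedForm u
  have h7 := norm_potL2_sq_le u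
  rw [norm_potL2_sq] at h7
  have h8 := mul_le_mul_of_nonneg_left h7 h3.le
  have h9 := mass_nonneg u.1
  linarith

/-- The action attains its minimum over the energy space. -/
theorem exists_minimizer (h : RotationBound V Ω θ C)
    (hV : Tendsto V (cocompact (Space d)) atTop) (hp : 1 < p) (hβ : 0 < β) (ω : ℝ) :
    ∃ u : energySubmodule V h.measurable h.nonneg, powerEnergy p β u.1 ≠ ⊤ ∧
      ∀ v : energySubmodule V h.measurable h.nonneg, powerEnergy p β v.1 ≠ ⊤ →
        quadraticEnergy V Ω u.1 + ω * mass u.1 + (powerEnergy p β u.1).toReal ≤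
        quadraticEnergy V Ω v.1 + ω * mass v.1 + (powerEnergy p β v.1).toReal := by
  obtain ⟨K, hK⟩ := h.exists_mass_le hV hp hβ (C / θ + 1 - ω)
  obtain ⟨u, hu, hmin⟩ := exists_minimizer_of_compact (q := h.shiftedForm)
    (m := massForm h.measurable h.nonneg) (N := fun u => powerEnergy p β u.1)
    (a := C / θ + 1 - ω) (K := K)
    h.shiftedForm_symm massForm_symm (fun u => by rw [massForm_self]; exact mass_nonneg _)
    (fun u => by rw [massForm_self]; exact h.mass_le_shiftedForm u) (powerEnergy_zero hp)
    (fun u v => two_mul_powerEnergy_midpoint_le hp u.2.1.1)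
    (fun u hu => by rw [massForm_self]; linarith [hK u hu])
    (h.exists_subseq_massForm hV) h.exists_tendsto_shiftedForm
    (fun w u b => powerEnergy_le_of_tendsto w u b)
  have e : ∀ u, h.shiftedForm u u - (C / θ + 1 - ω) * massForm h.measurable h.nonneg u u =
      quadraticEnergy V Ω u.1 + ω * mass u.1 := by
    intro u
    rw [shiftedForm_apply, h.energyForm_self, massForm_self]
    ring
  refine ⟨u, hu, fun v hv => ?_⟩
  rw [← e, ← e]
  exact hmin v hv

end RotationBound

end Nonlinear

section EulerLagrange

variable {d : ℕ} {V : Space d → ℝ} {u v : Space d → ℂ} {Ω θ C p β : ℝ}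

lemma rpow_mul_le_add (hp : 1 < p) {a b : ℝ} (ha : 0 ≤ a) (hb : 0 ≤ b) :
    a ^ p * b ≤ a ^ (p + 1) + b ^ (p + 1) := by
  have hp0 : 0 ≤ p := by linarith
  rcases le_total a b with h | h
  · have h1 : a ^ p * b ≤ b ^ p * b := by gcongr
    have h2 : b ^ (p + 1) = b ^ p * b := by
      rw [Real.rpow_add_of_nonneg hb hp0 zero_le_one, Real.rpow_one]
    have : 0 ≤ a ^ (p + 1) := by positivity
    linarith
  · have h1 : a ^ p * b ≤ a ^ p * a := by gcongr
    have h2 : a ^ (p + 1) = a ^ p * a := by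
      rw [Real.rpow_add_of_nonneg ha hp0 zero_le_one, Real.rpow_one]
    have : 0 ≤ b ^ (p + 1) := by positivity
    linarith

lemma integrable_power_mul_conj (hp : 1 < p) (hu : MemLp u (ENNReal.ofReal (p + 1)) volume)
    (hv : MemLp v (ENNReal.ofReal (p + 1)) volume) :
    Integrable fun x => ((‖u x‖ ^ (p - 1) : ℝ) : ℂ) * u x * (starRingEnd ℂ) (v x) := by
  refine ((integrable_rpow_of_memLp hp hu).add (integrable_rpow_of_memLp hp hv)).mono' ?_
    (Eventually.of_forall fun x => ?_)
  · exact ((Complex.measurable_ofReal.comp_aemeasurable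
      (hu.1.norm.aemeasurable.pow_const _)).aestronglyMeasurable.mul hu.1).mul
      (Complex.continuous_conj.comp_aestronglyMeasurable hv.1)
  · rw [norm_mul, norm_mul, RCLike.norm_conj, Complex.norm_real,
      Real.norm_of_nonneg (by positivity)]
    have h1 : ‖u x‖ ^ (p - 1) * ‖u x‖ = ‖u x‖ ^ p := by
      have := Real.rpow_add_of_nonneg (norm_nonneg (u x)) (y := p - 1) (z := 1) (by linarith)
        zero_le_one
      rw [Real.rpow_one] at this
      rw [← this]
      congr 1
      ring
    rw [h1]
    exact rpow_mul_le_add hp (norm_nonneg _) (norm_nonneg _)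

lemma hasDerivAt_integral_norm_rpow (hp : 1 < p) (hu : MemLp u (ENNReal.ofReal (p + 1)) volume)
    (hv : MemLp v (ENNReal.ofReal (p + 1)) volume) :
    HasDerivAt (fun t : ℝ => ∫ x, ‖u x + t • v x‖ ^ (p + 1))
      ((p + 1) * (∫ x, ((‖u x‖ ^ (p - 1) : ℝ) : ℂ) * u x * (starRingEnd ℂ) (v x)).re) 0 := by
  have hp1 : 1 < p + 1 := by linarith
  let F' : ℝ → Space d → ℝ := fun t x =>
    (p + 1) * ‖u x + t • v x‖ ^ (p + 1 - 2) * ⟪u x + t • v x, v x⟫_ℝ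
  have hder : ∀ x t, HasDerivAt (fun t : ℝ => ‖u x + t • v x‖ ^ (p + 1)) (F' t x) t := by
    intro x t
    have h1 : HasDerivAt (fun t : ℝ => u x + t • v x) (v x) t := by
      simpa using ((hasDerivAt_id t).smul_const (v x)).const_add (u x)
    have h2 := (hasFDerivAt_norm_rpow (u x + t • v x) hp1).comp_hasDerivAt t h1
    have h3 : ((p + 1) * ‖u x + t • v x‖ ^ (p + 1 - 2)) • innerSL ℝ (u x + t • v x) (v x) =
        F' t x := rfl
    rw [← h3]
    exact h2
  have hbound : MemLp (fun x => ‖u x‖ + ‖v x‖) (ENNReal.ofReal (p + 1)) volume :=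
    hu.norm.add hv.norm
  have hbi : Integrable fun x => (‖u x‖ + ‖v x‖) ^ (p + 1) := by
    have := hbound.integrable_norm_rpow (by simp; linarith) (by simp)
    rw [ENNReal.toReal_ofReal (by linarith)] at this
    refine this.congr (Eventually.of_forall fun x => ?_)
    simp only
    rw [Real.norm_of_nonneg (by positivity)]
  have hmeas : ∀ t : ℝ, MemLp (fun x => u x + t • v x) (ENNReal.ofReal (p + 1)) volume :=
    fun t => hu.add (hv.const_smul t)
  have key := hasDerivAt_integral_of_dominated_loc_of_deriv_le (μ := volume)
    (F := fun (t : ℝ) x => ‖u x + t • v x‖ ^ (p + 1)) (F' := F') (x₀ := (0 : ℝ))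
    (s := Metric.ball 0 1) (bound := fun x => (p + 1) * (‖u x‖ + ‖v x‖) ^ (p + 1))
    (Metric.ball_mem_nhds _ one_pos)
    (Eventually.of_forall fun t => (integrable_rpow_of_memLp hp (hmeas t)).1)
    (integrable_rpow_of_memLp hp (hmeas 0)) ?_ ?_ (hbi.const_mul _)
    (Eventually.of_forall fun x t _ => hder x t)
  · have hval : (p + 1) * (∫ x, ((‖u x‖ ^ (p - 1) : ℝ) : ℂ) * u x * (starRingEnd ℂ) (v x)).re =
        ∫ x, F' 0 x := ?_
    · rw [hval]
      exact key.2
    rw [← Complex.re_ofReal_mul, ← integral_const_mul, ← RCLike.re_eq_complex_re, ← integral_re]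
    · congr 1
      funext x
      simp only [F', zero_smul, add_zero, RCLike.re_eq_complex_re]
      rw [Complex.re_ofReal_mul, mul_assoc, Complex.re_ofReal_mul, mul_assoc]
      have : p + 1 - 2 = p - 1 := by ring
      rw [this, Complex.inner]
      congr 2
      simp [mul_comm]
    · exact (integrable_power_mul_conj hp hu hv).const_mul _
  · have h1 := (hmeas 0).1
    exact ((aestronglyMeasurable_const.mul
      (h1.norm.aemeasurable.pow_const _).aestronglyMeasurable).mul (h1.inner hv.1))
  · refine Eventually.of_forall fun x t ht => ?_
    have ht' : |t| < 1 := by simpa using ht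
    have h1 : ‖u x + t • v x‖ ≤ ‖u x‖ + ‖v x‖ := by
      refine (norm_add_le _ _).trans ?_
      rw [norm_smul, Real.norm_eq_abs]
      nlinarith [norm_nonneg (v x)]
    have h2 : |⟪u x + t • v x, v x⟫_ℝ| ≤ ‖u x + t • v x‖ * ‖v x‖ := abs_real_inner_le_norm _ _
    simp only [F', Real.norm_eq_abs, abs_mul]
    rw [abs_of_nonneg (by linarith : 0 ≤ p + 1), abs_of_nonneg (by positivity :
      0 ≤ ‖u x + t • v x‖ ^ (p + 1 - 2)), mul_assoc]
    refine mul_le_mul_of_nonneg_left ?_ (by linarith)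
    have h3 : (‖u x‖ + ‖v x‖) ^ (p + 1) =
        (‖u x‖ + ‖v x‖) ^ (p + 1 - 2) * ((‖u x‖ + ‖v x‖) * (‖u x‖ + ‖v x‖)) := by
      rw [← pow_two, ← Real.rpow_natCast _ 2, ← Real.rpow_add_of_nonneg (by positivity)
        (by linarith) (by norm_num)]
      congr 1
      push_cast
      ring
    rw [h3]
    have hp2 : 0 ≤ p + 1 - 2 := by linarith
    have h4 : ‖u x + t • v x‖ * ‖v x‖ ≤ (‖u x‖ + ‖v x‖) * (‖u x‖ + ‖v x‖) := by
      gcongr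
      linarith [norm_nonneg (u x)]
    exact mul_le_mul (Real.rpow_le_rpow (norm_nonneg _) h1 hp2) (h2.trans h4) (abs_nonneg _)
      (by positivity)

end EulerLagrange

/-! ### The Euler–Lagrange equation -/

section Stationary

variable {d : ℕ} {V : Space d → ℝ} {u v : Space d → ℂ} {Ω θ C p β : ℝ}

namespace RotationBound

lemma integral_stationary (h : RotationBound V Ω θ C) (hp : 1 < p) (ω : ℝ)
    (hu : u ∈ energySpace V) (hup : MemLp u (ENNReal.ofReal (p + 1)) volume)
    (hv : v ∈ energySpace V) (hvp : MemLp v (ENNReal.ofReal (p + 1)) volume) :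
    ∫ x, (1 / 2 * (∑ i : Fin d, weakPartial i u x * (starRingEnd ℂ) (weakPartial i v x))
        + ((V x : ℂ) * u x + (β : ℂ) * ((‖u x‖ ^ (p - 1) : ℝ) : ℂ) * u x
          - (Ω : ℂ) * Lz u x + (ω : ℂ) * u x) * (starRingEnd ℂ) (v x)) =
      (∫ x, formDensity V Ω u v x) + ω * (∫ x, u x * (starRingEnd ℂ) (v x)) +
        β * ∫ x, ((‖u x‖ ^ (p - 1) : ℝ) : ℂ) * u x * (starRingEnd ℂ) (v x) := by
  have i1 := h.integrable_formDensity hu hv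
  have i2 := (integrable_mul_conj hu.1 hv.1).const_mul (ω : ℂ)
  have i3 := (integrable_power_mul_conj hp hup hvp).const_mul (β : ℂ)
  rw [← integral_const_mul, ← integral_const_mul]
  have s1 := integral_add i1 i2
  have s2 := integral_add (i1.add i2) i3
  rw [← s1]
  refine Eq.trans ?_ s2
  congr 1
  funext x
  simp only [formDensity, Pi.add_apply]
  ring

/-- A minimizer of the action satisfies the Euler–Lagrange equation. Real variations in the
directions `v` and `iv` give the real and the imaginary part. -/
theorem isStationary_of_minimizer (h : RotationBound V Ω θ C) (hp : 1 < p) (hβ : 0 < β) (ω : ℝ)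
    (u : energySubmodule V h.measurable h.nonneg) (hu : powerEnergy p β u.1 ≠ ⊤)
    (hmin : ∀ v : energySubmodule V h.measurable h.nonneg, powerEnergy p β v.1 ≠ ⊤ →
        quadraticEnergy V Ω u.1 + ω * mass u.1 + (powerEnergy p β u.1).toReal ≤
        quadraticEnergy V Ω v.1 + ω * mass v.1 + (powerEnergy p β v.1).toReal) :
    IsStationary V p β Ω ω u.1 := by
  have hup := memLp_of_powerEnergy_ne_top hp hβ u.2.1.1 hu
  have hp1 : p + 1 ≠ 0 := by linarith
  let Φ : (Space d → ℂ) → ℂ := fun v => (∫ x, formDensity V Ω u.1 v x) +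
    ω * (∫ x, u.1 x * (starRingEnd ℂ) (v x)) +
    β * ∫ x, ((‖u.1 x‖ ^ (p - 1) : ℝ) : ℂ) * u.1 x * (starRingEnd ℂ) (v x)
  have key : ∀ v ∈ energySpace V, MemLp v (ENNReal.ofReal (p + 1)) volume → (Φ v).re = 0 := by
    intro v hv hvp
    obtain ⟨v, rfl⟩ : ∃ v' : energySubmodule V h.measurable h.nonneg, v'.1 = v := ⟨⟨v, hv⟩, rfl⟩
    set B := h.energyForm + ω • massForm h.measurable h.nonneg with hB
    have hBs : ∀ a b, B a b = B b a := by
      intro a b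
      simp only [hB, LinearMap.add_apply, LinearMap.smul_apply, h.energyForm_symm a b,
        massForm_symm a b]
    have hBself : ∀ a, B a a = quadraticEnergy V Ω a.1 + ω * mass a.1 := by
      intro a
      simp [hB, h.energyForm_self, massForm_self]
    let f : ℝ → ℝ := fun t => B u u + 2 * (t * B u v) + t ^ 2 * B v v +
      2 * β / (p + 1) * ∫ x, ‖u.1 x + t • v.1 x‖ ^ (p + 1)
    have hf : ∀ t, f t = quadraticEnergy V Ω (u + t • v).1 + ω * mass (u + t • v).1 +
        (powerEnergy p β (u + t • v).1).toReal := by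
      intro t
      have hN : (powerEnergy p β (u + t • v).1).toReal =
          2 * β / (p + 1) * ∫ x, ‖u.1 x + t • v.1 x‖ ^ (p + 1) :=
        (powerEnergy_toReal hp hβ (hup.add (hvp.const_smul t))).2
      rw [← hBself, apply_self_add hBs, hN]
      simp only [map_smul, LinearMap.smul_apply, smul_eq_mul, f]
      congr 1
      ring
    have hfmin : IsLocalMin f 0 := by
      refine Eventually.of_forall fun t => ?_
      have h0 := hf 0
      rw [zero_smul, add_zero] at h0
      rw [h0, hf]
      exact hmin _ (powerEnergy_toReal hp hβ (hup.add (hvp.const_smul t))).1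
    have hder := hasDerivAt_integral_norm_rpow hp hup hvp
    have hfder : HasDerivAt f (2 * B u v + 2 * β / (p + 1) * ((p + 1) *
        (∫ x, ((‖u.1 x‖ ^ (p - 1) : ℝ) : ℂ) * u.1 x * (starRingEnd ℂ) (v.1 x)).re)) 0 := by
      have d1 : HasDerivAt (fun t : ℝ => B u u + 2 * (t * B u v) + t ^ 2 * B v v)
          (2 * B u v) 0 := by
        have a1 := ((hasDerivAt_id (0 : ℝ)).mul_const (B u v)).const_mul 2
        have a2 := ((hasDerivAt_id (0 : ℝ)).pow 2).mul_const (B v v)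
        exact ((a1.const_add (B u u)).add a2).congr_deriv (by simp)
      exact d1.add (hder.const_mul _)
    have h0 := hfmin.hasDerivAt_eq_zero hfder
    have h1 : (Φ v.1).re = B u v + β *
        (∫ x, ((‖u.1 x‖ ^ (p - 1) : ℝ) : ℂ) * u.1 x * (starRingEnd ℂ) (v.1 x)).re := by
      simp only [Φ, Complex.add_re, Complex.re_ofReal_mul, hB, LinearMap.add_apply,
        LinearMap.smul_apply, smul_eq_mul, massForm_eq_integral, h.energyForm_apply]
    rw [h1]
    field_simp at h0
    linarith
  refine ⟨u.2, fun v hv hvp => ?_⟩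
  rw [h.integral_stationary hp ω u.2 hup hv hvp]
  change Φ v = 0
  have hI : Φ (Complex.I • v) = -Complex.I * Φ v := by
    have hIv := smul_mem_energySpace Complex.I hv
    have e1 : ∫ x, formDensity V Ω u.1 (Complex.I • v) x =
        -Complex.I * ∫ x, formDensity V Ω u.1 v x := by
      rw [h.integral_formDensity_symm u.2 hIv, integral_formDensity_smul Complex.I hv, map_mul,
        Complex.conj_I, ← h.integral_formDensity_symm u.2 hv]
    have e2 : ∀ F : Space d → ℂ, ∫ x, F x * (starRingEnd ℂ) ((Complex.I • v) x) =
        -Complex.I * ∫ x, F x * (starRingEnd ℂ) (v x) := by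
      intro F
      rw [← integral_const_mul]
      congr 1
      funext x
      simp
      ring
    simp only [Φ]
    rw [e1, e2 u.1, e2 fun x => ((‖u.1 x‖ ^ (p - 1) : ℝ) : ℂ) * u.1 x]
    ring
  apply Complex.ext
  · exact key v hv hvp
  · have := key _ (smul_mem_energySpace Complex.I hv) (hvp.const_smul Complex.I)
    rw [hI] at this
    simpa using this

end RotationBound

end Stationary

/-! ### Truncation and the chain rule -/

section Truncation

/-- A smooth bounded truncation, `z / (1 + δ² |z|²)`. -/
noncomputable def truncate (δ : ℝ) (z : ℂ) : ℂ := (1 + (δ * ‖z‖) ^ 2)⁻¹ • z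

/-- The differential of `truncate δ` at `a`. -/
noncomputable def truncateDeriv (δ : ℝ) (a : ℂ) : ℂ →L[ℝ] ℂ :=
  (1 + (δ * ‖a‖) ^ 2)⁻¹ • ContinuousLinearMap.id ℝ ℂ -
    (2 * δ ^ 2 * ((1 + (δ * ‖a‖) ^ 2) ^ 2)⁻¹) • (innerSL ℝ a).smulRight a

lemma truncateDeriv_apply (δ : ℝ) (a b : ℂ) :
    truncateDeriv δ a b = (1 + (δ * ‖a‖) ^ 2)⁻¹ • b -
      (2 * δ ^ 2 * ((1 + (δ * ‖a‖) ^ 2) ^ 2)⁻¹ * ⟪a, b⟫_ℝ) • a := by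
  simp only [truncateDeriv, sub_apply, smul_apply,
    ContinuousLinearMap.id_apply, ContinuousLinearMap.smulRight_apply, innerSL_apply_apply,
    smul_smul]

lemma continuous_truncate (δ : ℝ) : Continuous (truncate δ) := by
  have h1 : Continuous fun z : ℂ => (1 + (δ * ‖z‖) ^ 2)⁻¹ :=
    Continuous.inv₀ (by fun_prop) fun z => by positivity
  exact h1.smul continuous_id

lemma continuous_truncateDeriv (δ : ℝ) : Continuous fun q : ℂ × ℂ => truncateDeriv δ q.1 q.2 := by
  simp_rw [truncateDeriv_apply]
  have h1 : Continuous fun q : ℂ × ℂ => (1 + (δ * ‖q.1‖) ^ 2)⁻¹ :=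
    Continuous.inv₀ (by fun_prop) fun z => by positivity
  have h2 : Continuous fun q : ℂ × ℂ => ((1 + (δ * ‖q.1‖) ^ 2) ^ 2)⁻¹ :=
    Continuous.inv₀ (by fun_prop) fun z => by positivity
  have h3 : Continuous fun q : ℂ × ℂ => ⟪q.1, q.2⟫_ℝ := continuous_fst.inner continuous_snd
  exact (h1.smul continuous_snd).sub (((continuous_const.mul h2).mul h3).smul continuous_fst)

lemma norm_truncate_le (δ : ℝ) (z : ℂ) : ‖truncate δ z‖ ≤ ‖z‖ := by
  rw [truncate, norm_smul, Real.norm_of_nonneg (by positivity)]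
  refine mul_le_of_le_one_left (norm_nonneg _) (inv_le_one_of_one_le₀ ?_)
  nlinarith [sq_nonneg (δ * ‖z‖)]

lemma norm_truncate_le_inv {δ : ℝ} (hδ : 0 < δ) (z : ℂ) : ‖truncate δ z‖ ≤ δ⁻¹ := by
  rw [truncate, norm_smul, Real.norm_of_nonneg (by positivity), inv_mul_eq_div,
    div_le_iff₀ (by positivity), inv_mul_eq_div, le_div_iff₀ hδ]
  nlinarith [sq_nonneg (δ * ‖z‖ - 1), norm_nonneg z]

lemma norm_truncateDeriv_le (δ : ℝ) (a b : ℂ) : ‖truncateDeriv δ a b‖ ≤ 3 * ‖b‖ := by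
  rw [truncateDeriv_apply]
  set s := 1 + (δ * ‖a‖) ^ 2 with hs
  have hs1 : 1 ≤ s := by nlinarith [sq_nonneg (δ * ‖a‖)]
  have hs0 : 0 < s := by linarith
  refine (norm_sub_le _ _).trans ?_
  rw [norm_smul, norm_smul, Real.norm_of_nonneg (by positivity), norm_mul,
    Real.norm_of_nonneg (by positivity), Real.norm_eq_abs]
  have h1 : s⁻¹ * ‖b‖ ≤ ‖b‖ := mul_le_of_le_one_left (norm_nonneg _) (inv_le_one_of_one_le₀ hs1)
  have h2 : 2 * δ ^ 2 * (s ^ 2)⁻¹ * |⟪a, b⟫_ℝ| * ‖a‖ ≤ 2 * ‖b‖ := by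
    have h3 := abs_real_inner_le_norm a b
    calc 2 * δ ^ 2 * (s ^ 2)⁻¹ * |⟪a, b⟫_ℝ| * ‖a‖
        ≤ 2 * δ ^ 2 * (s ^ 2)⁻¹ * (‖a‖ * ‖b‖) * ‖a‖ := by gcongr
      _ = 2 * ‖b‖ * ((δ * ‖a‖) ^ 2 / s ^ 2) := by ring
      _ ≤ 2 * ‖b‖ * 1 := by
        gcongr
        rw [div_le_one (by positivity)]
        nlinarith
      _ = _ := mul_one _
  linarith

/-- The Taylor remainder of `truncate δ` is quadratic, uniformly in the base point. -/
lemma norm_truncate_add_sub_le {δ : ℝ} (hδ : 0 < δ) (a b : ℂ) :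
    ‖truncate δ (a + b) - truncate δ a - truncateDeriv δ a b‖ ≤ 7 * δ * ‖b‖ ^ 2 := by
  rw [truncateDeriv_apply, truncate, truncate]
  set s := 1 + (δ * ‖a‖) ^ 2 with hs
  set t := 1 + (δ * ‖a + b‖) ^ 2 with ht
  set R := ⟪a, b⟫_ℝ with hR
  set α := ‖a‖
  set n := ‖b‖
  set γ := ‖a + b‖
  have hα : 0 ≤ α := norm_nonneg _
  have hn : 0 ≤ n := norm_nonneg _
  have hγ : 0 ≤ γ := norm_nonneg _
  have hs1 : 1 ≤ s := by nlinarith [sq_nonneg (δ * α)]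
  have ht1 : 1 ≤ t := by nlinarith [sq_nonneg (δ * γ)]
  have hs0 : 0 < s := by linarith
  have ht0 : 0 < t := by linarith
  have hsq : γ ^ 2 = α ^ 2 + 2 * R + n ^ 2 := norm_add_sq_real a b
  have hts : t - s = δ ^ 2 * (2 * R + n ^ 2) := by
    rw [hs, ht, mul_pow, mul_pow, hsq]; ring
  have hRle : |R| ≤ α * n := abs_real_inner_le_norm a b
  have hγα : |γ - α| ≤ n := by
    have := abs_norm_sub_norm_le (a + b) a
    simpa using this
  have hδα : δ * α ≤ s := by nlinarith [sq_nonneg (δ * α - 1), mul_nonneg hδ.le hα]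
  have hδγ : δ * γ ≤ t := by nlinarith [sq_nonneg (δ * γ - 1), mul_nonneg hδ.le hγ]
  have hst : s + t ≤ 2 * (s * t) := by nlinarith
  have hdiff : |t - s| ≤ 2 * δ * n * (s * t) := by
    have e1 : t - s = (γ - α) * δ * (δ * γ + δ * α) := by rw [hs, ht]; ring
    rw [e1, abs_mul, abs_mul, abs_of_pos hδ, abs_of_nonneg (by positivity : 0 ≤ δ * γ + δ * α)]
    calc |γ - α| * δ * (δ * γ + δ * α) ≤ n * δ * (2 * (s * t)) := by
          gcongr
          linarith
      _ = _ := by ring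
  have e : t⁻¹ • (a + b) - s⁻¹ • a - (s⁻¹ • b - (2 * δ ^ 2 * (s ^ 2)⁻¹ * R) • a) =
      (t⁻¹ - s⁻¹) • b + (t⁻¹ - s⁻¹ + 2 * δ ^ 2 * (s ^ 2)⁻¹ * R) • a := by
    module
  rw [e]
  have c1 : |t⁻¹ - s⁻¹| ≤ 2 * δ * n := by
    have : t⁻¹ - s⁻¹ = (s - t) / (s * t) := by field_simp
    rw [this, abs_div, abs_of_pos (by positivity : 0 < s * t), div_le_iff₀ (by positivity),
      abs_sub_comm]
    exact hdiff
  have c2 : |t⁻¹ - s⁻¹ + 2 * δ ^ 2 * (s ^ 2)⁻¹ * R| * α ≤ 5 * δ * n ^ 2 := by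
    have e2 : t⁻¹ - s⁻¹ + 2 * δ ^ 2 * (s ^ 2)⁻¹ * R =
        (2 * δ ^ 2 * R * (t - s) - δ ^ 2 * n ^ 2 * s) / (s ^ 2 * t) := by
      have e3 : s - t = - (δ ^ 2 * (2 * R + n ^ 2)) := by linarith
      field_simp
      linear_combination s * e3
    rw [e2, abs_div, abs_of_pos (by positivity : 0 < s ^ 2 * t), div_mul_eq_mul_div,
      div_le_iff₀ (by positivity)]
    have a1 : |2 * δ ^ 2 * R * (t - s) - δ ^ 2 * n ^ 2 * s| ≤
        2 * δ ^ 2 * (α * n) * (2 * δ * n * (s * t)) + δ ^ 2 * n ^ 2 * s := by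
      refine (abs_sub _ _).trans ?_
      rw [abs_mul, abs_mul, abs_of_nonneg (by positivity : 0 ≤ 2 * δ ^ 2),
        abs_of_nonneg (by positivity : 0 ≤ δ ^ 2 * n ^ 2 * s)]
      gcongr
    have a2 : (δ * α) ^ 2 ≤ s := by rw [hs]; linarith
    have a3 : δ * α ≤ s * t := by nlinarith
    calc |2 * δ ^ 2 * R * (t - s) - δ ^ 2 * n ^ 2 * s| * α
        ≤ (2 * δ ^ 2 * (α * n) * (2 * δ * n * (s * t)) + δ ^ 2 * n ^ 2 * s) * α := by gcongr
      _ = 4 * δ * n ^ 2 * (s * t) * (δ * α) ^ 2 + δ * n ^ 2 * s * (δ * α) := by ring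
      _ ≤ 4 * δ * n ^ 2 * (s * t) * s + δ * n ^ 2 * s * (s * t) :=
          add_le_add (mul_le_mul_of_nonneg_left a2 (by positivity))
            (mul_le_mul_of_nonneg_left a3 (by positivity))
      _ = _ := by ring
  refine (norm_add_le _ _).trans ?_
  rw [norm_smul, norm_smul, Real.norm_eq_abs, Real.norm_eq_abs]
  have c3 : |t⁻¹ - s⁻¹| * n ≤ 2 * δ * n * n := by gcongr
  change |t⁻¹ - s⁻¹| * n + |t⁻¹ - s⁻¹ + 2 * δ ^ 2 * (s ^ 2)⁻¹ * R| * α ≤ _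
  linarith

lemma tendsto_truncate (z : ℂ) :
    Tendsto (fun n : ℕ => truncate (1 / ((n : ℝ) + 1)) z) atTop (𝓝 z) := by
  have h := tendsto_one_div_add_atTop_nhds_zero_nat (𝕜 := ℝ)
  have h1 := ((((h.mul_const ‖z‖).pow 2).const_add 1).inv₀ (by simp)).smul_const z
  simpa [truncate] using h1

lemma tendsto_truncateDeriv (a b : ℂ) :
    Tendsto (fun n : ℕ => truncateDeriv (1 / ((n : ℝ) + 1)) a b) atTop (𝓝 b) := by
  have h := tendsto_one_div_add_atTop_nhds_zero_nat (𝕜 := ℝ)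
  have h0 := ((h.mul_const ‖a‖).pow 2).const_add 1
  have h1 := (h0.inv₀ (by simp)).smul_const b
  have h2 := (((((h.pow 2).const_mul 2).mul ((h0.pow 2).inv₀ (by simp))).mul_const
    ⟪a, b⟫_ℝ)).smul_const a
  have h3 := h1.sub h2
  simp only [truncateDeriv_apply]
  simpa using h3

end Truncation

section ChainRule

variable {d : ℕ} {e : Space d} {u g : Space d → ℂ}

/-- Chain rule for weak derivatives of `L²` functions, for a map `F` with a bounded differential `D`
and a quadratic Taylor remainder. Against a test function, the remainder of a difference quotient is
bounded by the squared `L²` norm of `u(· + s e) - u`, which is `o(s)`. -/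
lemma IsWeakDeriv.comp (hw : IsWeakDeriv e u g) (hu : MemLp u 2 volume) (hg : MemLp g 2 volume)
    {F : ℂ → ℂ} {D : ℂ → ℂ →L[ℝ] ℂ} {L K : ℝ} (hF : Continuous F)
    (hD : Continuous fun q : ℂ × ℂ => D q.1 q.2) (hFL : ∀ z, ‖F z‖ ≤ L * ‖z‖)
    (hDL : ∀ a b, ‖D a b‖ ≤ L * ‖b‖) (hK : ∀ a b, ‖F (a + b) - F a - D a b‖ ≤ K * ‖b‖ ^ 2) :
    MemLp (fun x => F (u x)) 2 volume ∧ MemLp (fun x => D (u x) (g x)) 2 volume ∧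
      IsWeakDeriv e (fun x => F (u x)) (fun x => D (u x) (g x)) := by
  have hFu : ∀ {w : Space d → ℂ}, MemLp w 2 volume → MemLp (fun x => F (w x)) 2 volume := by
    intro w hw
    exact hw.of_le_mul (hF.comp_aestronglyMeasurable hw.1) (Eventually.of_forall fun x => hFL _)
  have hDu : ∀ {w : Space d → ℂ}, MemLp w 2 volume → MemLp (fun x => D (u x) (w x)) 2 volume := by
    intro w hw
    exact hw.of_le_mul (hD.comp_aestronglyMeasurable (hu.1.prodMk hw.1))
      (Eventually.of_forall fun x => hDL _ _)
  refine ⟨hFu hu, hDu hg, isWeakDeriv_of_tendsto_slope ((hFu hu).locallyIntegrable (by norm_num))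
    ((hDu hg).locallyIntegrable (by norm_num)) fun η hη hc => ?_⟩
  have hm := memLp_ofReal_test hη hc
  obtain ⟨M, hM⟩ := hc.exists_bound_of_continuous hη.continuous
  have hM0 : 0 ≤ M := (norm_nonneg _).trans (hM 0)
  have hL0 : 0 ≤ L := by
    have := (norm_nonneg _).trans (hFL 1)
    simpa using this
  have hK0 : 0 ≤ K := by
    have := (norm_nonneg _).trans (hK 0 1)
    simpa using this
  have hus : ∀ s : ℝ, MemLp (fun x => u (x + s • e)) 2 volume := fun s =>
    hu.comp_measurePreserving (measurePreserving_translate (s • e))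
  set τ : ℝ → Lp ℂ 2 (volume : Measure (Space d)) := fun s => translate (s • e) (hu.toLp u) with hτ
  have hτ0 : τ 0 = hu.toLp u := by simp [hτ]
  -- the error of the linear approximation of the difference quotient
  have key : ∀ s : ℝ, ‖(∫ x, η x • F (u (x + s • e))) - (∫ x, η x • F (u x)) -
      s • ∫ x, η x • D (u x) (g x)‖ ≤
      L * ‖hm.toLp _‖ * ‖τ s - τ 0 - s • hg.toLp g‖ + M * K * ‖τ s - τ 0‖ ^ 2 := by
    intro s
    let Δ : Space d → ℂ := fun x => u (x + s • e) - u x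
    have hΔ : MemLp Δ 2 volume := (hus s).sub hu
    let ρ : Space d → ℂ := fun x => Δ x - s • g x
    have hρ : MemLp ρ 2 volume := hΔ.sub (hg.const_smul s)
    have eΔ : hΔ.toLp Δ = τ s - τ 0 := by rw [hτ0]; rfl
    have eρ : hρ.toLp ρ = τ s - τ 0 - s • hg.toLp g := by rw [hτ0]; rfl
    let Q : Space d → ℂ := fun x => F (u (x + s • e)) - F (u x) - D (u x) (Δ x)
    have hQ : MemLp Q 2 volume := ((hFu (hus s)).sub (hFu hu)).sub (hDu hΔ)
    have it : ∀ {w : Space d → ℂ}, MemLp w 2 volume → Integrable fun x => η x • w x := fun hw =>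
      integrable_test_smul hη hc (hw.locallyIntegrable (by norm_num))
    have e1 : (∫ x, η x • F (u (x + s • e))) - (∫ x, η x • F (u x)) -
        s • ∫ x, η x • D (u x) (g x) = (∫ x, η x • D (u x) (ρ x)) + ∫ x, η x • Q x := by
      rw [← integral_smul, ← integral_sub (it (hFu (hus s))) (it (hFu hu)),
        ← integral_add (it (hDu hρ)) (it hQ)]
      refine (integral_sub ((it (hFu (hus s))).sub (it (hFu hu))) ((it (hDu hg)).smul s)).symm.trans
        ?_
      congr 1
      funext x
      simp only [Q, ρ, Pi.sub_apply, Pi.smul_apply, map_sub, map_smul, smul_sub]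
      rw [smul_comm s (η x)]
      abel
    rw [e1]
    refine (norm_add_le _ _).trans (add_le_add ?_ ?_)
    · have h1 : ∫ x, η x • D (u x) (ρ x) = ⟪hm.toLp _, (hDu hρ).toLp _⟫_ℂ := by
        rw [inner_toLp_ofReal hm]
        apply integral_congr_ae
        filter_upwards [(hDu hρ).coeFn_toLp] with x hx
        rw [hx]
      rw [h1, ← eρ]
      refine (norm_inner_le_norm _ _).trans ?_
      have h2 : ‖(hDu hρ).toLp _‖ ≤ L * ‖hρ.toLp ρ‖ := by
        refine Lp.norm_le_mul_norm_of_ae_le_mul ?_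
        filter_upwards [(hDu hρ).coeFn_toLp, hρ.coeFn_toLp] with x h3 h4
        rw [h3, h4]
        exact hDL _ _
      calc ‖hm.toLp _‖ * ‖(hDu hρ).toLp _‖ ≤ ‖hm.toLp _‖ * (L * ‖hρ.toLp ρ‖) := by gcongr
        _ = _ := by ring
    · rw [← eΔ, norm_toLp_sq hΔ, ← integral_const_mul]
      have hΔi := (memLp_two_iff_integrable_sq_norm hΔ.1).1 hΔ
      refine norm_integral_le_of_norm_le (hΔi.const_mul _) (Eventually.of_forall fun x => ?_)
      rw [norm_smul, mul_assoc]
      refine mul_le_mul (hM x) ?_ (norm_nonneg _) hM0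
      have := hK (u x) (Δ x)
      simpa [Q, Δ] using this
  rw [hasDerivAt_iff_isLittleO]
  have hder : HasDerivAt τ (hg.toLp g) 0 := hasDerivAt_translate hw hu hg
  have o1 := (hasDerivAt_iff_isLittleO.1 hder).norm_left.const_mul_left (L * ‖hm.toLp _‖)
  have o2 : (fun s : ℝ => M * K * ‖τ s - τ 0‖ ^ 2) =o[𝓝 0] fun s : ℝ => s - 0 := by
    have b1 := hder.isBigO_sub.norm_left
    have b2 : (fun s : ℝ => ‖τ s - τ 0‖) =o[𝓝 0] fun _ => (1 : ℝ) := by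
      rw [Asymptotics.isLittleO_one_iff]
      have := (hder.continuousAt.tendsto.sub_const (τ 0)).norm
      simpa using this
    have b3 := (b1.mul_isLittleO b2).const_mul_left (M * K)
    simpa [pow_two] using b3
  refine (Asymptotics.IsBigO.of_bound 1 (Eventually.of_forall fun s => ?_)).trans_isLittleO
    (o1.add o2)
  have := key s
  simp only [zero_smul, add_zero, sub_zero, one_mul] at this ⊢
  exact this.trans (le_abs_self _)

end ChainRule

/-! ### Negativity of the minimal action, and subcritical rotation -/

section Negative

variable {d : ℕ} {V : Space d → ℝ} {u : Space d → ℂ} {Ω θ C p β : ℝ}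

lemma truncate_mem_energySpace (hVm : Measurable V) (hV0 : ∀ x, 0 ≤ V x) (hu : u ∈ energySpace V)
    {δ : ℝ} (hδ : 0 < δ) :
    (fun x => truncate δ (u x)) ∈ energySpace V ∧
      ∀ i, weakPartial i (fun x => truncate δ (u x)) =ᵐ[volume]
        fun x => truncateDeriv δ (u x) (weakPartial i u x) := by
  have hm : MemLp (fun x => truncate δ (u x)) 2 volume :=
    hu.1.of_le ((continuous_truncate δ).comp_aestronglyMeasurable hu.1.1)
      (Eventually.of_forall fun x => norm_truncate_le _ _)
  have key := fun i => IsWeakDeriv.comp (isWeakPartial_iff.1 (isWeakPartial_weakPartial hu i)) hu.1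
    (memLp_weakPartial hu i) (continuous_truncate δ) (continuous_truncateDeriv δ) (L := 3)
    (fun z => (norm_truncate_le δ z).trans (by linarith [norm_nonneg z])) (norm_truncateDeriv_le δ)
    (norm_truncate_add_sub_le hδ)
  refine ⟨⟨hm, fun i => ⟨_, (key i).2.2, (key i).2.1⟩, ?_⟩, fun i =>
    IsWeakPartial.weakPartial_ae_eq (key i).2.2⟩
  refine hu.2.2.mono (hVm.aestronglyMeasurable.mul (hm.1.norm.pow 2))
    (Eventually.of_forall fun x => ?_)
  have h1 := norm_truncate_le δ (u x)
  have h2 := hV0 x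
  rw [Real.norm_of_nonneg (by positivity), Real.norm_of_nonneg (by positivity)]
  gcongr

/-- Truncations are bounded functions in `L²`, hence in `L^{p+1}`. -/
lemma powerEnergy_truncate_ne_top (hp : 1 < p) (hu : MemLp u 2 volume) {δ : ℝ} (hδ : 0 < δ) :
    powerEnergy p β (fun x => truncate δ (u x)) ≠ ⊤ := by
  rw [powerEnergy, lintegral_enorm_rpow hp]
  refine ENNReal.mul_ne_top ENNReal.ofReal_ne_top (ne_of_lt ?_)
  have hi := ((memLp_two_iff_integrable_sq_norm hu.1).1 hu).const_mul (δ⁻¹ ^ (p - 1))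
  refine lt_of_le_of_lt (lintegral_mono fun x => ENNReal.ofReal_le_ofReal ?_) hi.lintegral_lt_top
  have h0 := norm_nonneg (truncate δ (u x))
  have e : p + 1 = (p - 1) + 2 := by ring
  rw [e, Real.rpow_add_of_nonneg h0 (by linarith) (by norm_num), Real.rpow_two]
  have h1 := norm_truncate_le δ (u x)
  have h2 := norm_truncate_le_inv hδ (u x)
  have h3 : 0 ≤ p - 1 := by linarith
  gcongr

lemma tendsto_integral_mul_norm_sq_sub {W : Space d → ℝ} (hW0 : ∀ x, 0 ≤ W x)
    {g : Space d → ℂ} {G : ℕ → Space d → ℂ} {K : ℝ} (hW : AEStronglyMeasurable W volume)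
    (hg : Integrable fun x => W x * ‖g x‖ ^ 2) (hgm : AEStronglyMeasurable g volume)
    (hG : ∀ n, AEStronglyMeasurable (G n) volume)
    (hb : ∀ n, ∀ x, ‖G n x‖ ≤ K * ‖g x‖)
    (hlim : ∀ x, Tendsto (fun n => G n x) atTop (𝓝 (g x))) :
    Tendsto (fun n => ∫ x, W x * ‖G n x - g x‖ ^ 2) atTop (𝓝 0) := by
  have h := tendsto_integral_of_dominated_convergence
    (F := fun n x => W x * ‖G n x - g x‖ ^ 2) (f := fun _ => (0 : ℝ)) (μ := volume)
    (fun x => (K + 1) ^ 2 * (W x * ‖g x‖ ^ 2))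
    (fun n => hW.mul (((hG n).sub hgm).norm.pow 2)) (hg.const_mul _)
    (fun n => Eventually.of_forall fun x => ?_) (Eventually.of_forall fun x => ?_)
  · simpa using h
  · have h1 : ‖G n x - g x‖ ≤ (K + 1) * ‖g x‖ := by
      refine (norm_sub_le _ _).trans ?_
      linarith [hb n x]
    have h2 := hW0 x
    rw [Real.norm_of_nonneg (by positivity)]
    calc W x * ‖G n x - g x‖ ^ 2 ≤ W x * ((K + 1) * ‖g x‖) ^ 2 := by gcongr
      _ = _ := by ring
  · have h1 := (((hlim x).sub_const (g x)).norm.pow 2).const_mul (W x)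
    simpa using h1

lemma aestronglyMeasurable_truncateDeriv (δ : ℝ) {g : Space d → ℂ}
    (hu : AEStronglyMeasurable u volume) (hg : AEStronglyMeasurable g volume) :
    AEStronglyMeasurable (fun x => truncateDeriv δ (u x) (g x)) volume := by
  have h := Continuous.comp_aestronglyMeasurable (f := fun x => (u x, g x))
    (g := fun q : ℂ × ℂ => truncateDeriv δ q.1 q.2) (continuous_truncateDeriv δ) (hu.prodMk hg)
  exact h

namespace RotationBound

/-- The truncations of `u` converge to `u` in the energy norm. -/
lemma tendsto_shiftedForm_truncate (h : RotationBound V Ω θ C)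
    (u : energySubmodule V h.measurable h.nonneg) (w : ℕ → energySubmodule V h.measurable h.nonneg)
    (hw : ∀ n, (w n).1 = fun x => truncate (1 / ((n : ℝ) + 1)) (u.1 x)) :
    Tendsto (fun n => h.shiftedForm (w n - u) (w n - u)) atTop (𝓝 0) := by
  have hu : u.1 ∈ energySpace V := u.2
  have hwp : ∀ n i, weakPartial i (w n).1 =ᵐ[volume]
      fun x => truncateDeriv (1 / ((n : ℝ) + 1)) (u.1 x) (weakPartial i u.1 x) := by
    intro n
    rw [hw]
    exact (truncate_mem_energySpace h.measurable h.nonneg hu Nat.one_div_pos_of_nat).2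
  have hsub : ∀ n, (w n - u).1 = fun x => truncate (1 / ((n : ℝ) + 1)) (u.1 x) - u.1 x := by
    intro n
    have : (w n - u).1 = (w n).1 - u.1 := rfl
    rw [this, hw n]
    rfl
  have h1 : ∀ i, Tendsto (fun n => ∫ x, ‖weakPartial i (w n - u).1 x‖ ^ 2) atTop (𝓝 0) := by
    intro i
    have hg := memLp_weakPartial hu i
    have hgi : Integrable fun x => (1 : ℝ) * ‖weakPartial i u.1 x‖ ^ 2 := by
      simpa using (memLp_two_iff_integrable_sq_norm hg.1).1 hg
    have hGm : ∀ n : ℕ, AEStronglyMeasurable (fun x =>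
        truncateDeriv (1 / ((n : ℝ) + 1)) (u.1 x) (weakPartial i u.1 x)) volume := fun n =>
      aestronglyMeasurable_truncateDeriv _ hu.1.1 hg.1
    have hlim := tendsto_integral_mul_norm_sq_sub (fun _ => zero_le_one) aestronglyMeasurable_const
      hgi hg.1 hGm (fun n x => norm_truncateDeriv_le _ (u.1 x) (weakPartial i u.1 x))
      (fun x => tendsto_truncateDeriv _ _)
    refine hlim.congr fun n => integral_congr_ae ?_
    have e : weakPartial i (w n - u).1 =ᵐ[volume]
        fun x => weakPartial i (w n).1 x - weakPartial i u.1 x := by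
      have e1 := isWeakPartial_weakPartial (w n).2 i
      have e2 := IsWeakDeriv.const_smul (isWeakPartial_weakPartial hu i) (-1)
      have e3 := IsWeakPartial.weakPartial_ae_eq (i := i) (IsWeakDeriv.add e1 e2)
      have e4 : (w n - u).1 = (w n).1 + (-1 : ℂ) • u.1 := by
        rw [neg_one_smul, ← sub_eq_add_neg]
        rfl
      rw [e4]
      filter_upwards [e3] with x hx
      rw [hx]
      simp [sub_eq_add_neg]
    filter_upwards [e, hwp n i] with x h1 h2
    rw [h1, h2, one_mul]
  have h2 : Tendsto (fun n => ∫ x, V x * ‖(w n - u).1 x‖ ^ 2) atTop (𝓝 0) := by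
    simp only [hsub]
    exact tendsto_integral_mul_norm_sq_sub (K := 1) h.nonneg h.measurable.aestronglyMeasurable
      hu.2.2 hu.1.1 (fun n => (continuous_truncate _).comp_aestronglyMeasurable hu.1.1)
      (fun n x => by simpa using norm_truncate_le _ _) (fun x => tendsto_truncate _)
  have h3 : Tendsto (fun n => mass (w n - u).1) atTop (𝓝 0) := by
    simp only [hsub, mass]
    have := tendsto_integral_mul_norm_sq_sub (W := fun _ => (1 : ℝ)) (K := 1) (g := u.1)
      (G := fun n x => truncate (1 / ((n : ℝ) + 1)) (u.1 x))
      (fun _ => zero_le_one) aestronglyMeasurable_const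
      (by simpa using (memLp_two_iff_integrable_sq_norm hu.1.1).1 hu.1) hu.1.1
      (fun n => (continuous_truncate _).comp_aestronglyMeasurable hu.1.1)
      (fun n x => by simpa using norm_truncate_le _ _) (fun x => tendsto_truncate _)
    simpa using this
  have h4 : Tendsto (fun n => gradPot V (w n - u).1) atTop (𝓝 0) := by
    have := ((tendsto_finsetSum Finset.univ fun i _ => h1 i).const_mul (1 / 2)).add h2
    simpa [gradPot] using this
  have h5 := (h4.const_mul 2).add (h3.const_mul (2 * (C / θ) + 1))
  simp only [mul_zero, add_zero] at h5
  refine squeeze_zero (fun n => ?_) (fun n => h.shiftedForm_le _) h5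
  exact (mass_nonneg _).trans (h.mass_le_shiftedForm _)

end RotationBound

lemma powerEnergy_smul (hp : 1 < p) {t : ℝ} (ht : 0 ≤ t) (u : Space d → ℂ) :
    powerEnergy p β (t • u) = ENNReal.ofReal (t ^ (p + 1)) * powerEnergy p β u := by
  rw [powerEnergy, powerEnergy, mul_left_comm]
  congr 1
  rw [← lintegral_const_mul' _ _ ENNReal.ofReal_ne_top]
  congr 1
  funext x
  rw [Pi.smul_apply, enorm_smul, ENNReal.mul_rpow_of_nonneg _ _ (by linarith),
    ← ofReal_norm t, Real.norm_of_nonneg ht, ENNReal.ofReal_rpow_of_nonneg ht (by linarith)]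

/-- If the quadratic part of the action is negative somewhere, so is the action: at a truncation the
power is finite, and near `0` it is of higher order than the quadratic part. -/
lemma RotationBound.exists_action_neg (h : RotationBound V Ω θ C) (hp : 1 < p) {ω : ℝ}
    (hu : u ∈ energySpace V) (hneg : quadraticEnergy V Ω u + ω * mass u < 0) :
    ∃ v : energySubmodule V h.measurable h.nonneg, powerEnergy p β v.1 ≠ ⊤ ∧
      quadraticEnergy V Ω v.1 + ω * mass v.1 + (powerEnergy p β v.1).toReal < 0 := by
  let u' : energySubmodule V h.measurable h.nonneg := ⟨u, hu⟩
  let w : ℕ → energySubmodule V h.measurable h.nonneg := fun n =>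
    ⟨fun x => truncate (1 / ((n : ℝ) + 1)) (u x),
      (truncate_mem_energySpace h.measurable h.nonneg hu Nat.one_div_pos_of_nat).1⟩
  have hlim := h.tendsto_shiftedForm_truncate u' w fun n => rfl
  have hm0 : ∀ u, 0 ≤ massForm h.measurable h.nonneg u u := fun u => by
    rw [massForm_self]
    exact mass_nonneg _
  have hms : ∀ u, massForm h.measurable h.nonneg u u ≤ h.shiftedForm u u := fun u => by
    rw [massForm_self]
    exact h.mass_le_shiftedForm u
  have hq := tendsto_apply_self h.shiftedForm_symm (fun u => (hm0 u).trans (hms u)) hlim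
  have hm := tendsto_apply_self massForm_symm hm0
    (squeeze_zero (fun n => hm0 _) (fun n => hms _) hlim)
  have hQ : ∀ v : energySubmodule V h.measurable h.nonneg,
      h.shiftedForm v v + (ω - (C / θ + 1)) * massForm h.measurable h.nonneg v v =
        quadraticEnergy V Ω v.1 + ω * mass v.1 := by
    intro v
    rw [h.shiftedForm_apply, h.energyForm_self, massForm_self]
    ring
  have hlim2 := hq.add (hm.const_mul (ω - (C / θ + 1)))
  simp only [hQ] at hlim2
  obtain ⟨n, hn⟩ := (hlim2.eventually_lt_const hneg).exists
  have hpw : powerEnergy p β (w n).1 ≠ ⊤ :=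
    powerEnergy_truncate_ne_top hp hu.1 Nat.one_div_pos_of_nat
  set a := quadraticEnergy V Ω (w n).1 + ω * mass (w n).1 with ha
  set b := (powerEnergy p β (w n).1).toReal with hb
  have hb0 : 0 ≤ b := ENNReal.toReal_nonneg
  have hp1 : 0 < p - 1 := by linarith
  -- the quadratic part dominates the power `p + 1 > 2` at a small multiple of `w n`
  set r := -a / (b + 1) with hr
  have hr0 : 0 < r := div_pos (by linarith) (by linarith)
  set t := r ^ (p - 1)⁻¹ with ht
  have ht0 : 0 < t := by positivity
  have htp : t ^ (p + 1) = t ^ 2 * r := by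
    have e : p + 1 = 2 + (p - 1) := by ring
    rw [e, Real.rpow_add ht0, Real.rpow_two, ht, ← Real.rpow_mul hr0.le,
      inv_mul_cancel₀ hp1.ne', Real.rpow_one]
  have hE : powerEnergy p β (t • w n).1 = ENNReal.ofReal (t ^ (p + 1)) * powerEnergy p β (w n).1 :=
    powerEnergy_smul hp ht0.le _
  refine ⟨t • w n, ?_, ?_⟩
  · rw [hE]
    exact ENNReal.mul_ne_top ENNReal.ofReal_ne_top hpw
  · rw [hE, ENNReal.toReal_mul, ENNReal.toReal_ofReal (by positivity), ← hQ, htp]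
    have e : h.shiftedForm (t • w n) (t • w n) +
        (ω - (C / θ + 1)) * massForm h.measurable h.nonneg (t • w n) (t • w n) = t ^ 2 * a := by
      rw [ha, ← hQ]
      simp only [map_smul, LinearMap.smul_apply, smul_eq_mul]
      ring
    rw [e, ← hb]
    have e2 : r * b < -a := by
      rw [hr, div_mul_eq_mul_div, div_lt_iff₀ (by linarith)]
      nlinarith
    have : t ^ 2 * (r * b) < t ^ 2 * (-a) := by gcongr
    linarith

end Negative

section Bound

variable {d : ℕ} {V : Space d → ℝ} {Ω : ℝ}

/-- A rotation below the critical speed is subordinate to the trap: if `|Ω| < γ` and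
`V - ½ γ² (x₁² + x₂²)` tends to infinity, then `θ = |Ω| / γ` works. -/
lemma exists_rotationBound (hVm : Measurable V) (hV0 : ∀ x, 0 ≤ V x)
    (hΩ : Ω = 0 ∨ (0 < |Ω| ∧ ((|Ω| : ℝ) : EReal) < OmegaMax V)) :
    ∃ θ C, RotationBound V Ω θ C := by
  rcases hΩ with rfl | ⟨hpos, hlt⟩
  · refine ⟨1 / 2, 0, hVm, hV0, by norm_num, by norm_num, le_rfl, fun x => ?_⟩
    have := hV0 x
    simp only [ne_eq, OfNat.ofNat_ne_zero, not_false_eq_true, zero_pow, zero_mul, zero_div]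
    positivity
  · obtain ⟨_, ⟨γ, ⟨hγ, hγV⟩, rfl⟩, hγΩ⟩ := lt_sSup_iff.1 hlt
    have hγΩ' : |Ω| < γ := EReal.coe_lt_coe_iff.1 hγΩ
    have hcont : Continuous (axisDistSq (d := d)) := by
      unfold axisDistSq
      split_ifs <;> fun_prop
    obtain ⟨s, hs, hsV⟩ := mem_cocompact.1 (hγV.eventually_ge_atTop 0)
    obtain ⟨K, hK⟩ := hs.exists_bound_of_continuousOn hcont.continuousOn
    have hγ2 : ∀ x, γ ^ 2 / 2 * axisDistSq x ≤ V x + γ ^ 2 / 2 * |K| := by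
      intro x
      by_cases hx : x ∈ s
      · have h1 : axisDistSq x ≤ |K| := ((le_abs_self _).trans (hK x hx)).trans (le_abs_self K)
        have h2 : γ ^ 2 / 2 * axisDistSq x ≤ γ ^ 2 / 2 * |K| := by gcongr
        linarith [hV0 x]
      · have h1 : 0 ≤ V x - γ ^ 2 / 2 * axisDistSq x := hsV hx
        have : 0 ≤ γ ^ 2 / 2 * |K| := by positivity
        linarith
    have hθ1 : |Ω| / γ < 1 := (div_lt_one hγ).2 hγΩ'
    refine ⟨|Ω| / γ, (|Ω| / γ) ^ 2 * (γ ^ 2 / 2 * |K|), hVm, hV0, div_pos hpos hγ, hθ1,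
      by positivity, fun x => ?_⟩
    have h1 := mul_le_mul_of_nonneg_left (hγ2 x) (sq_nonneg (|Ω| / γ))
    have h2 : (|Ω| / γ) ^ 2 * (γ ^ 2 / 2 * axisDistSq x) = Ω ^ 2 * axisDistSq x / 2 := by
      rw [div_pow, sq_abs]
      field_simp
    rw [h2] at h1
    linarith

end Bound

/-! ### Action ground states and duality -/

section Duality

variable {d : ℕ} {V : Space d → ℝ} {u : Space d → ℂ} {Ω θ C p β ω m : ℝ}

lemma mass_pos (hu : u ∈ energySpace V) (h0 : ¬ u =ᵐ[volume] 0) : 0 < mass u := by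
  refine (mass_nonneg u).lt_of_ne fun hm => h0 ?_
  have hi := (memLp_two_iff_integrable_sq_norm hu.1.1).1 hu.1
  have := (integral_eq_zero_iff_of_nonneg (fun x => by positivity) hi).1 hm.symm
  filter_upwards [this] with x hx
  simpa using hx

lemma exists_quadraticEnergy_add_neg (hω : (ω : EReal) < -lambda0 V Ω) :
    ∃ u ∈ energySpace V, quadraticEnergy V Ω u + ω * mass u < 0 := by
  have h1 : lambda0 V Ω < ((-ω : ℝ) : EReal) := by
    rw [EReal.coe_neg]
    exact EReal.lt_neg_comm.1 hω
  simp only [lambda0, iInf_lt_iff] at h1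
  obtain ⟨u, ⟨hu, hu0⟩, h2⟩ := h1
  have h3 := mass_pos hu hu0
  rw [EReal.coe_lt_coe_iff, div_lt_iff₀ h3] at h2
  exact ⟨u, hu, by linarith⟩

/-- Below the threshold `-λ₀(Ω)` the action attains its minimum over the whole energy space, at a
nonzero function, which is stationary and hence an action ground state. -/
theorem RotationBound.exists_actionGroundState (h : RotationBound V Ω θ C)
    (hV : Tendsto V (cocompact (Space d)) atTop) (hp : 1 < p) (hβ : 0 < β)
    (hω : (ω : EReal) < -lambda0 V Ω) :
    ∃ u ∈ actionGroundStates V p β Ω ω, ∀ v ∈ energySpace V,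
      action V p β Ω ω u ≤ action V p β Ω ω v := by
  obtain ⟨u, hu, hmin⟩ := h.exists_minimizer hV hp hβ ω
  have hst := h.isStationary_of_minimizer hp hβ ω u hu hmin
  have hle : ∀ v ∈ energySpace V, action V p β Ω ω u.1 ≤ action V p β Ω ω v := by
    intro v hv
    rw [action_eq, action_eq]
    by_cases hvp : powerEnergy p β v = ⊤
    · rw [hvp, EReal.coe_ennreal_top, EReal.coe_add_top]
      exact le_top
    · have h1 := hmin ⟨v, hv⟩ hvp
      rw [← EReal.coe_ennreal_toReal hu, ← EReal.coe_ennreal_toReal hvp, ← EReal.coe_add,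
        ← EReal.coe_add, EReal.coe_le_coe_iff]
      exact h1
  -- a function that vanishes almost everywhere has nonnegative action
  have hne : ¬ u.1 =ᵐ[volume] 0 := by
    intro h0
    have hm : mass u.1 = 0 := by
      rw [mass, integral_congr_ae (g := fun _ => (0 : ℝ))]
      · simp
      · filter_upwards [h0] with x hx
        simp [hx]
    obtain ⟨v, hv, hvneg⟩ := exists_quadraticEnergy_add_neg hω
    obtain ⟨w, hw, hwneg⟩ := h.exists_action_neg (β := β) hp hv hvneg
    have h1 := hmin w hw
    have h2 := h.le_quadraticEnergy u.2
    have h3 := mul_nonneg (sub_nonneg.2 h.lt_one.le) (gradPot_nonneg h.nonneg u.1)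
    have h4 : 0 ≤ (powerEnergy p β u.1).toReal := ENNReal.toReal_nonneg
    rw [hm] at h1 h2
    linarith
  exact ⟨u.1, ⟨⟨hst, hne⟩, fun v hv _ => hle v hv.1⟩, hle⟩

lemma RotationBound.action_le_of_mem_actionGroundStates (h : RotationBound V Ω θ C)
    (hV : Tendsto V (cocompact (Space d)) atTop) (hp : 1 < p) (hβ : 0 < β)
    (hω : (ω : EReal) < -lambda0 V Ω) (hu : u ∈ actionGroundStates V p β Ω ω) {v : Space d → ℂ}
    (hv : v ∈ energySpace V) : action V p β Ω ω u ≤ action V p β Ω ω v := by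
  obtain ⟨g, hg, hgle⟩ := h.exists_actionGroundState hV hp hβ hω
  exact (hu.2 g hg.1.1 hg.1.2).trans (hgle v hv)

lemma lagrangian_eq_action_sub (V : Space d → ℝ) (p β Ω m : ℝ) (u : Space d → ℂ) (ω : ℝ) :
    lagrangian V p β Ω m u ω = action V p β Ω ω u - ((ω * m : ℝ) : EReal) := by
  have e : ω * (mass u - m) = ω * mass u + -(ω * m) := by ring
  rw [lagrangian, action, e, EReal.coe_add, EReal.coe_neg, ← add_assoc, ← sub_eq_add_neg]

lemma lagrangian_of_mass_eq (hu : mass u = m) : lagrangian V p β Ω m u ω = energy V p β Ω u := by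
  simp [lagrangian, hu]

/-- An action ground state minimizes the Lagrangian over the energy space. -/
lemma RotationBound.lagrangian_le_of_mem_actionGroundStates (h : RotationBound V Ω θ C)
    (hV : Tendsto V (cocompact (Space d)) atTop) (hp : 1 < p) (hβ : 0 < β)
    (hω : (ω : EReal) < -lambda0 V Ω) (hu : u ∈ actionGroundStates V p β Ω ω) {v : Space d → ℂ}
    (hv : v ∈ energySpace V) : lagrangian V p β Ω m u ω ≤ lagrangian V p β Ω m v ω := by
  rw [lagrangian_eq_action_sub, lagrangian_eq_action_sub]
  exact EReal.sub_le_sub (h.action_le_of_mem_actionGroundStates hV hp hβ hω hu hv) le_rfl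

lemma RotationBound.iInf_lagrangian_eq (h : RotationBound V Ω θ C)
    (hV : Tendsto V (cocompact (Space d)) atTop) (hp : 1 < p) (hβ : 0 < β)
    (hω : (ω : EReal) < -lambda0 V Ω) :
    ⨅ u ∈ energySpace V, lagrangian V p β Ω m u ω =
      groundAction V p β Ω ω - ((ω * m : ℝ) : EReal) := by
  obtain ⟨g, hg, -⟩ := h.exists_actionGroundState hV hp hβ hω
  have h1 : groundAction V p β Ω ω = action V p β Ω ω g :=
    le_antisymm (iInf₂_le g hg) (le_iInf₂ fun v hv => hg.2 v hv.1.1 hv.1.2)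
  rw [h1, ← lagrangian_eq_action_sub]
  exact le_antisymm (iInf₂_le g hg.1.1.1)
    (le_iInf₂ fun v hv => h.lagrangian_le_of_mem_actionGroundStates hV hp hβ hω hg hv)

lemma dualEnergy_le_minEnergy (V : Space d → ℝ) (p β Ω m : ℝ) :
    dualEnergy V p β Ω m ≤ minEnergy V p β Ω m := by
  refine iSup₂_le fun ω _ => le_iInf₂ fun u hu => iInf₂_le_of_le u hu.1 ?_
  rw [lagrangian_of_mass_eq hu.2]

lemma RotationBound.minEnergy_le_dualEnergy (h : RotationBound V Ω θ C)
    (hV : Tendsto V (cocompact (Space d)) atTop) (hp : 1 < p) (hβ : 0 < β)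
    (hω : (ω : EReal) < -lambda0 V Ω) (hm : m ∈ groundMasses V p β Ω ω) :
    minEnergy V p β Ω m ≤ dualEnergy V p β Ω m := by
  obtain ⟨g, hg, hgm⟩ := hm
  calc minEnergy V p β Ω m ≤ energy V p β Ω g := iInf₂_le g ⟨hg.1.1.1, hgm⟩
    _ = lagrangian V p β Ω m g ω := (lagrangian_of_mass_eq hgm).symm
    _ ≤ ⨅ u ∈ energySpace V, lagrangian V p β Ω m u ω :=
      le_iInf₂ fun v hv => h.lagrangian_le_of_mem_actionGroundStates hV hp hβ hω hg hv
    _ ≤ dualEnergy V p β Ω m :=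
      le_iSup₂ (f := fun ω (_ : ω ∈ {ω : ℝ | (ω : EReal) < -lambda0 V Ω}) =>
        ⨅ u ∈ energySpace V, lagrangian V p β Ω m u ω) ω hω

end Duality

end RNLS

theorem mainTheorem8 (d : ℕ) (hd : 1 ≤ d)
    (V : RNLS.Space d → ℝ) (hVm : Measurable V) (hV0 : ∀ x, 0 ≤ V x)
    (hV : Tendsto V (cocompact (RNLS.Space d)) atTop)
    (p : ℝ) (hp : 1 < p) (hpd : 3 ≤ d → p < ((d : ℝ) + 2) / ((d : ℝ) - 2))
    (β : ℝ) (hβ : 0 < β)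
    (Ω : ℝ) (hΩ : Ω = 0 ∨ (0 < |Ω| ∧ ((|Ω| : ℝ) : EReal) < RNLS.OmegaMax V)) :
    -- the two forms of the dual value agree
    (∀ m : ℝ, 0 < m →
      RNLS.dualEnergy V p β Ω m =
        ⨆ ω ∈ {ω : ℝ | (ω : EReal) < -RNLS.lambda0 V Ω},
          (RNLS.groundAction V p β Ω ω - ((ω * m : ℝ) : EReal))) ∧
    -- weak duality
    (∀ m : ℝ, 0 < m → RNLS.dualEnergy V p β Ω m ≤ RNLS.minEnergy V p β Ω m) ∧
    -- strong duality
    (∀ ω : ℝ, (ω : EReal) < -RNLS.lambda0 V Ω →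
      ∀ m ∈ RNLS.massInterval V p β Ω ω, m ∈ RNLS.groundMasses V p β Ω ω →
        RNLS.dualEnergy V p β Ω m = RNLS.minEnergy V p β Ω m) := by
  obtain ⟨θ, C, h⟩ := RNLS.exists_rotationBound hVm hV0 hΩ
  refine ⟨fun m _ => ?_, fun m _ => RNLS.dualEnergy_le_minEnergy V p β Ω m, fun ω hω m _ hm => ?_⟩
  · exact iSup_congr fun ω => iSup_congr fun hω => h.iInf_lagrangian_eq hV hp hβ hω
  · exact le_antisymm (RNLS.dualEnergy_le_minEnergy V p β Ω m)
      (h.minEnergy_le_dualEnergy hV hp hβ hω hm)
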